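/- **Setting.** Let $H\in(-1/2,1/2)$, $T>0$, $K(t)=\frac{t^{H-1/2}}{\Gamma(H+1/2)}$ and $c_H=\frac{1}{\Gamma(H+1/2)\Gamma(1/2-H)}$. For $\beta>0$, $c>1$, $a>0$ and $N\in\mathbb N$ let $m=\mathrm{rd}\big(\beta\sqrt{(1/2+H)N}\big)$ and $n=\mathrm{rd}\big(\frac1\beta\sqrt{N/(1/2+H)}\big)$, where $\mathrm{rd}$ rounds to the nearest positive integer, and let $$\xi_0=0,\qquad \xi_1=a,\qquad \xi_{i+1}=\left(\frac{c+\xi_i^{(1/2+H)/(2m)}}{c-\xi_i^{(1/2+H)/(2m)}}\right)^2\xi_i,\quad i=1,\dots,n-1,$$ where $\xi_i^{(1/2+H)/(2m)}<c$ is required for $i=1,\dots,n-1$. The non-geometric Gaussian rule of type $(H,N,c,\beta,a)$ consists of the $m$ nodes and weights of Gaussian quadrature of level $m$ on $[0,\xi_1]$ with weight function $c_Hx^{-H-1/2}$, and, for $i=1,\dots,n-1$, of the $m$ nodes $x_j$ of Gaussian quadrature of level $m$ on $[\xi_i,\xi_{i+1}]$ with weight function $1$, with weights $w_j=c_H\widetilde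 w_jx_j^{-H-1/2}$, where $\widetilde w_j$ are the Gaussian weights. Put $K^N(t)=\sum_{j=1}^{mn}w_je^{-x_jt}$. Let $\eta=\eta(c,\beta)$ be the solution of $$\frac{\mathrm d\eta_t}{\mathrm dt}=2\log\left(1+\frac{2e^{\eta_t/(2\beta^2)}}{c-e^{\eta_t/(2\beta^2)}}\right),\qquad \eta_0=0,$$ which explodes at the finite time $T_0(c,\beta)$ at which $e^{\eta_t/(2\beta^2)}$ reaches $c$ (there the right-hand side becomes infinite). Call $(c_0,\beta_0)$ with $c_0>1$, $\beta_0>0$ a threshold pair if $T_0(c_0,\beta_0)=1$. **Theorem.** (i) For $c_0=3.60585021$ there is exactly one $\beta_0>0$ such that $(c_0,\beta_0)$ is a threshold pair; it satisfies $|\beta_0-0.92995|<5\cdot10^{-6}$, and with $\eta_1(c_0,\beta_0)=\lim_{t\uparrow1}\eta_t(c_0,\beta_0)$ we have $\left|\frac{\eta_1(c_0,\beta_0)}{\beta_0}-2.3854\right|<5\cdot10^{-5}$. (ii) Let $(c_0,\beta_0)$ be any threshold pair, $H\in(-1/2,1/2)$, $T>0$ and $a>0$. Let $c\ge c_0$ and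 $\beta\ge\beta_0$ with $c>c_0$ or $\beta>\beta_0$. Then $\eta(c,\beta)$ exists on $[0,1]$ (with $e^{\eta_t/(2\beta^2)}<c$ there), the non-geometric Gaussian rule of type $(H,N,c,\beta,a)$ exists for all sufficiently large $N$, and as $N\to\infty$ $$\int_0^T|K(t)-K^N(t)|\,\mathrm dt\le(1+o(1))\,\frac{c_H}{H+1/2}\,\xi_n^{-1/2-H},$$ where, with two-sided positive bounds that are independent of $N$, $$\frac{c_H}{H+1/2}\,\xi_n^{-1/2-H}=\Theta(1)\exp\left(-\frac{\eta_1(c,\beta)}{\beta}\sqrt{(H+1/2)N}\right).$$ (iii) In the situation of (ii), with $H,T,a$ fixed, the higher order terms in the first bound explode at the threshold: for all $\gamma>0$ and $C\in\mathbb R$, if $(c,\beta)$ as in (ii) is sufficiently close to $(c_0,\beta_0)$, then $$\int_0^T|K(t)-K^N(t)|\,\mathrm dt>\left(1+Ce^{-\gamma\sqrt N}\right)\frac{c_H}{H+1/2}\,\xi_n^{-1/2-H}$$ for infinitely many $N$. The leading constant in the second bound explodes as well: for every $C\in\mathbb R$, if $(c,\beta)$ as in (ii) is sufficiently close to $(c_0,\beta_0)$,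 then for all sufficiently large $N$ $$\frac{c_H}{H+1/2}\,\xi_n^{-1/2-H}\ge C\exp\left(-\frac{\eta_1(c,\beta)}{\beta}\sqrt{(H+1/2)N}\right).$$ -/

import Mathlib

open Filter Topology Set Asymptotics

noncomputable section

namespace RoughKernel

/-- The fractional kernel `K(t) = t^(H-1/2) / Γ(H+1/2)`. -/
def fracKernel (H t : ℝ) : ℝ := t ^ (H - 1 / 2) / Real.Gamma (H + 1 / 2)

/-- The constant `c_H = 1 / (Γ(H+1/2) Γ(1/2-H))`. -/
def cH (H : ℝ) : ℝ := 1 / (Real.Gamma (H + 1 / 2) * Real.Gamma (1 / 2 - H))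

/-- Rounding of a real number to the nearest positive integer. -/
def rd (x : ℝ) : ℕ := max 1 (round x).toNat

/-- The level `m = rd (β √((1/2+H) N))` of the Gaussian quadrature formulas. -/
def level (H β : ℝ) (N : ℕ) : ℕ := rd (β * √((1 / 2 + H) * N))

/-- The number `n = rd (β⁻¹ √(N / (1/2+H)))` of intervals. -/
def numIntervals (H β : ℝ) (N : ℕ) : ℕ := rd (1 / β * √(N / (1 / 2 + H)))

/-- The recursion `ξ₀ = 0`, `ξ₁ = a`, `ξ_{i+1} = ((c + ξ_i^s) / (c - ξ_i^s))² ξ_i`. -/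
def xiAux (c a s : ℝ) : ℕ → ℝ
  | 0 => 0
  | 1 => a
  | i + 2 =>
    ((c + xiAux c a s (i + 1) ^ s) / (c - xiAux c a s (i + 1) ^ s)) ^ 2 * xiAux c a s (i + 1)

/-- The exponent `(1/2+H) / (2m)` in the recursion for the interval end points. -/
def xiExponent (H β : ℝ) (N : ℕ) : ℝ := (1 / 2 + H) / (2 * (level H β N : ℝ))

/-- The end points `ξ_i` of the intervals of the rule of type `(H, N, c, β, a)`. -/
def xi (H c β a : ℝ) (N : ℕ) (i : ℕ) : ℝ := xiAux c a (xiExponent H β N) i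

/-- `x` are the nodes (in increasing order) and `w` the weights of the Gaussian quadrature formula
of level `m` on `[p, q]` for the weight function `ρ`: an `m`-point formula on `[p, q]` that is
exact for all polynomials of degree at most `2m - 1`. -/
structure IsGaussQuadrature (ρ : ℝ → ℝ) (p q : ℝ) (m : ℕ) (x w : Fin m → ℝ) : Prop where
  strictMono : StrictMono x
  mem : ∀ j, x j ∈ Icc p q
  exact : ∀ P : Polynomial ℝ, P.degree < ((2 * m : ℕ) : WithBot ℕ) →
    ∫ y in p..q, P.eval y * ρ y = ∑ j, w j * P.eval (x j)

/-- `x` and `w` are the nodes and weights of the non-geometric Gaussian rule of type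
`(H, N, c, β, a)`. The `m n` nodes are indexed by pairs: `x i j` is the `j`-th node in the
interval `[ξ_i, ξ_{i+1}]`. -/
structure IsNonGeometricRule (H c β a : ℝ) (N : ℕ)
    (x w : Fin (numIntervals H β N) → Fin (level H β N) → ℝ) : Prop where
  wellDefined : ∀ i : ℕ, 1 ≤ i → i < numIntervals H β N →
    xi H c β a N i ^ xiExponent H β N < c
  first : ∀ i : Fin (numIntervals H β N), (i : ℕ) = 0 →
    IsGaussQuadrature (fun y => cH H * y ^ (-H - 1 / 2))
      (xi H c β a N 0) (xi H c β a N 1) (level H β N) (x i) (w i)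
  rest : ∀ i : Fin (numIntervals H β N), 1 ≤ (i : ℕ) →
    ∃ v : Fin (level H β N) → ℝ,
      IsGaussQuadrature (fun _ => 1)
        (xi H c β a N i) (xi H c β a N (i + 1)) (level H β N) (x i) v ∧
      ∀ j, w i j = cH H * v j * x i j ^ (-H - 1 / 2)

/-- The approximation `K^N(t) = ∑ w_j exp(-x_j t)`. -/
def approxKernel {n m : ℕ} (x w : Fin n → Fin m → ℝ) (t : ℝ) : ℝ :=
  ∑ i, ∑ j, w i j * Real.exp (-x i j * t)

/-- The error `∫_0^T |K(t) - K^N(t)| dt`. -/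
def kernelError (H T : ℝ) {n m : ℕ} (x w : Fin n → Fin m → ℝ) : ℝ :=
  ∫ t in (0 : ℝ)..T, |fracKernel H t - approxKernel x w t|

/-- The bound `c_H / (H+1/2) * ξ_n^(-1/2-H)`. -/
def leadingTerm (H c β a : ℝ) (N : ℕ) : ℝ :=
  cH H / (H + 1 / 2) * xi H c β a N (numIntervals H β N) ^ (-1 / 2 - H)

/-- `η` solves, on the time set `s`, the initial value problem
`η' = 2 log (1 + 2 e^(η/(2β²)) / (c - e^(η/(2β²))))`, `η 0 = 0`, staying in the region
`e^(η/(2β²)) < c` in which the right-hand side is defined. -/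
structure IsEtaSolution (c β : ℝ) (s : Set ℝ) (η : ℝ → ℝ) : Prop where
  initial : η 0 = 0
  lt : ∀ t ∈ s, Real.exp (η t / (2 * β ^ 2)) < c
  deriv : ∀ t ∈ s, HasDerivWithinAt η
    (2 * Real.log (1 + 2 * Real.exp (η t / (2 * β ^ 2)) / (c - Real.exp (η t / (2 * β ^ 2))))) s t

/-- The solution `η` for the parameters `c, β` explodes exactly at time `1`: it exists on `[0, 1)`,
and as `t ↑ 1` it reaches the boundary `e^(η/(2β²)) = c`, at which the right-hand side of the
equation becomes infinite. -/
structure ExplodesAtOne (c β : ℝ) (η : ℝ → ℝ) : Prop where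
  solution : IsEtaSolution c β (Ico 0 1) η
  explodes : Tendsto (fun t => Real.exp (η t / (2 * β ^ 2))) (𝓝[<] 1) (𝓝 c)

/-- `(c₀, β₀)` is a threshold pair: the solution of the equation explodes exactly at time `1`. -/
def IsThreshold (c₀ β₀ : ℝ) : Prop := 0 < β₀ ∧ ∃ η, ExplodesAtOne c₀ β₀ η

/-- The parameters `(c, β)` with `c ≥ c₀`, `β ≥ β₀`, and `c > c₀` or `β > β₀`. -/
def admissible (c₀ β₀ : ℝ) : Set (ℝ × ℝ) :=
  {p | c₀ ≤ p.1 ∧ β₀ ≤ p.2 ∧ (c₀ < p.1 ∨ β₀ < p.2)}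

end RoughKernel

end

/-! Put α = H + 1/2. The kernel is a Laplace transform, K(t) = c_H ∫₀^∞ y^(-α) e^(-ty) dy
(`fracKernel_eq_laplace`), and K^N replaces the integral over [0, ξ_n] by composite Gauss
quadrature. The derivatives of even order of the integrands are nonnegative, so Gauss quadrature
never overestimates (`hermite_le`, `IsGaussQuadrature.error_nonneg`). Hence K - K^N ≥ 0, and the
L¹-error is exactly the sum of the time-integrated errors of the intervals and of the truncation at
ξ_n (`IsCompositeRule.kernelError_eq`). The truncation yields the leading term c_H ξ_n^(-α)/α, up to
a tiny correction.

Integration in t turns the integrand into y^(-α-1) (1 - e^(-Ty)). On [p, q] = [ξ_k, ξ_{k+1}] a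
comparison of derivatives reduces its error to that of 1/y, which Chebyshev polynomials control: if
cosh θ = (q+p)/(q-p), it is about e^(-2mθ), up to powers of m and factors depending on p, q, θ
(`IsGaussQuadrature.error_inv_le`, `IsGaussQuadrature.le_error_inv`).

The recursion is made for this bound. Let s = α/(2m) and ξ_k^s = c e^(u_k). Then u_{k+1} = u_k + s
rate(u_k) and θ = -u_k (`xi_eq_exp`, `GridNeg.cosh_eq`), so that ξ_k^(-α) e^(-2mθ) = c^(-2m) on
every interval. The leading term is a constant times e^(-2m(u_n + log c)); relative to it, the
intervals matter like e^(2m u_n) up to powers of m, which is negligible as long as u_n stays below a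
negative constant.

The u_k form the Euler scheme of u' = rate(u) with n s = 1/(2β²) + O(s), and η/(2β²) - log c is this
flow at time t/(2β²). The function `travel` = ∫ 1/rate straightens the flow into a translation;
since 1/rate extends continuously by 0 to the boundary, the explosion time is finite, and (c, β) is
a threshold pair iff travel(-log c) + 1/(2β²) = 0 (`isThreshold_iff`). For admissible pairs the flow
ends at V = `endPoint` < 0 and u_n = V + O(s) (`exists_abs_gridPoint_sub_le`); as 2ms = α, the
leading term changes only by a bounded factor.

Near the threshold V tends to 0 from below. The last interval alone then has relative error about
e^(2mV), which beats e^(-γ√N) because m is close to β√(αN) (`eventually_lt_kernelError`). Moreover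
the Euler scheme lags behind the convex flow by a time of at least s·`lag`, where `lag` contains
(1/4) log rate(V) (`travel_step_add_log_le`). In the leading term this gives a factor exp(α rate(V)
lag / 2), which is unbounded (`eventually_eventually_le_leadingTerm`).

The numerical values come from -2 travel(x) = ∫_{v/2}^v coth(y)/y dy - log 2 with v = rate(x)/2
(`travel_eq_integral_cothDiv`) and Taylor enclosures. -/

noncomputable section

namespace RoughKernel

/-! ### Rolle's theorem and Hermite interpolation -/

/-- Rolle: between `k + 1` zeros there are `k` zeros of the derivative, distinct from the former. -/
theorem exists_zeros_deriv {g g' : ℝ → ℝ} {p q : ℝ} (hg : ∀ x ∈ Icc p q, HasDerivAt g (g' x) x)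
    {k : ℕ} (Z : Finset ℝ) (hZ : ∀ z ∈ Z, z ∈ Icc p q ∧ g z = 0) (hc : Z.card = k + 1) :
    ∃ Z' : Finset ℝ, (∀ z ∈ Z', z ∈ Icc p q ∧ g' z = 0) ∧ Z'.card = k ∧ Disjoint Z' Z := by
  classical
  let e := Z.orderEmbOfFin hc
  have he : ∀ i, e i ∈ Z := fun i => Z.orderEmbOfFin_mem hc i
  have hlt : ∀ i : Fin k, e i.castSucc < e i.succ := fun i =>
    (e.lt_iff_lt).2 Fin.castSucc_lt_succ
  have key : ∀ i : Fin k, ∃ ζ ∈ Ioo (e i.castSucc) (e i.succ), g' ζ = 0 := by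
    intro i
    have h1 := (hZ _ (he i.castSucc))
    have h2 := (hZ _ (he i.succ))
    have hsub : ∀ x ∈ Icc (e i.castSucc) (e i.succ), x ∈ Icc p q := fun x hx =>
      ⟨h1.1.1.trans hx.1, hx.2.trans h2.1.2⟩
    exact exists_hasDerivAt_eq_zero (hlt i)
      (fun x hx => (hg x (hsub x hx)).continuousAt.continuousWithinAt)
      (h1.2.trans h2.2.symm) (fun x hx => hg x (hsub x ⟨hx.1.le, hx.2.le⟩))
  choose ζ hζ hζ0 using key
  have hmono : StrictMono ζ := by
    intro i j hij
    have : e i.succ ≤ e j.castSucc := e.monotone (by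
      rw [Fin.le_def]; simpa using hij)
    exact (hζ i).2.trans_le (this.trans (hζ j).1.le)
  refine ⟨Finset.univ.image ζ, ?_, ?_, ?_⟩
  · intro z hz
    obtain ⟨i, -, rfl⟩ := Finset.mem_image.1 hz
    exact ⟨⟨(hZ _ (he i.castSucc)).1.1.trans (hζ i).1.le,
      (hζ i).2.le.trans (hZ _ (he i.succ)).1.2⟩, hζ0 i⟩
  · rw [Finset.card_image_of_injective _ hmono.injective]; simp
  · rw [Finset.disjoint_left]
    intro z hz hzZ
    obtain ⟨i, -, rfl⟩ := Finset.mem_image.1 hz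
    have : ζ i ∈ Set.range e := by
      rw [Finset.range_orderEmbOfFin]; exact hzZ
    obtain ⟨j, hj⟩ := this
    have h1 := (hζ i).1
    have h2 := (hζ i).2
    rw [← hj, e.lt_iff_lt, Fin.lt_def] at h1 h2
    simp at h1 h2
    omega

theorem exists_zero_iterated {F : ℕ → ℝ → ℝ} {p q : ℝ} {k : ℕ}
    (hF : ∀ j < k, ∀ x ∈ Icc p q, HasDerivAt (F j) (F (j + 1) x) x) (Z : Finset ℝ)
    (hZ : ∀ z ∈ Z, z ∈ Icc p q ∧ F 0 z = 0) (hc : k < Z.card) :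
    ∃ ζ ∈ Icc p q, F k ζ = 0 := by
  induction k generalizing F Z with
  | zero =>
    obtain ⟨z, hz⟩ := Finset.card_pos.1 hc
    exact ⟨z, hZ z hz⟩
  | succ k ih =>
    obtain ⟨Z', hZ', hc', -⟩ := exists_zeros_deriv (hF 0 (by omega)) (k := Z.card - 1) Z hZ
      (by omega)
    exact ih (F := fun j => F (j + 1)) (fun j hj x hx => hF (j + 1) (by omega) x hx) Z' hZ'
      (by omega)

-- The interpolant is A + N B: N is the nodal polynomial, A interpolates the values, and B corrects
-- the derivatives. At a node (N B)' = N' B, and N' does not vanish there because the nodes are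
-- distinct.
open Polynomial in
theorem exists_hermite {m : ℕ} {x : Fin m → ℝ} (hx : Function.Injective x) (y d : Fin m → ℝ) :
    ∃ P : ℝ[X], P.degree < ((2 * m : ℕ) : WithBot ℕ) ∧
      ∀ j, P.eval (x j) = y j ∧ (derivative P).eval (x j) = d j := by
  classical
  have hinj : Set.InjOn x (Finset.univ : Finset (Fin m)) := hx.injOn
  set N := Lagrange.nodal Finset.univ x
  set A := Lagrange.interpolate Finset.univ x y
  have hN' : ∀ j, (derivative N).eval (x j) ≠ 0 := by
    intro j
    rw [Lagrange.eval_nodal_derivative_eval_node_eq (Finset.mem_univ j), Lagrange.eval_nodal]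
    refine Finset.prod_ne_zero_iff.2 fun i hi => sub_ne_zero.2 fun h => ?_
    exact (Finset.ne_of_mem_erase hi) (hx h).symm
  set B := Lagrange.interpolate Finset.univ x
    fun j => (d j - (derivative A).eval (x j)) / (derivative N).eval (x j)
  have hA : A.degree < (m : WithBot ℕ) := by
    have := Lagrange.degree_interpolate_lt (s := Finset.univ) (v := x) y hinj
    rwa [Finset.card_univ, Fintype.card_fin] at this
  have hB : B.degree < (m : WithBot ℕ) := by
    have := Lagrange.degree_interpolate_lt (s := Finset.univ) (v := x)
      (fun j => (d j - (derivative A).eval (x j)) / (derivative N).eval (x j)) hinj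
    rwa [Finset.card_univ, Fintype.card_fin] at this
  have hND : N.degree = (m : WithBot ℕ) := by
    have := Lagrange.degree_nodal (R := ℝ) (s := Finset.univ) (v := x)
    rwa [Finset.card_univ, Fintype.card_fin] at this
  have hN0 : ∀ j, N.eval (x j) = 0 := fun j => Lagrange.eval_nodal_at_node (Finset.mem_univ j)
  refine ⟨A + N * B, ?_, fun j => ⟨?_, ?_⟩⟩
  · refine (degree_add_le _ _).trans_lt (max_lt (hA.trans_le ?_) ?_)
    · exact_mod_cast (by omega : m ≤ 2 * m)
    · rw [degree_mul, hND]
      by_cases hB0 : B = 0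
      · rw [hB0]; simp only [degree_zero, WithBot.add_bot]; exact WithBot.bot_lt_coe _
      · rw [degree_eq_natDegree hB0] at hB ⊢
        have : B.natDegree < m := by exact_mod_cast hB
        exact_mod_cast (by omega : m + B.natDegree < 2 * m)
  · have : A.eval (x j) = y j := Lagrange.eval_interpolate_at_node _ hinj (Finset.mem_univ j)
    simp [hN0, this]
  · have : B.eval (x j) = (d j - (derivative A).eval (x j)) / (derivative N).eval (x j) :=
      Lagrange.eval_interpolate_at_node _ hinj (Finset.mem_univ j)
    simp [hN0, this, mul_div_cancel₀ _ (hN' j)]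

theorem hasDerivAt_iteratedDeriv {f : ℝ → ℝ} {n k : ℕ} {x : ℝ} (hf : ContDiffAt ℝ n f x)
    (hk : k < n) : HasDerivAt (iteratedDeriv k f) (iteratedDeriv (k + 1) f x) x := by
  have h : DifferentiableAt ℝ (iteratedDeriv k f) x := by
    have := (contDiffWithinAt_univ.2 hf).differentiableWithinAt_iteratedDerivWithin
      (m := k) (by exact_mod_cast hk) (by simp)
    simpa [iteratedDerivWithin_univ, differentiableWithinAt_univ] using this
  rw [iteratedDeriv_succ]
  exact h.hasDerivAt

open Polynomial in
/-- A function with nonnegative derivative of order `2m` lies above its Hermite interpolant. -/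
theorem hermite_le {m : ℕ} {x : Fin m → ℝ} (hx : Function.Injective x) {p q : ℝ}
    (hmem : ∀ j, x j ∈ Icc p q) {f : ℝ → ℝ}
    (hf : ∀ y ∈ Icc p q, ContDiffAt ℝ ((2 * m : ℕ) : ℕ∞) f y)
    (hpos : ∀ y ∈ Icc p q, 0 ≤ iteratedDeriv (2 * m) f y) {P : ℝ[X]}
    (hP : P.degree < ((2 * m : ℕ) : WithBot ℕ))
    (hPx : ∀ j, P.eval (x j) = f (x j) ∧ (derivative P).eval (x j) = deriv f (x j))
    {y : ℝ} (hy : y ∈ Icc p q) : P.eval y ≤ f y := by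
  classical
  by_cases hyx : ∃ j, y = x j
  · obtain ⟨j, rfl⟩ := hyx
    exact (hPx j).1.le
  push Not at hyx
  -- For m = 0 the interpolant is zero, and the derivative of order 0 is f itself.
  rcases Nat.eq_zero_or_pos m with rfl | hm
  · have h0 : P = 0 := by
      rw [← degree_eq_bot]
      exact WithBot.lt_coe_bot.1 (by simpa using hP)
    have := hpos y hy
    simpa [h0] using this
  set N := Lagrange.nodal Finset.univ x with hNdef
  have hNy : 0 < (N.eval y) ^ 2 := by
    have : N.eval y ≠ 0 := by
      rw [Lagrange.eval_nodal]
      exact Finset.prod_ne_zero_iff.2 fun i _ => sub_ne_zero.2 (hyx i)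
    positivity
  have hN0 : ∀ j, N.eval (x j) = 0 := fun j => Lagrange.eval_nodal_at_node (Finset.mem_univ j)
  -- This κ makes f - Q vanish at y as well, while the double zeros of N² keep the Hermite
  -- conditions at the nodes.
  set κ := (f y - P.eval y) / (N.eval y) ^ 2 with hκ
  set Q := P + C κ * N ^ 2 with hQ
  let F : ℕ → ℝ → ℝ := fun k z => iteratedDeriv k f z - (derivative^[k] Q).eval z
  have hF : ∀ j < 2 * m, ∀ z ∈ Icc p q, HasDerivAt (F j) (F (j + 1) z) z := by
    intro j hj z hz
    refine (hasDerivAt_iteratedDeriv (hf z hz) hj).sub ?_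
    rw [Function.iterate_succ_apply']
    exact (derivative^[j] Q).hasDerivAt z
  have hinjx : (Finset.univ.image x).card = m := by
    rw [Finset.card_image_of_injective _ hx]; simp
  have hyn : y ∉ Finset.univ.image x := by
    simp only [Finset.mem_image, Finset.mem_univ, true_and, not_exists]
    exact fun j h => hyx j h.symm
  -- The m + 1 zeros of f - Q give m zeros of its derivative away from the nodes. The nodes are m
  -- further zeros of the derivative, so 2m zeros are available for 2m - 1 more applications of
  -- Rolle.
  obtain ⟨Z', hZ', hc', hd⟩ := exists_zeros_deriv (g := F 0) (g' := F 1) (k := m)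
    (fun z hz => hF 0 (by omega) z hz) (insert y (Finset.univ.image x)) (by
      intro z hz
      rcases Finset.mem_insert.1 hz with rfl | hz
      · refine ⟨hy, ?_⟩
        simp only [F, iteratedDeriv_zero, Function.iterate_zero, id, hQ, hκ, eval_add, eval_mul,
          eval_C, eval_pow]
        rw [div_mul_cancel₀ _ hNy.ne']; ring
      · obtain ⟨j, -, rfl⟩ := Finset.mem_image.1 hz
        refine ⟨hmem j, ?_⟩
        simp [F, hQ, hN0, (hPx j).1]) (by
      rw [Finset.card_insert_of_notMem hyn, hinjx])
  have hd' : Disjoint Z' (Finset.univ.image x) := hd.mono_right (Finset.subset_insert _ _)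
  obtain ⟨ζ, hζ, hζ0⟩ := exists_zero_iterated (F := fun j => F (j + 1)) (k := 2 * m - 1) (p := p)
    (q := q) (fun j hj z hz => hF (j + 1) (by omega) z hz) (Z' ∪ Finset.univ.image x) (by
      intro z hz
      rcases Finset.mem_union.1 hz with hz | hz
      · exact hZ' z hz
      · obtain ⟨j, -, rfl⟩ := Finset.mem_image.1 hz
        refine ⟨hmem j, ?_⟩
        simp [F, hQ, hN0, (hPx j).2, derivative_pow]) (by
      rw [Finset.card_union_of_disjoint hd', hinjx, hc']; omega)
  -- Only the leading term of κ N² survives 2m derivatives, so κ has the sign of the derivative of f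
  -- at ζ.
  have h2 : derivative^[2 * m] Q = C (κ * (2 * m).factorial) := by
    have hmon : (N ^ 2).Monic := (Lagrange.nodal_monic).pow 2
    have hdeg : (N ^ 2).natDegree = 2 * m := by
      rw [natDegree_pow, Lagrange.natDegree_nodal]; simp
    have hco : derivative^[2 * m] (N ^ 2) = C ((2 * m).factorial : ℝ) := by
      ext k
      rw [coeff_iterate_derivative, coeff_C]
      rcases Nat.eq_zero_or_pos k with rfl | hk
      · have : (N ^ 2).coeff (2 * m) = 1 := by rw [← hdeg]; exact hmon
        simp [this, Nat.descFactorial_self]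
      · rw [coeff_eq_zero_of_natDegree_lt (by omega)]
        simp [hk.ne']
    rw [hQ, iterate_map_add, iterate_derivative_eq_zero_of_degree_lt hP, zero_add,
      iterate_derivative_C_mul, hco, ← C_mul]
  have h3 : iteratedDeriv (2 * m) f ζ = κ * (2 * m).factorial := by
    have h4 : F (2 * m - 1 + 1) ζ = 0 := hζ0
    rw [show 2 * m - 1 + 1 = 2 * m by omega] at h4
    simp only [F, h2, eval_C] at h4
    linarith
  have h5 : 0 ≤ κ := by
    have := hpos ζ hζ
    rw [h3] at this
    exact nonneg_of_mul_nonneg_left this (by positivity)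
  have h6 : f y - P.eval y = κ * (N.eval y) ^ 2 := by rw [hκ, div_mul_cancel₀ _ hNy.ne']
  nlinarith [mul_nonneg h5 hNy.le]

end RoughKernel
end

/-! ### Gauss quadrature: sign of the error, positive weights, existence -/

noncomputable section

namespace RoughKernel
open Polynomial MeasureTheory

theorem intervalIntegrable_mul_of_continuousOn {ρ f : ℝ → ℝ} {p q : ℝ} (hpq : p ≤ q)
    (hρ : IntervalIntegrable ρ volume p q) (hf : ContinuousOn f (Icc p q)) :
    IntervalIntegrable (fun y => f y * ρ y) volume p q :=
  hρ.continuousOn_mul (by rwa [uIcc_of_le hpq])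

section Gauss

variable {ρ : ℝ → ℝ} {p q : ℝ} {m : ℕ} {x w : Fin m → ℝ}

/-- The Hermite interpolant at the nodes has degree below 2m, so the rule integrates it exactly, and
it lies below f. -/
theorem IsGaussQuadrature.error_nonneg (hG : IsGaussQuadrature ρ p q m x w) (hpq : p ≤ q)
    (hρ : IntervalIntegrable ρ volume p q) (hρ0 : ∀ y ∈ Icc p q, 0 ≤ ρ y) {f : ℝ → ℝ}
    (hf : ∀ y ∈ Icc p q, ContDiffAt ℝ ((2 * m : ℕ) : ℕ∞) f y)
    (hpos : ∀ y ∈ Icc p q, 0 ≤ iteratedDeriv (2 * m) f y) :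
    ∑ j, w j * f (x j) ≤ ∫ y in p..q, f y * ρ y := by
  obtain ⟨P, hP, hPx⟩ := exists_hermite hG.strictMono.injective (fun j => f (x j))
    (fun j => deriv f (x j))
  calc ∑ j, w j * f (x j) = ∑ j, w j * P.eval (x j) := by simp only [(hPx _).1]
    _ = ∫ y in p..q, P.eval y * ρ y := (hG.exact P hP).symm
    _ ≤ ∫ y in p..q, f y * ρ y := by
      refine intervalIntegral.integral_mono_on hpq
        (intervalIntegrable_mul_of_continuousOn hpq hρ P.continuous.continuousOn)
        (intervalIntegrable_mul_of_continuousOn hpq hρ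
          fun y hy => (hf y hy).continuousAt.continuousWithinAt) fun y hy => ?_
      exact mul_le_mul_of_nonneg_right
        (hermite_le hG.strictMono.injective hG.mem hf hpos hP hPx hy) (hρ0 y hy)

/-- The square of a Lagrange basis polynomial has degree 2m - 2, is integrated exactly, and picks
out a single weight. -/
theorem IsGaussQuadrature.weight_nonneg (hG : IsGaussQuadrature ρ p q m x w) (hpq : p ≤ q)
    (hρ0 : ∀ y ∈ Icc p q, 0 ≤ ρ y) (j : Fin m) : 0 ≤ w j := by
  classical
  have hinj : Set.InjOn x (Finset.univ : Finset (Fin m)) := hG.strictMono.injective.injOn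
  have hm : 0 < m := j.pos
  set B := Lagrange.basis Finset.univ x j
  have hB : B.degree = ((m - 1 : ℕ) : WithBot ℕ) := by
    have := Lagrange.degree_basis hinj (Finset.mem_univ j)
    rwa [Finset.card_univ, Fintype.card_fin] at this
  have hdeg : (B ^ 2).degree < ((2 * m : ℕ) : WithBot ℕ) := by
    rw [degree_pow, hB]
    have : 2 • ((m - 1 : ℕ) : WithBot ℕ) = ((2 * (m - 1) : ℕ) : WithBot ℕ) := by
      rw [nsmul_eq_mul]; push_cast; rfl
    rw [this]
    exact_mod_cast (by omega : 2 * (m - 1) < 2 * m)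
  have h := hG.exact _ hdeg
  rw [Finset.sum_eq_single j] at h
  · rw [eval_pow, Lagrange.eval_basis_self hinj (Finset.mem_univ j), one_pow, mul_one] at h
    rw [← h]
    refine intervalIntegral.integral_nonneg hpq fun y hy => mul_nonneg ?_ (hρ0 y hy)
    rw [eval_pow]; positivity
  · intro i _ hij
    rw [eval_pow, Lagrange.eval_basis_of_ne hij.symm (Finset.mem_univ i)]; simp
  · simp

theorem IsGaussQuadrature.sum_weight (hG : IsGaussQuadrature ρ p q m x w) (hm : 0 < m) :
    ∑ j, w j = ∫ y in p..q, ρ y := by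
  have := hG.exact 1 (by rw [degree_one]; exact_mod_cast (by omega : 0 < 2 * m))
  simpa using this.symm

theorem IsGaussQuadrature.sum_le (hG : IsGaussQuadrature ρ p q m x w) (hpq : p ≤ q) (hm : 0 < m)
    (hρ0 : ∀ y ∈ Icc p q, 0 ≤ ρ y) {f : ℝ → ℝ} {M : ℝ} (hf : ∀ y ∈ Icc p q, f y ≤ M) :
    ∑ j, w j * f (x j) ≤ M * ∫ y in p..q, ρ y := by
  rw [← hG.sum_weight hm, Finset.mul_sum]
  refine Finset.sum_le_sum fun j _ => ?_
  rw [mul_comm M]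
  exact mul_le_mul_of_nonneg_left (hf _ (hG.mem j)) (hG.weight_nonneg hpq hρ0 j)

/-- The Gaussian quadrature error of `1/y`. -/
theorem IsGaussQuadrature.error_inv (hG : IsGaussQuadrature (fun _ => 1) p q m x w) (hp : 0 < p)
    (hpq : p ≤ q) :
    (∫ y in p..q, y⁻¹) - ∑ j, w j * (x j)⁻¹ =
      ∫ y in p..q, (Lagrange.nodal Finset.univ x).eval y ^ 2 /
        ((Lagrange.nodal Finset.univ x).eval 0 ^ 2 * y) := by
  set N := Lagrange.nodal Finset.univ x
  have hx0 : ∀ j, x j ≠ 0 := fun j => (hp.trans_le (hG.mem j).1).ne'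
  have hN : N.eval 0 ≠ 0 := by
    rw [Lagrange.eval_nodal]
    exact Finset.prod_ne_zero_iff.2 fun j _ => sub_ne_zero.2 (hx0 j).symm
  have hN0 : ∀ j, N.eval (x j) = 0 := fun j => Lagrange.eval_nodal_at_node (Finset.mem_univ j)
  -- P = (1 - N²/N(0)²)/y is a polynomial of degree below 2m that equals 1/y at the nodes; the error
  -- of the rule is therefore the integral of 1/y - P.
  obtain ⟨P, hP⟩ : X ∣ 1 - C ((N.eval 0) ^ 2)⁻¹ * N ^ 2 := by
    rw [X_dvd_iff, coeff_zero_eq_eval_zero]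
    simp [hN]
  have hPe : ∀ y, y ≠ 0 → P.eval y = y⁻¹ - N.eval y ^ 2 / (N.eval 0 ^ 2 * y) := by
    intro y hy
    have := congrArg (eval y) hP
    simp only [eval_sub, eval_one, eval_mul, eval_C, eval_pow, eval_X] at this
    field_simp
    field_simp at this
    linarith
  have hPd : P.degree < ((2 * m : ℕ) : WithBot ℕ) := by
    by_cases hP0 : P = 0
    · rw [hP0, degree_zero]; exact WithBot.bot_lt_coe _
    have h1 : (X * P).natDegree ≤ 2 * m := by
      rw [← hP]
      refine (natDegree_sub_le _ _).trans (max_le (by simp) ?_)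
      refine (natDegree_C_mul_le _ _).trans ?_
      rw [natDegree_pow, Lagrange.natDegree_nodal]; simp
    rw [natDegree_X_mul hP0] at h1
    rw [degree_eq_natDegree hP0]
    exact_mod_cast (by omega : P.natDegree < 2 * m)
  have h1 := hG.exact P hPd
  have hne : ∀ y ∈ uIcc p q, y ≠ 0 := by
    intro y hy
    rw [uIcc_of_le hpq] at hy
    exact (hp.trans_le hy.1).ne'
  have hs : ∑ j, w j * (x j)⁻¹ = ∑ j, w j * P.eval (x j) := by
    refine Finset.sum_congr rfl fun j _ => ?_
    rw [hPe _ (hx0 j), hN0]; simp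
  have hi : IntervalIntegrable (fun y : ℝ => y⁻¹) volume p q :=
    ContinuousOn.intervalIntegrable (continuousOn_inv₀.mono fun y hy => hne y hy)
  have hi2 : IntervalIntegrable (fun y : ℝ => P.eval y) volume p q :=
    P.continuous.intervalIntegrable _ _
  rw [hs, ← h1]
  simp only [mul_one]
  rw [← intervalIntegral.integral_sub hi hi2]
  refine intervalIntegral.integral_congr fun y hy => ?_
  simp only [hPe y (hne y hy)]
  ring

end Gauss

section Existence

variable {ρ : ℝ → ℝ} {p q : ℝ}

theorem integral_sq_mul_pos (hpq : p < q) (hρ : IntervalIntegrable ρ volume p q)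
    (hρ0 : ∀ y ∈ Ioo p q, 0 < ρ y) {P : ℝ[X]} (hP : P ≠ 0) :
    0 < ∫ y in p..q, P.eval y ^ 2 * ρ y := by
  have hint : IntervalIntegrable (fun y => P.eval y ^ 2 * ρ y) volume p q :=
    intervalIntegrable_mul_of_continuousOn hpq.le hρ (by fun_prop)
  rw [intervalIntegral.integral_pos_iff_support_of_nonneg_ae' ?_ hint]
  · refine ⟨hpq, ?_⟩
    have hsub : Ioo p q \ (P.roots.toFinset : Set ℝ) ⊆
        Function.support (fun y => P.eval y ^ 2 * ρ y) ∩ Ioc p q := by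
      rintro y ⟨hy, hyr⟩
      refine ⟨?_, hy.1, hy.2.le⟩
      have : P.eval y ≠ 0 := fun h => hyr (by simp [hP, h])
      exact mul_ne_zero (pow_ne_zero 2 this) (hρ0 y hy).ne'
    refine lt_of_lt_of_le ?_ (measure_mono hsub)
    rw [measure_sdiff_null (P.roots.toFinset.finite_toSet.measure_zero volume)]
    simp [hpq]
  · rw [uIoc_of_le hpq.le]
    have : ∀ᵐ y ∂(volume.restrict (Ioc p q)), y ∈ Ioo p q := by
      rw [← Measure.restrict_congr_set Ioo_ae_eq_Ioc]
      exact ae_restrict_mem measurableSet_Ioo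
    filter_upwards [this] with y hy
    exact mul_nonneg (sq_nonneg _) (hρ0 y hy).le

/-- The pairing is positive definite on polynomials of degree below m, hence some P there represents
Q ↦ ∫ X^m Q ρ. The orthogonal polynomial is X^m - P. -/
theorem exists_orthogonal_poly (hpq : p < q) (hρ : IntervalIntegrable ρ volume p q)
    (hρ0 : ∀ y ∈ Ioo p q, 0 < ρ y) (m : ℕ) :
    ∃ N : ℝ[X], N.Monic ∧ N.natDegree = m ∧ ∀ Q : ℝ[X], Q.degree < (m : WithBot ℕ) →
      ∫ y in p..q, (N * Q).eval y * ρ y = 0 := by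
  have hint : ∀ P : ℝ[X], IntervalIntegrable (fun y => P.eval y * ρ y) volume p q := fun P =>
    intervalIntegrable_mul_of_continuousOn hpq.le hρ (by fun_prop)
  let I : ℝ[X] →ₗ[ℝ] ℝ :=
    { toFun := fun P => ∫ y in p..q, P.eval y * ρ y
      map_add' := fun P Q => by
        simp only [eval_add, add_mul]
        exact intervalIntegral.integral_add (hint P) (hint Q)
      map_smul' := fun c P => by
        simp only [eval_smul, smul_eq_mul, mul_assoc, RingHom.id_apply]
        exact intervalIntegral.integral_const_mul _ _ }
  let W := degreeLT ℝ m
  let B : ℝ[X] →ₗ[ℝ] Module.Dual ℝ W := LinearMap.mk₂ ℝ (fun P Q => I (P * (Q : ℝ[X])))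
    (fun P P' Q => by simp [add_mul]) (fun c P Q => by simp)
    (fun P Q Q' => by simp [mul_add]) (fun c P Q => by simp)
  have hfin : FiniteDimensional ℝ W := Module.Finite.of_basis (degreeLT.basis ℝ m)
  have hinj : Function.Injective (B.comp W.subtype) := by
    rw [← LinearMap.ker_eq_bot, LinearMap.ker_eq_bot']
    intro P hP
    by_contra hne
    have h1 : I ((P : ℝ[X]) * P) = 0 := by
      have := congrArg (fun L => L P) hP
      simpa [B] using this
    have h2 := integral_sq_mul_pos hpq hρ hρ0 (P := (P : ℝ[X])) (by simpa using hne)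
    have h3 : I ((P : ℝ[X]) * P) = ∫ y in p..q, (P : ℝ[X]).eval y ^ 2 * ρ y := by
      simp only [I, LinearMap.coe_mk, AddHom.coe_mk, eval_mul, sq]
    linarith
  have hsurj : Function.Surjective (B.comp W.subtype) :=
    (LinearMap.injective_iff_surjective_of_finrank_eq_finrank
      (Subspace.dual_finrank_eq).symm).1 hinj
  obtain ⟨P, hP⟩ := hsurj (B (X ^ m))
  have hPd : (P : ℝ[X]).degree < (m : WithBot ℕ) := mem_degreeLT.1 P.2
  have hlt : (P : ℝ[X]).degree < (X ^ m : ℝ[X]).degree := by rwa [degree_X_pow]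
  refine ⟨X ^ m - (P : ℝ[X]), (monic_X_pow m).sub_of_left hlt, ?_, ?_⟩
  · apply natDegree_eq_of_degree_eq_some
    rw [degree_sub_eq_left_of_degree_lt hlt, degree_X_pow]
  · intro Q hQ
    have := congrArg (fun L => L ⟨Q, mem_degreeLT.2 hQ⟩) hP
    simp only [B, LinearMap.comp_apply, LinearMap.mk₂_apply, Submodule.subtype_apply] at this
    change I ((X ^ m - (P : ℝ[X])) * Q) = 0
    rw [sub_mul, map_sub, this, sub_self]

/-- The nodes are the zeros of the orthogonal polynomial N. They are simple and lie in (p, q), since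
otherwise some Q of degree below m would have ∫ N Q ρ ≠ 0. Division by N with remainder raises the
exactness of the interpolatory rule from degree below m to degree below 2m. -/
theorem exists_gaussQuadrature (hpq : p < q) (hρ : IntervalIntegrable ρ volume p q)
    (hρ0 : ∀ y ∈ Ioo p q, 0 < ρ y) (m : ℕ) : ∃ x w, IsGaussQuadrature ρ p q m x w := by
  classical
  obtain ⟨N, hNm, hNd, hN⟩ := exists_orthogonal_poly hpq hρ hρ0 m
  have hN0 := hNm.ne_zero
  have hint : ∀ P : ℝ[X], IntervalIntegrable (fun y => P.eval y * ρ y) volume p q := fun P =>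
    intervalIntegrable_mul_of_continuousOn hpq.le hρ (by fun_prop)
  -- If N = f g and f has no zero in (p, q), then N g = f g² has constant sign, against the
  -- orthogonality of N to g.
  have key : ∀ f : ℝ[X], f ∣ N → 0 < f.natDegree → ∃ y ∈ Ioo p q, f.eval y = 0 := by
    rintro f ⟨g, hg⟩ hf
    by_contra! hne
    have hg0 : g ≠ 0 := by rintro rfl; simp [hg] at hN0
    have hf0 : f ≠ 0 := by rintro rfl; simp at hf
    have hgd : g.degree < (m : WithBot ℕ) := by
      rw [← natDegree_lt_iff_degree_lt hg0, ← hNd, hg, natDegree_mul hf0 hg0]; omega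
    have h0 := hN g hgd
    have hmul : ∀ y, (N * g).eval y * ρ y = g.eval y ^ 2 * (f.eval y * ρ y) := by
      intro y; rw [hg]; simp only [eval_mul]; ring
    simp only [hmul] at h0
    have hsign : (∀ y ∈ Ioo p q, 0 < f.eval y) ∨ (∀ y ∈ Ioo p q, f.eval y < 0) := by
      by_contra! hcon
      obtain ⟨⟨y, hy, hy'⟩, z, hz, hz'⟩ := hcon
      obtain ⟨u, hu, hu'⟩ := isPreconnected_Ioo.intermediate_value hy hz
        (f.continuous.continuousOn) ⟨hy', hz'⟩
      exact hne u hu hu'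
    rcases hsign with hs | hs
    · have := integral_sq_mul_pos (ρ := fun y => f.eval y * ρ y) hpq (hint f)
        (fun y hy => mul_pos (hs y hy) (hρ0 y hy)) hg0
      linarith
    · have := integral_sq_mul_pos (ρ := fun y => -(f.eval y * ρ y)) hpq (hint f).neg
        (fun y hy => by nlinarith [hs y hy, hρ0 y hy]) hg0
      simp only [mul_neg, intervalIntegral.integral_neg] at this
      linarith
  -- The cofactor of the linear factors has no real root, so by `key` it has degree zero.
  have hcard : N.roots.card = m := by
    obtain ⟨g, hg, hgd, hgr⟩ := exists_prod_multiset_X_sub_C_mul N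
    by_contra hne
    obtain ⟨y, -, hy⟩ := key g ⟨_, by rw [mul_comm]; exact hg.symm⟩ (by omega)
    have hg0 : g ≠ 0 := by rintro rfl; simp at hg; exact hN0 hg.symm
    have : y ∈ g.roots := (mem_roots hg0).2 hy
    simp [hgr] at this
  have hmem : ∀ r ∈ N.roots, r ∈ Ioo p q := by
    intro r hr
    obtain ⟨y, hy, hy'⟩ := key (X - C r) (dvd_iff_isRoot.2 ((mem_roots hN0).1 hr)) (by simp)
    have : y = r := by simpa [sub_eq_zero] using hy'
    rwa [← this]
  have hnodup : N.roots.Nodup := by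
    rw [Multiset.nodup_iff_count_le_one]
    intro r
    by_contra! hcon
    rw [count_roots] at hcon
    obtain ⟨g, hg⟩ := (le_rootMultiplicity_iff hN0).1 (show 2 ≤ N.rootMultiplicity r from hcon)
    have hg0 : g ≠ 0 := by rintro rfl; simp [hg] at hN0
    have hX0 : (X - C r) ^ 2 ≠ 0 := pow_ne_zero _ (X_sub_C_ne_zero r)
    have hgd : g.degree < (m : WithBot ℕ) := by
      rw [← natDegree_lt_iff_degree_lt hg0, ← hNd, hg, natDegree_mul hX0 hg0, natDegree_pow,
        natDegree_X_sub_C]; omega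
    have h0 := hN g hgd
    have := integral_sq_mul_pos hpq hρ hρ0 (mul_ne_zero (X_sub_C_ne_zero r) hg0)
    have hmul : ∀ y, (N * g).eval y * ρ y = ((X - C r) * g).eval y ^ 2 * ρ y := by
      intro y; rw [hg]; simp only [eval_mul, eval_pow]; ring
    simp only [hmul] at h0
    linarith
  have hfc : N.roots.toFinset.card = m := by
    rw [Multiset.toFinset_card_of_nodup hnodup, hcard]
  let x : Fin m → ℝ := N.roots.toFinset.orderEmbOfFin hfc
  have hxmono : StrictMono x := (N.roots.toFinset.orderEmbOfFin hfc).strictMono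
  have hxmem : ∀ j, x j ∈ N.roots := fun j =>
    Multiset.mem_toFinset.1 (N.roots.toFinset.orderEmbOfFin_mem hfc j)
  have hinj : Set.InjOn x (Finset.univ : Finset (Fin m)) := hxmono.injective.injOn
  refine ⟨x, fun j => ∫ y in p..q, (Lagrange.basis Finset.univ x j).eval y * ρ y, hxmono,
    fun j => Ioo_subset_Icc_self (hmem _ (hxmem j)), fun P hP => ?_⟩
  have hdm : P %ₘ N + N * (P /ₘ N) = P := modByMonic_add_div P N
  have hx0 : ∀ j, N.eval (x j) = 0 := fun j => (mem_roots hN0).1 (hxmem j)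
  have hR : (P %ₘ N).degree < (m : WithBot ℕ) := by
    rw [← hNd, ← degree_eq_natDegree hN0]; exact degree_modByMonic_lt P hNm
  have hQ : (P /ₘ N).degree < (m : WithBot ℕ) := by
    by_cases hQ0 : P /ₘ N = 0
    · rw [hQ0, degree_zero]; exact WithBot.bot_lt_coe _
    have hP0 : P ≠ 0 := by rintro rfl; simp at hQ0
    rw [← natDegree_lt_iff_degree_lt hQ0, natDegree_divByMonic P hNm, hNd]
    have := (natDegree_lt_iff_degree_lt hP0).2 hP
    have : m ≠ 0 := by
      rintro rfl; simp at this
    omega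
  have hRx : ∀ j, P.eval (x j) = (P %ₘ N).eval (x j) := by
    intro j
    conv_lhs => rw [← hdm]
    simp [hx0]
  have hRe : P %ₘ N = ∑ j, C ((P %ₘ N).eval (x j)) * Lagrange.basis Finset.univ x j := by
    have := Lagrange.eq_interpolate hinj (f := P %ₘ N)
      (by rwa [Finset.card_univ, Fintype.card_fin])
    rwa [Lagrange.interpolate_apply] at this
  have h1 : ∫ y in p..q, P.eval y * ρ y = ∫ y in p..q, (P %ₘ N).eval y * ρ y := by
    have : ∀ y, P.eval y * ρ y = (P %ₘ N).eval y * ρ y + (N * (P /ₘ N)).eval y * ρ y := by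
      intro y
      conv_lhs => rw [← hdm]
      simp only [eval_add]; ring
    simp only [this]
    rw [intervalIntegral.integral_add (hint _) (hint _), hN _ hQ, add_zero]
  have h2 : ∀ y, (P %ₘ N).eval y * ρ y =
      ∑ j, P.eval (x j) * ((Lagrange.basis Finset.univ x j).eval y * ρ y) := by
    intro y
    conv_lhs => rw [hRe]
    rw [eval_finsetSum, Finset.sum_mul]
    simp only [eval_mul, eval_C, hRx, mul_assoc]
  rw [h1]
  simp only [h2]
  rw [intervalIntegral.integral_finsetSum fun j _ => (hint _).const_mul _]
  refine Finset.sum_congr rfl fun j _ => ?_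
  rw [intervalIntegral.integral_const_mul, mul_comm]

end Existence

end RoughKernel
end

/-! ### Chebyshev bounds for the quadrature error of 1/y -/

noncomputable section

namespace RoughKernel
open Polynomial MeasureTheory

theorem exists_antiderivative (P : ℝ[X]) :
    ∃ A : ℝ[X], derivative A = P ∧ A.natDegree ≤ P.natDegree + 1 := by
  refine ⟨∑ k ∈ Finset.range (P.natDegree + 1), C (P.coeff k / (k + 1)) * X ^ (k + 1), ?_, ?_⟩
  · conv_rhs => rw [P.as_sum_range_C_mul_X_pow]
    rw [derivative_sum]
    refine Finset.sum_congr rfl fun k _ => ?_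
    rw [derivative_C_mul_X_pow]
    congr 2
    push_cast
    field_simp
  · refine natDegree_sum_le_of_forall_le _ _ fun k hk => ?_
    refine (natDegree_C_mul_X_pow_le _ _).trans ?_
    have := Finset.mem_range.1 hk
    omega

/-- A polynomial of degree at most `m` is bounded outside `[-1, 1]` by its `L²`-norm. -/
theorem eval_sq_le_integral_mul_chebyshev {R : ℝ[X]} {m : ℕ} (hR : R.natDegree ≤ m) {x : ℝ}
    (hx : 1 ≤ x) : R.eval x ^ 2 ≤
      (∫ y in (-1 : ℝ)..1, R.eval y ^ 2) * (derivative (Chebyshev.T ℝ (2 * m + 1 : ℕ))).eval x := by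
  rcases eq_or_ne R 0 with rfl | hR0
  · simp
  set I := ∫ y in (-1 : ℝ)..1, R.eval y ^ 2 with hI
  have hIpos : 0 < I := by
    have := integral_sq_mul_pos (ρ := fun _ => 1) (p := -1) (q := 1) (by norm_num)
      intervalIntegrable_const (fun _ _ => one_pos) hR0
    simpa using this
  obtain ⟨A, hA, hAd⟩ := exists_antiderivative (R ^ 2)
  have hint : ∀ a b, IntervalIntegrable (fun y => R.eval y ^ 2) volume a b := fun a b =>
    Continuous.intervalIntegrable (by fun_prop) _ _
  have hF : ∀ a b, ∫ y in a..b, R.eval y ^ 2 = A.eval b - A.eval a := by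
    intro a b
    refine intervalIntegral.integral_eq_sub_of_hasDerivAt (f := fun y => A.eval y)
      (fun y _ => ?_) (hint a b)
    have := A.hasDerivAt y
    rwa [hA, eval_pow] at this
  -- P increases from 0 to 1 on [-1, 1], so the extremal property of Chebyshev polynomials bounds P'
  -- = R²/I to the right of 1.
  set P : ℝ[X] := C I⁻¹ * (A - C (A.eval (-1))) with hP
  have hPd : P.degree ≤ ((2 * m + 1 : ℕ) : WithBot ℕ) := by
    rw [← natDegree_le_iff_degree_le]
    refine (natDegree_C_mul_le _ _).trans ?_
    rw [natDegree_sub_C]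
    refine hAd.trans ?_
    rw [natDegree_pow]; omega
  have hPb : ∀ y ∈ Icc (-1 : ℝ) 1, |P.eval y| ≤ 1 := by
    intro y hy
    have h1 : P.eval y = I⁻¹ * ∫ z in (-1 : ℝ)..y, R.eval z ^ 2 := by
      rw [hF]; simp [hP]
    have h2 : 0 ≤ ∫ z in (-1 : ℝ)..y, R.eval z ^ 2 :=
      intervalIntegral.integral_nonneg hy.1 fun _ _ => sq_nonneg _
    have h3 : 0 ≤ ∫ z in y..(1 : ℝ), R.eval z ^ 2 :=
      intervalIntegral.integral_nonneg hy.2 fun _ _ => sq_nonneg _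
    have h4 : (∫ z in (-1 : ℝ)..y, R.eval z ^ 2) + ∫ z in y..(1 : ℝ), R.eval z ^ 2 = I :=
      intervalIntegral.integral_add_adjacent_intervals (hint _ _) (hint _ _)
    rw [h1, abs_of_nonneg (by positivity), inv_mul_le_iff₀ hIpos]
    linarith
  have h := Chebyshev.eval_iterate_derivative_le_of_forall_abs_le_one (k := 1) hx hPd hPb
  simp only [Function.iterate_one, hP, derivative_mul, derivative_C, zero_mul, zero_add,
    derivative_sub, sub_zero, hA, eval_mul, eval_C, eval_pow] at h
  rwa [inv_mul_le_iff₀ hIpos] at h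

/-- From T_m' = m U_{m-1} and U_{m-1}(cosh θ) sinh θ = sinh(mθ). -/
theorem chebyshev_derivative_cosh_le {θ : ℝ} (hθ : 0 < θ) (m : ℕ) :
    (derivative (Chebyshev.T ℝ (m : ℤ))).eval (Real.cosh θ) ≤
      m * Real.exp (m * θ) / (2 * Real.sinh θ) := by
  have hs : 0 < Real.sinh θ := Real.sinh_pos_iff.2 hθ
  have hd := Chebyshev.T_derivative_eq_U (R := ℝ) (m : ℤ)
  have hU := Chebyshev.U_real_cosh θ ((m : ℤ) - 1)
  rw [hd, le_div_iff₀ (by positivity)]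
  simp only [eval_mul, Int.cast_natCast, eval_natCast]
  push_cast at hU
  rw [sub_add_cancel] at hU
  have h2 : 2 * Real.sinh (m * θ) ≤ Real.exp (m * θ) := by
    rw [Real.sinh_eq]
    have := Real.exp_pos (-(m * θ))
    linarith
  have hm : (0 : ℝ) ≤ m := Nat.cast_nonneg m
  calc (m : ℝ) * (Chebyshev.U ℝ (m - 1)).eval (Real.cosh θ) * (2 * Real.sinh θ)
      = m * (2 * ((Chebyshev.U ℝ (m - 1)).eval (Real.cosh θ) * Real.sinh θ)) := by ring
    _ ≤ _ := by rw [hU]; exact mul_le_mul_of_nonneg_left h2 hm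

section

variable {p q θ : ℝ} {m : ℕ} {x v : Fin m → ℝ}

/-- R is T_{2m} transported to [p, q] and normalised at 0, where its argument is cosh θ. So (1 -
R)/y is a polynomial of degree below 2m that approximates 1/y up to 1/(p cosh(2mθ)). This uniform
error enters twice, in the integral and in the quadrature sum. -/
theorem IsGaussQuadrature.error_inv_le (hG : IsGaussQuadrature (fun _ => 1) p q m x v)
    (hp : 0 < p) (hpq : p < q) (hm : 0 < m) (hθ : q + p = (q - p) * Real.cosh θ) :
    (∫ y in p..q, y⁻¹) - ∑ j, v j * (x j)⁻¹ ≤ 2 * (q - p) / p / Real.cosh (2 * m * θ) := by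
  have hqp : 0 < q - p := sub_pos.2 hpq
  have hc := Real.cosh_pos (2 * m * θ)
  set R : ℝ[X] := C (Real.cosh (2 * m * θ))⁻¹ *
    (Chebyshev.T ℝ (2 * m : ℕ)).comp (C ((q + p) / (q - p)) - C (2 / (q - p)) * X) with hR
  have hRe : ∀ y, R.eval y = (Real.cosh (2 * m * θ))⁻¹ *
      (Chebyshev.T ℝ (2 * m : ℕ)).eval ((q + p) / (q - p) - 2 / (q - p) * y) := by
    intro y; simp [hR]
  have hR0 : R.eval 0 = 1 := by
    rw [hRe, mul_zero, sub_zero, hθ, mul_div_cancel_left₀ _ hqp.ne', Chebyshev.T_real_cosh]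
    push_cast
    exact inv_mul_cancel₀ hc.ne'
  obtain ⟨P, hP⟩ : X ∣ 1 - R := by
    rw [X_dvd_iff, coeff_zero_eq_eval_zero]; simp [hR0]
  have hPd : P.degree < ((2 * m : ℕ) : WithBot ℕ) := by
    by_cases hP0 : P = 0
    · rw [hP0, degree_zero]; exact WithBot.bot_lt_coe _
    have h1 : (X * P).natDegree ≤ 2 * m := by
      rw [← hP]
      refine (natDegree_sub_le _ _).trans (max_le (by simp) ?_)
      refine (natDegree_C_mul_le _ _).trans ?_
      rw [natDegree_comp]
      have h2 : (Chebyshev.T ℝ (2 * m : ℕ)).natDegree = 2 * m := by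
        rw [Chebyshev.natDegree_T, Int.natAbs_natCast]
      have h3 : (C ((q + p) / (q - p)) - C (2 / (q - p)) * X : ℝ[X]).natDegree ≤ 1 :=
        (natDegree_sub_le _ _).trans (max_le (by simp) ((natDegree_C_mul_le _ _).trans natDegree_X_le))
      rw [h2]
      nlinarith
    rw [natDegree_X_mul hP0] at h1
    rw [degree_eq_natDegree hP0]
    exact_mod_cast (by omega : P.natDegree < 2 * m)
  set b := 1 / (p * Real.cosh (2 * m * θ)) with hb
  have hbd : ∀ y ∈ Icc p q, |y⁻¹ - P.eval y| ≤ b := by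
    intro y hy
    have hy0 : 0 < y := hp.trans_le hy.1
    have h1 : y⁻¹ - P.eval y = R.eval y / y := by
      have := congrArg (eval y) hP
      simp only [eval_sub, eval_one, eval_mul, eval_X] at this
      field_simp
      linarith
    have h2 : |(Chebyshev.T ℝ (2 * m : ℕ)).eval ((q + p) / (q - p) - 2 / (q - p) * y)| ≤ 1 := by
      refine Chebyshev.abs_eval_T_real_le_one _ ?_
      rw [div_mul_eq_mul_div, ← sub_div, abs_div, abs_of_pos hqp, div_le_one hqp, abs_le]
      constructor <;> linarith [hy.1, hy.2]
    rw [h1, hRe, abs_div, abs_mul, abs_of_pos hy0, abs_of_pos (inv_pos.2 hc), hb,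
      div_le_div_iff₀ hy0 (by positivity), one_mul, mul_comm, mul_assoc]
    calc p * (Real.cosh (2 * m * θ) * ((Real.cosh (2 * m * θ))⁻¹ * _))
        = p * |(Chebyshev.T ℝ (2 * m : ℕ)).eval ((q + p) / (q - p) - 2 / (q - p) * y)| := by
          rw [mul_inv_cancel_left₀ hc.ne']
      _ ≤ p * 1 := mul_le_mul_of_nonneg_left h2 hp.le
      _ ≤ y := by linarith [hy.1]
  have hi : IntervalIntegrable (fun y : ℝ => y⁻¹) volume p q := by
    refine ContinuousOn.intervalIntegrable (continuousOn_inv₀.mono fun y hy => ?_)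
    rw [uIcc_of_le hpq.le] at hy
    exact (hp.trans_le hy.1).ne'
  have hi2 : IntervalIntegrable (fun y : ℝ => P.eval y) volume p q :=
    P.continuous.intervalIntegrable _ _
  have h1 : (∫ y in p..q, y⁻¹) - ∫ y in p..q, P.eval y ≤ b * (q - p) := by
    rw [← intervalIntegral.integral_sub hi hi2]
    calc ∫ y in p..q, (y⁻¹ - P.eval y) ≤ ∫ _ in p..q, b :=
          intervalIntegral.integral_mono_on hpq.le (hi.sub hi2) intervalIntegrable_const
            fun y hy => (abs_le.1 (hbd y hy)).2
      _ = b * (q - p) := by simp [mul_comm]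
  have h2 : ∑ j, v j * (P.eval (x j) - (x j)⁻¹) ≤ b * ∫ _ in p..q, (1 : ℝ) :=
    hG.sum_le hpq.le hm (fun _ _ => zero_le_one) (f := fun y => P.eval y - y⁻¹)
      fun y hy => by linarith [(abs_le.1 (hbd y hy)).1]
  have h3 := hG.exact P hPd
  simp only [mul_one] at h3
  simp only [mul_sub, Finset.sum_sub_distrib, ← h3] at h2
  have h4 : 2 * (q - p) / p / Real.cosh (2 * m * θ) = 2 * (b * (q - p)) := by
    rw [hb]; field_simp
  rw [h4]
  simp only [intervalIntegral.integral_const, smul_eq_mul, mul_one] at h2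
  linarith

/-- By the exact formula `IsGaussQuadrature.error_inv` the error is at least ∫ N² / (N(0)² q), and a
polynomial of degree m cannot be too large at 0 compared to its L²-norm on [p, q]. -/
theorem IsGaussQuadrature.le_error_inv (hG : IsGaussQuadrature (fun _ => 1) p q m x v)
    (hp : 0 < p) (hpq : p < q) (hθ0 : 0 < θ) (hθ : q + p = (q - p) * Real.cosh θ) :
    (1 - p / q) * Real.sinh θ * Real.exp (-((2 * m + 1) * θ)) / (2 * m + 1) ≤
      (∫ y in p..q, y⁻¹) - ∑ j, v j * (x j)⁻¹ := by
  have hqp : 0 < q - p := sub_pos.2 hpq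
  have hq : 0 < q := hp.trans hpq
  have hs : 0 < Real.sinh θ := Real.sinh_pos_iff.2 hθ0
  rw [hG.error_inv hp hpq.le]
  set N := Lagrange.nodal Finset.univ x
  have hN : 0 < N.eval 0 ^ 2 := by
    have : N.eval 0 ≠ 0 := by
      rw [Lagrange.eval_nodal]
      exact Finset.prod_ne_zero_iff.2 fun j _ =>
        sub_ne_zero.2 (hp.trans_le (hG.mem j).1).ne
    positivity
  -- The substitution maps [-1, 1] onto [p, q] with reversed orientation, and cosh θ to 0.
  set R : ℝ[X] := N.comp (C ((q + p) / 2) - C ((q - p) / 2) * X) with hR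
  have hRe : ∀ t, R.eval t = N.eval ((q + p) / 2 - (q - p) / 2 * t) := by
    intro t; simp [hR]
  have hRd : R.natDegree ≤ m := by
    rw [hR, natDegree_comp, Lagrange.natDegree_nodal, Finset.card_univ, Fintype.card_fin]
    have : (C ((q + p) / 2) - C ((q - p) / 2) * X : ℝ[X]).natDegree ≤ 1 :=
        (natDegree_sub_le _ _).trans (max_le (by simp) ((natDegree_C_mul_le _ _).trans natDegree_X_le))
    nlinarith
  have h1 := eval_sq_le_integral_mul_chebyshev hRd (Real.one_le_cosh θ)
  have h2 : ∫ y in (-1 : ℝ)..1, R.eval y ^ 2 = 2 / (q - p) * ∫ y in p..q, N.eval y ^ 2 := by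
    simp only [hRe]
    rw [intervalIntegral.integral_comp_sub_mul (fun y => N.eval y ^ 2) (by positivity), smul_eq_mul,
      inv_div]
    congr 2 <;> ring
  have h3 : R.eval (Real.cosh θ) = N.eval 0 := by
    rw [hRe]; congr 1; linarith
  have h4 := chebyshev_derivative_cosh_le hθ0 (2 * m + 1)
  rw [h2, h3] at h1
  have hJ : 0 ≤ ∫ y in p..q, N.eval y ^ 2 :=
    intervalIntegral.integral_nonneg hpq.le fun _ _ => sq_nonneg _
  set J := ∫ y in p..q, N.eval y ^ 2
  have h5 : N.eval 0 ^ 2 ≤ 2 / (q - p) * J *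
      ((2 * m + 1 : ℕ) * Real.exp ((2 * m + 1 : ℕ) * θ) / (2 * Real.sinh θ)) :=
    h1.trans (mul_le_mul_of_nonneg_left h4 (by positivity))
  push_cast at h5
  have h6 : J / (N.eval 0 ^ 2 * q) ≤ ∫ y in p..q, N.eval y ^ 2 / (N.eval 0 ^ 2 * y) := by
    rw [← intervalIntegral.integral_div]
    refine intervalIntegral.integral_mono_on hpq.le
      (Continuous.intervalIntegrable (by fun_prop) _ _) ?_ fun y hy => ?_
    · refine ContinuousOn.intervalIntegrable (ContinuousOn.div (by fun_prop) (by fun_prop) ?_)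
      intro y hy
      rw [uIcc_of_le hpq.le] at hy
      have := hp.trans_le hy.1
      positivity
    · have := hp.trans_le hy.1
      gcongr
      exact hy.2
  refine le_trans ?_ h6
  rw [Real.exp_neg, ← div_eq_mul_inv]
  set E := Real.exp ((2 * m + 1) * θ)
  have hE : 0 < E := Real.exp_pos _
  have h7 : N.eval 0 ^ 2 * ((q - p) * Real.sinh θ) ≤ J * ((2 * m + 1) * E) := by
    have : 2 / (q - p) * J * ((2 * m + 1) * E / (2 * Real.sinh θ)) =
        J * ((2 * m + 1) * E) / ((q - p) * Real.sinh θ) := by field_simp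
    rwa [this, le_div_iff₀ (by positivity)] at h5
  rw [div_div, div_le_div_iff₀ (by positivity) (by positivity)]
  have h8 : (1 - p / q) * q = q - p := by field_simp
  calc (1 - p / q) * Real.sinh θ * (N.eval 0 ^ 2 * q)
      = N.eval 0 ^ 2 * (((1 - p / q) * q) * Real.sinh θ) := by ring
    _ ≤ J * (E * (2 * m + 1)) := by rw [h8]; linarith

end

end RoughKernel
end

/-! ### Quadrature errors of powers and exponentials -/

noncomputable section

namespace RoughKernel
open Polynomial MeasureTheory

theorem iteratedDeriv_rpow_neg (r y : ℝ) (k : ℕ) :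
    iteratedDeriv k (fun y : ℝ => y ^ (-r)) y =
      (-1) ^ k * ((ascPochhammer ℝ k).eval r * y ^ (-r - k)) := by
  rw [iteratedDeriv_eq_iterate, Real.iter_deriv_rpow_const]
  have := ascPochhammer_eval_neg_eq_descPochhammer ℝ (-r) k
  rw [neg_neg] at this
  rw [this, ← mul_assoc, ← mul_assoc, ← mul_pow]
  norm_num

theorem contDiffAt_rpow_neg {r y : ℝ} (hy : 0 < y) {n : WithTop ℕ∞} :
    ContDiffAt ℝ n (fun y : ℝ => y ^ (-r)) y :=
  Real.contDiffAt_rpow_const_of_ne hy.ne'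

/-- Derivatives of order i of both factors have sign (-1)^i, so all terms of Leibniz's formula have
sign (-1)^(2k). -/
theorem iteratedDeriv_rpow_neg_mul_exp_nonneg {r t y : ℝ} (hr : 0 ≤ r) (ht : 0 ≤ t) (hy : 0 < y)
    (k : ℕ) : 0 ≤ iteratedDeriv (2 * k) (fun y : ℝ => y ^ (-r) * Real.exp (-t * y)) y := by
  have hexp : ContDiffAt ℝ ((2 * k : ℕ) : WithTop ℕ∞) (fun y : ℝ => Real.exp (-t * y)) y := by
    fun_prop
  rw [iteratedDeriv_fun_mul (contDiffAt_rpow_neg hy) hexp]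
  refine Finset.sum_nonneg fun i hi => ?_
  have hi' : i ≤ 2 * k := Nat.lt_succ_iff.1 (Finset.mem_range.1 hi)
  rw [iteratedDeriv_rpow_neg, iteratedDeriv_exp_const_mul]
  have h1 : (-1 : ℝ) ^ i * (-1) ^ (2 * k - i) = 1 := by
    rw [← pow_add, Nat.add_sub_cancel' hi', pow_mul]; norm_num
  have h2 : 0 ≤ (ascPochhammer ℝ i).eval r := by
    rcases hr.eq_or_lt with rfl | hr
    · rw [ascPochhammer_eval_zero]; split_ifs <;> norm_num
    · exact (ascPochhammer_pos i r hr).le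
  have h3 : (-t) ^ (2 * k - i) = (-1) ^ (2 * k - i) * t ^ (2 * k - i) := by
    rw [← mul_pow]; norm_num
  rw [h3]
  calc (0 : ℝ) ≤ ((2 * k).choose i : ℝ) * ((ascPochhammer ℝ i).eval r * y ^ (-r - i)) *
        (t ^ (2 * k - i) * Real.exp (-t * y)) := by positivity
    _ = ((2 * k).choose i : ℝ) * ((ascPochhammer ℝ i).eval r * y ^ (-r - i)) *
        (t ^ (2 * k - i) * Real.exp (-t * y)) * ((-1 : ℝ) ^ i * (-1) ^ (2 * k - i)) := by
          rw [h1, mul_one]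
    _ = _ := by ring

theorem factorial_le_ascPochhammer {r : ℝ} (hr : 1 ≤ r) (k : ℕ) :
    (k.factorial : ℝ) ≤ (ascPochhammer ℝ k).eval r := by
  induction k with
  | zero => simp
  | succ k ih =>
    rw [ascPochhammer_succ_eval, Nat.factorial_succ, mul_comm]
    push_cast
    refine mul_le_mul ih (by linarith) (by positivity) (ascPochhammer_pos k r (by linarith)).le

theorem ascPochhammer_le_factorial {r : ℝ} (hr : 0 < r) (hr' : r ≤ 2) (k : ℕ) :
    (ascPochhammer ℝ k).eval r ≤ (k + 1) * k.factorial := by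
  induction k with
  | zero => simp
  | succ k ih =>
    rw [ascPochhammer_succ_eval, Nat.factorial_succ]
    push_cast
    calc (ascPochhammer ℝ k).eval r * (r + k) ≤ ((k + 1) * k.factorial) * (k + 1 + 1) :=
          mul_le_mul ih (by linarith) (by positivity) (by positivity)
      _ = _ := by ring

section

variable {p q α : ℝ} {m : ℕ} {x v : Fin m → ℝ}

theorem intervalIntegrable_rpow_neg {r : ℝ} (hp : 0 < p) (hpq : p ≤ q) :
    IntervalIntegrable (fun y : ℝ => y ^ (-r)) volume p q := by
  refine ContinuousOn.intervalIntegrable fun y hy => ?_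
  rw [uIcc_of_le hpq] at hy
  exact (Real.continuousAt_rpow_const _ _ (Or.inl (hp.trans_le hy.1).ne')).continuousWithinAt

/-- The hypothesis is the nonnegativity of the derivative of order 2m of a y^(-r) - b y^(-s). Errors
of two powers can thus be compared through their derivatives. -/
theorem IsGaussQuadrature.error_combination_nonneg
    (hG : IsGaussQuadrature (fun _ => 1) p q m x v) (hp : 0 < p) (hpq : p ≤ q) {a b r s : ℝ}
    (h : ∀ y ∈ Icc p q, 0 ≤ a * ((ascPochhammer ℝ (2 * m)).eval r * y ^ (-r - (2 * m : ℕ))) -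
      b * ((ascPochhammer ℝ (2 * m)).eval s * y ^ (-s - (2 * m : ℕ)))) :
    b * ((∫ y in p..q, y ^ (-s)) - ∑ j, v j * x j ^ (-s)) ≤
      a * ((∫ y in p..q, y ^ (-r)) - ∑ j, v j * x j ^ (-r)) := by
  have h1 := hG.error_nonneg hpq intervalIntegrable_const (fun _ _ => zero_le_one)
    (f := fun y => a * y ^ (-r) - b * y ^ (-s)) (fun y hy =>
      (contDiffAt_const.mul (contDiffAt_rpow_neg (hp.trans_le hy.1))).sub
        (contDiffAt_const.mul (contDiffAt_rpow_neg (hp.trans_le hy.1)))) (fun y hy => by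
      have hy0 := hp.trans_le hy.1
      rw [iteratedDeriv_fun_sub (contDiffAt_const.mul (contDiffAt_rpow_neg hy0))
        (contDiffAt_const.mul (contDiffAt_rpow_neg hy0)), iteratedDeriv_const_mul_field,
        iteratedDeriv_const_mul_field, iteratedDeriv_rpow_neg, iteratedDeriv_rpow_neg, pow_mul]
      simpa using h y hy)
  simp only [mul_one] at h1
  rw [intervalIntegral.integral_sub ((intervalIntegrable_rpow_neg hp hpq).const_mul a)
    ((intervalIntegrable_rpow_neg hp hpq).const_mul b), intervalIntegral.integral_const_mul,
    intervalIntegral.integral_const_mul] at h1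
  have h2 : ∑ j, v j * (a * x j ^ (-r) - b * x j ^ (-s)) =
      a * ∑ j, v j * x j ^ (-r) - b * ∑ j, v j * x j ^ (-s) := by
    rw [Finset.mul_sum, Finset.mul_sum, ← Finset.sum_sub_distrib]
    exact Finset.sum_congr rfl fun j _ => by ring
  rw [h2] at h1
  linarith

/-- The derivatives of order 2m of y^(-α-1) and 1/y have ratio (α+1)_{2m}/(2m)! · y^(-α), with the
rising factorial. It is at most (2m+1) p^(-α) because α + 1 ≤ 2; that it is at least q^(-α) gives
the converse bound `IsGaussQuadrature.le_error_rpow`. -/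
theorem IsGaussQuadrature.error_rpow_le (hG : IsGaussQuadrature (fun _ => 1) p q m x v)
    (hp : 0 < p) (hpq : p ≤ q) (hα : 0 < α) (hα1 : α < 1) :
    (∫ y in p..q, y ^ (-(α + 1))) - ∑ j, v j * x j ^ (-(α + 1)) ≤
      (2 * m + 1) * p ^ (-α) * ((∫ y in p..q, y⁻¹) - ∑ j, v j * (x j)⁻¹) := by
  have h := hG.error_combination_nonneg hp hpq (a := (2 * m + 1) * p ^ (-α)) (b := 1)
    (r := 1) (s := α + 1) (fun y hy => by
      have hy0 := hp.trans_le hy.1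
      have h1 := ascPochhammer_le_factorial (show 0 < α + 1 by linarith) (by linarith) (2 * m)
      have h2 : y ^ (-(α + 1) - (2 * m : ℕ)) = y ^ (-α) * y ^ (-1 - ((2 * m : ℕ) : ℝ)) := by
        rw [← Real.rpow_add hy0]; congr 1; ring
      have h3 : y ^ (-α) ≤ p ^ (-α) :=
        Real.rpow_le_rpow_of_nonpos hp hy.1 (by linarith)
      have h4 : 0 ≤ y ^ (-1 - ((2 * m : ℕ) : ℝ)) := Real.rpow_nonneg hy0.le _
      rw [ascPochhammer_eval_one, h2, one_mul, sub_nonneg]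
      push_cast at h1 ⊢
      calc (ascPochhammer ℝ (2 * m)).eval (α + 1) * (y ^ (-α) * y ^ (-1 - 2 * (m : ℝ)))
          ≤ ((2 * m + 1) * (2 * m).factorial) * (p ^ (-α) * y ^ (-1 - 2 * (m : ℝ))) := by
            push_cast at h4
            refine mul_le_mul h1 (mul_le_mul_of_nonneg_right h3 h4) ?_ (by positivity)
            exact mul_nonneg (Real.rpow_nonneg hy0.le _) h4
        _ = _ := by ring)
  simpa only [one_mul, Real.rpow_neg_one] using h

theorem IsGaussQuadrature.le_error_rpow (hG : IsGaussQuadrature (fun _ => 1) p q m x v)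
    (hp : 0 < p) (hpq : p ≤ q) (hα : 0 < α) :
    q ^ (-α) * ((∫ y in p..q, y⁻¹) - ∑ j, v j * (x j)⁻¹) ≤
      (∫ y in p..q, y ^ (-(α + 1))) - ∑ j, v j * x j ^ (-(α + 1)) := by
  have h := hG.error_combination_nonneg hp hpq (a := 1) (b := q ^ (-α))
    (r := α + 1) (s := 1) (fun y hy => by
      have hy0 := hp.trans_le hy.1
      have h1 := factorial_le_ascPochhammer (show 1 ≤ α + 1 by linarith) (2 * m)
      have h2 : y ^ (-(α + 1) - (2 * m : ℕ)) = y ^ (-α) * y ^ (-1 - ((2 * m : ℕ) : ℝ)) := by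
        rw [← Real.rpow_add hy0]; congr 1; ring
      have h3 : q ^ (-α) ≤ y ^ (-α) :=
        Real.rpow_le_rpow_of_nonpos hy0 hy.2 (by linarith)
      have h4 : 0 ≤ y ^ (-1 - ((2 * m : ℕ) : ℝ)) := Real.rpow_nonneg hy0.le _
      rw [ascPochhammer_eval_one, h2, one_mul, sub_nonneg]
      calc q ^ (-α) * ((2 * m).factorial * y ^ (-1 - ((2 * m : ℕ) : ℝ)))
          = (2 * m).factorial * (q ^ (-α) * y ^ (-1 - ((2 * m : ℕ) : ℝ))) := by ring
        _ ≤ _ := mul_le_mul h1 (mul_le_mul_of_nonneg_right h3 h4)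
            (mul_nonneg (Real.rpow_nonneg (hp.le.trans hpq) _) h4)
            (ascPochhammer_pos _ _ (by linarith)).le)
  simpa only [one_mul, Real.rpow_neg_one] using h

theorem IsGaussQuadrature.error_rpow_mul_exp_nonneg
    (hG : IsGaussQuadrature (fun _ => 1) p q m x v) (hp : 0 < p) (hpq : p ≤ q) {r t : ℝ}
    (hr : 0 ≤ r) (ht : 0 ≤ t) :
    ∑ j, v j * (x j ^ (-r) * Real.exp (-t * x j)) ≤
      ∫ y in p..q, y ^ (-r) * Real.exp (-t * y) := by
  have h := hG.error_nonneg hpq intervalIntegrable_const (fun _ _ => zero_le_one)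
    (f := fun y => y ^ (-r) * Real.exp (-t * y)) (fun y hy =>
      (contDiffAt_rpow_neg (hp.trans_le hy.1)).mul (by fun_prop))
    (fun y hy => iteratedDeriv_rpow_neg_mul_exp_nonneg hr ht (hp.trans_le hy.1) m)
  simpa using h

theorem IsGaussQuadrature.error_exp_nonneg {ρ : ℝ → ℝ} (hG : IsGaussQuadrature ρ p q m x v)
    (hpq : p ≤ q) (hρ : IntervalIntegrable ρ volume p q) (hρ0 : ∀ y ∈ Icc p q, 0 ≤ ρ y) (t : ℝ) :
    ∑ j, v j * Real.exp (-t * x j) ≤ ∫ y in p..q, Real.exp (-t * y) * ρ y := by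
  refine hG.error_nonneg hpq hρ hρ0 (f := fun y => Real.exp (-t * y))
    (fun y _ => by fun_prop) fun y _ => ?_
  rw [iteratedDeriv_exp_const_mul, pow_mul]
  positivity

/-- On an interval starting at 0 the comparison function is a monomial: t^(2m) y^(2m)/(2m)! -
e^(-ty) has derivative t^(2m) (1 - e^(-ty)) ≥ 0 of order 2m. The quadrature sum of the monomial is
nonnegative and is dropped. -/
theorem IsGaussQuadrature.error_exp_le {ρ : ℝ → ℝ} (hG : IsGaussQuadrature ρ 0 q m x v)
    (hq : 0 ≤ q) (hρ : IntervalIntegrable ρ volume 0 q) (hρ0 : ∀ y ∈ Icc 0 q, 0 ≤ ρ y) {t : ℝ}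
    (ht : 0 ≤ t) :
    (∫ y in 0..q, Real.exp (-t * y) * ρ y) - ∑ j, v j * Real.exp (-t * x j) ≤
      (q * t) ^ (2 * m) / (2 * m).factorial * ∫ y in 0..q, ρ y := by
  set c := t ^ (2 * m) / (2 * m).factorial with hc
  have h := hG.error_nonneg hq hρ hρ0 (f := fun y => c * y ^ (2 * m) - Real.exp (-t * y))
    (fun y _ => by fun_prop) (fun y hy => by
      have h1 : ContDiffAt ℝ ((2 * m : ℕ) : WithTop ℕ∞) (fun y : ℝ => c * y ^ (2 * m)) y := by
        fun_prop
      have h2 : ContDiffAt ℝ ((2 * m : ℕ) : WithTop ℕ∞) (fun y : ℝ => Real.exp (-t * y)) y := by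
        fun_prop
      rw [iteratedDeriv_fun_sub h1 h2, iteratedDeriv_const_mul_field, iteratedDeriv_pow,
        iteratedDeriv_exp_const_mul, Nat.descFactorial_self, Nat.sub_self, pow_zero, mul_one, hc,
        div_mul_cancel₀ _ (by positivity), (even_two_mul m).neg_pow]
      have h3 : Real.exp (-t * y) ≤ 1 := Real.exp_le_one_iff.2 (by nlinarith [hy.1])
      nlinarith [pow_nonneg ht (2 * m)])
  have hi1 : IntervalIntegrable (fun y => c * y ^ (2 * m) * ρ y) volume 0 q :=
    intervalIntegrable_mul_of_continuousOn hq hρ (by fun_prop)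
  have hi2 : IntervalIntegrable (fun y => Real.exp (-t * y) * ρ y) volume 0 q :=
    intervalIntegrable_mul_of_continuousOn hq hρ (by fun_prop)
  simp only [sub_mul, mul_sub, Finset.sum_sub_distrib] at h
  rw [intervalIntegral.integral_sub hi1 hi2] at h
  have h4 : 0 ≤ ∑ j, v j * (c * x j ^ (2 * m)) := Finset.sum_nonneg fun j _ =>
    mul_nonneg (hG.weight_nonneg hq hρ0 j) (mul_nonneg (by positivity)
      ((even_two_mul m).pow_nonneg _))
  have h5 : ∫ y in 0..q, c * y ^ (2 * m) * ρ y ≤ ∫ y in 0..q, c * q ^ (2 * m) * ρ y := by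
    refine intervalIntegral.integral_mono_on hq hi1 (hρ.const_mul _) fun y hy => ?_
    have := hρ0 y hy
    have := hy.1
    have : y ^ (2 * m) ≤ q ^ (2 * m) := pow_le_pow_left₀ hy.1 hy.2 _
    gcongr
  rw [intervalIntegral.integral_const_mul] at h5
  have h6 : c * q ^ (2 * m) = (q * t) ^ (2 * m) / (2 * m).factorial := by
    rw [hc, mul_pow]; ring
  rw [h6] at h5
  linarith

end

end RoughKernel
end

/-! ### Laplace representation of the kernel; composite rules -/

noncomputable section

namespace RoughKernel
open MeasureTheory

section Laplace

variable {α T : ℝ}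

theorem integral_exp_neg_mul {y : ℝ} (hy : y ≠ 0) (T : ℝ) :
    ∫ t in (0 : ℝ)..T, Real.exp (-t * y) = (1 - Real.exp (-T * y)) / y := by
  have : ∀ t ∈ uIcc 0 T, HasDerivAt (fun t => -Real.exp (-t * y) / y) (Real.exp (-t * y)) t := by
    intro t _
    have h1 : HasDerivAt (fun t : ℝ => -t * y) (-1 * y) t := (hasDerivAt_id t).neg.mul_const y
    convert! (h1.exp.neg.div_const y) using 1
    field_simp
  rw [intervalIntegral.integral_eq_sub_of_hasDerivAt this
    (Continuous.intervalIntegrable (by fun_prop) _ _)]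
  simp
  ring

theorem one_sub_exp_div_le {T y : ℝ} (hy : 0 < y) : (1 - Real.exp (-T * y)) / y ≤ T := by
  rw [div_le_iff₀ hy]
  have := Real.add_one_le_exp (-T * y)
  linarith

theorem one_sub_exp_div_nonneg {T y : ℝ} (hT : 0 ≤ T) (hy : 0 < y) :
    0 ≤ (1 - Real.exp (-T * y)) / y := by
  refine div_nonneg (sub_nonneg.2 (Real.exp_le_one_iff.2 ?_)) hy.le
  nlinarith

/-- The factor (1 - e^(-Ty))/y is at most T, which is used near 0, and at most 1/y, which is used at
infinity. -/
theorem integrableOn_rpow_mul_one_sub_exp (hα : 0 < α) (hα1 : α < 1) (hT : 0 < T) :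
    IntegrableOn (fun y : ℝ => y ^ (-α) * ((1 - Real.exp (-T * y)) / y)) (Ioi 0) := by
  have hmeas : Measurable (fun y : ℝ => y ^ (-α) * ((1 - Real.exp (-T * y)) / y)) := by fun_prop
  rw [← Ioc_union_Ioi_eq_Ioi (zero_le_one' ℝ)]
  refine IntegrableOn.union ?_ ?_
  · have h : IntegrableOn (fun y : ℝ => T * y ^ (-α)) (Ioc 0 1) := by
      have := (intervalIntegral.intervalIntegrable_rpow' (a := 0) (b := 1)
        (show -1 < -α by linarith)).const_mul T
      rwa [intervalIntegrable_iff_integrableOn_Ioc_of_le zero_le_one] at this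
    refine Integrable.mono' h hmeas.aestronglyMeasurable ?_
    refine (ae_restrict_mem measurableSet_Ioc).mono fun y hy => ?_
    have h1 := Real.rpow_nonneg hy.1.le (-α)
    have h2 := one_sub_exp_div_nonneg hT.le hy.1
    rw [Real.norm_of_nonneg (mul_nonneg h1 h2), mul_comm]
    exact mul_le_mul_of_nonneg_right (one_sub_exp_div_le hy.1) h1
  · have h : IntegrableOn (fun y : ℝ => y ^ (-(α + 1))) (Ioi 1) :=
      integrableOn_Ioi_rpow_of_lt (by linarith) one_pos
    refine Integrable.mono' h hmeas.aestronglyMeasurable ?_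
    refine (ae_restrict_mem measurableSet_Ioi).mono fun y hy => ?_
    have hy0 : 0 < y := one_pos.trans hy
    have h1 := Real.rpow_nonneg hy0.le (-α)
    have h2 := one_sub_exp_div_nonneg hT.le hy0
    rw [Real.norm_of_nonneg (mul_nonneg h1 h2), neg_add, Real.rpow_add hy0, Real.rpow_neg_one]
    refine mul_le_mul_of_nonneg_left ?_ h1
    rw [← one_div]
    refine div_le_div_of_nonneg_right ?_ hy0.le
    linarith [Real.exp_pos (-T * y)]

theorem integrable_laplace (hα : 0 < α) (hα1 : α < 1) (hT : 0 < T) :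
    Integrable (fun z : ℝ × ℝ => z.2 ^ (-α) * Real.exp (-z.1 * z.2))
      ((volume.restrict (Ioc 0 T)).prod (volume.restrict (Ioi 0))) := by
  have hmeas : Measurable (fun z : ℝ × ℝ => z.2 ^ (-α) * Real.exp (-z.1 * z.2)) := by fun_prop
  rw [integrable_prod_iff' hmeas.aestronglyMeasurable]
  constructor
  · refine ae_of_all _ fun y => ?_
    have : Continuous (fun t : ℝ => y ^ (-α) * Real.exp (-t * y)) := by fun_prop
    exact (this.integrableOn_Icc (a := 0) (b := T)).mono_set Ioc_subset_Icc_self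
  · refine (integrableOn_rpow_mul_one_sub_exp hα hα1 hT).congr ?_
    refine (ae_restrict_mem measurableSet_Ioi).mono fun y (hy : 0 < y) => ?_
    simp only
    have : ∀ t, ‖y ^ (-α) * Real.exp (-t * y)‖ = y ^ (-α) * Real.exp (-t * y) := fun t =>
      Real.norm_of_nonneg (mul_nonneg (Real.rpow_nonneg hy.le _) (Real.exp_pos _).le)
    simp only [this]
    rw [integral_const_mul, ← intervalIntegral.integral_of_le hT.le, integral_exp_neg_mul hy.ne']

theorem integrable_laplace_on (hα : 0 < α) (hα1 : α < 1) (hT : 0 < T) {S : Set ℝ}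
    (hS : S ⊆ Ioi 0) : Integrable (fun z : ℝ × ℝ => z.2 ^ (-α) * Real.exp (-z.1 * z.2))
      ((volume.restrict (Ioc 0 T)).prod (volume.restrict S)) := by
  have := integrable_laplace hα hα1 hT
  rw [Measure.prod_restrict] at this ⊢
  exact IntegrableOn.mono_set this (prod_mono le_rfl hS)

theorem intervalIntegrable_laplace (hα : 0 < α) (hα1 : α < 1) (hT : 0 < T) {S : Set ℝ}
    (hS : S ⊆ Ioi 0) :
    IntervalIntegrable (fun t => ∫ y in S, y ^ (-α) * Real.exp (-t * y)) volume 0 T := by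
  rw [intervalIntegrable_iff_integrableOn_Ioc_of_le hT.le]
  exact (integrable_laplace_on hα hα1 hT hS).integral_prod_left

theorem integral_laplace (hα : 0 < α) (hα1 : α < 1) (hT : 0 < T) {S : Set ℝ}
    (hS : S ⊆ Ioi 0) (hSm : MeasurableSet S) :
    ∫ t in (0 : ℝ)..T, ∫ y in S, y ^ (-α) * Real.exp (-t * y) =
      ∫ y in S, y ^ (-α) * ((1 - Real.exp (-T * y)) / y) := by
  rw [intervalIntegral.integral_of_le hT.le,
    integral_integral_swap (f := fun t y => y ^ (-α) * Real.exp (-t * y))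
      (integrable_laplace_on hα hα1 hT hS)]
  refine setIntegral_congr_fun hSm fun y hy => ?_
  have hy0 : 0 < y := hS hy
  rw [integral_const_mul, ← intervalIntegral.integral_of_le hT.le, integral_exp_neg_mul hy0.ne']

theorem integrableOn_rpow_mul_exp (hα1 : α < 1) {t : ℝ} (ht : 0 < t) :
    IntegrableOn (fun y : ℝ => y ^ (-α) * Real.exp (-t * y)) (Ioi 0) := by
  have := integrableOn_rpow_mul_exp_neg_mul_rpow (s := -α) (p := 1) (b := t) (by linarith)
    one_pos ht
  simpa using this

theorem fracKernel_eq_laplace {H t : ℝ} (hH : -1 / 2 < H) (hH' : H < 1 / 2) (ht : 0 < t) :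
    fracKernel H t = cH H * ∫ y in Ioi 0, y ^ (-(H + 1 / 2)) * Real.exp (-t * y) := by
  have h := Real.integral_rpow_mul_exp_neg_mul_Ioi (a := 1 / 2 - H) (r := t) (by linarith) ht
  have h1 : ∫ y in Ioi (0 : ℝ), y ^ (-(H + 1 / 2)) * Real.exp (-t * y) =
      (1 / t) ^ (1 / 2 - H) * Real.Gamma (1 / 2 - H) := by
    rw [← h]
    congr 1
    ext y
    congr 2 <;> ring
  have h2 := Real.Gamma_pos_of_pos (show 0 < H + 1 / 2 by linarith)
  have h3 := Real.Gamma_pos_of_pos (show 0 < 1 / 2 - H by linarith)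
  rw [h1, fracKernel, cH, one_div t, Real.inv_rpow ht.le, ← Real.rpow_neg ht.le,
    show -(1 / 2 - H) = H - 1 / 2 by ring]
  generalize Real.Gamma (H + 1 / 2) = A at *
  generalize Real.Gamma (1 / 2 - H) = B at *
  field_simp

theorem integral_Ioi_rpow_neg {ξ : ℝ} (hα : 0 < α) (hξ : 0 < ξ) :
    ∫ y in Ioi ξ, y ^ (-(α + 1)) = ξ ^ (-α) / α := by
  rw [integral_Ioi_rpow_of_lt (by linarith) hξ, show -(α + 1) + 1 = -α by ring, neg_div_neg_eq]

theorem rpow_mul_one_sub_exp_div {y : ℝ} (hy : 0 < y) (T : ℝ) :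
    y ^ (-α) * ((1 - Real.exp (-T * y)) / y) =
      y ^ (-(α + 1)) - y ^ (-(α + 1)) * Real.exp (-T * y) := by
  rw [neg_add, Real.rpow_add hy, Real.rpow_neg_one]
  field_simp

theorem integrableOn_rpow_mul_exp_Ioi {ξ : ℝ} (hα : 0 < α) (hξ : 0 < ξ) (hT : 0 ≤ T) :
    IntegrableOn (fun y : ℝ => y ^ (-(α + 1)) * Real.exp (-T * y)) (Ioi ξ) := by
  refine Integrable.mono' (integrableOn_Ioi_rpow_of_lt (a := -(α + 1)) (by linarith) hξ)
    (by fun_prop) ?_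
  refine (ae_restrict_mem measurableSet_Ioi).mono fun y (hy : ξ < y) => ?_
  have hy0 : 0 < y := hξ.trans hy
  have h1 := Real.rpow_nonneg hy0.le (-(α + 1))
  rw [Real.norm_of_nonneg (mul_nonneg h1 (Real.exp_pos _).le)]
  refine mul_le_of_le_one_right h1 (Real.exp_le_one_iff.2 (by nlinarith))

theorem integral_rpow_mul_exp_Ioi_le {ξ : ℝ} (hα : 0 < α) (hξ : 0 < ξ) (hT : 0 ≤ T) :
    ∫ y in Ioi ξ, y ^ (-(α + 1)) * Real.exp (-T * y) ≤
      Real.exp (-T * ξ) * (ξ ^ (-α) / α) := by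
  rw [← integral_Ioi_rpow_neg hα hξ, ← integral_const_mul]
  refine setIntegral_mono_on (integrableOn_rpow_mul_exp_Ioi hα hξ hT)
    ((integrableOn_Ioi_rpow_of_lt (by linarith) hξ).const_mul _) measurableSet_Ioi
    fun y (hy : ξ < y) => ?_
  rw [mul_comm]
  refine mul_le_mul_of_nonneg_right (Real.exp_le_exp.2 (by nlinarith))
    (Real.rpow_nonneg (hξ.trans hy).le _)

theorem integral_tail {ξ : ℝ} (hα : 0 < α) (hξ : 0 < ξ) (hT : 0 ≤ T) :
    ∫ y in Ioi ξ, y ^ (-α) * ((1 - Real.exp (-T * y)) / y) =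
      ξ ^ (-α) / α - ∫ y in Ioi ξ, y ^ (-(α + 1)) * Real.exp (-T * y) := by
  rw [← integral_Ioi_rpow_neg hα hξ,
    ← integral_sub (integrableOn_Ioi_rpow_of_lt (by linarith) hξ)
      (integrableOn_rpow_mul_exp_Ioi hα hξ hT)]
  exact setIntegral_congr_fun measurableSet_Ioi fun y (hy : ξ < y) =>
    rpow_mul_one_sub_exp_div (hξ.trans hy) T

end Laplace

/-- A composite Gaussian rule for the density `κ y^(-α)` on the intervals `[ξ_i, ξ_{i+1}]`. -/
structure IsCompositeRule (κ α : ℝ) (ξ : ℕ → ℝ) {n m : ℕ} (x w : Fin n → Fin m → ℝ) : Prop where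
  zero : ξ 0 = 0
  pos : 0 < ξ 1
  lt : ∀ i : ℕ, 1 ≤ i → i < n → ξ i < ξ (i + 1)
  first : ∀ i : Fin n, (i : ℕ) = 0 →
    IsGaussQuadrature (fun y => κ * y ^ (-α)) 0 (ξ 1) m (x i) (w i)
  rest : ∀ i : Fin n, 1 ≤ (i : ℕ) → ∃ v : Fin m → ℝ,
    IsGaussQuadrature (fun _ => 1) (ξ i) (ξ (i + 1)) m (x i) v ∧
      ∀ j, w i j = κ * v j * x i j ^ (-α)

/-- The error of a composite rule on the interval `i`, for the integrand `exp (-t y)`. -/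
def pieceError (κ α : ℝ) (ξ : ℕ → ℝ) {n m : ℕ} (x w : Fin n → Fin m → ℝ) (i : Fin n) (t : ℝ) : ℝ :=
  κ * (∫ y in Ioc (ξ i) (ξ (i + 1)), y ^ (-α) * Real.exp (-t * y)) -
    ∑ j, w i j * Real.exp (-x i j * t)

section Composite

variable {κ α T : ℝ} {ξ : ℕ → ℝ} {n m : ℕ} {x w : Fin n → Fin m → ℝ}

theorem IsCompositeRule.pos_of_le (hC : IsCompositeRule κ α ξ x w) {i : ℕ} (hi : 1 ≤ i)
    (hin : i ≤ n) : 0 < ξ i := by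
  induction i, hi using Nat.le_induction with
  | base => exact hC.pos
  | succ k hk ih => exact (ih (by omega)).trans (hC.lt k hk (by omega))

theorem IsCompositeRule.nonneg (hC : IsCompositeRule κ α ξ x w) {i : ℕ} (hin : i ≤ n) :
    0 ≤ ξ i := by
  rcases Nat.eq_zero_or_pos i with rfl | hi
  · exact hC.zero.ge
  · exact (hC.pos_of_le hi hin).le

theorem IsCompositeRule.le_succ (hC : IsCompositeRule κ α ξ x w) {i : ℕ} (hin : i < n) :
    ξ i ≤ ξ (i + 1) := by
  rcases Nat.eq_zero_or_pos i with rfl | hi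
  · rw [hC.zero]; exact hC.nonneg (by omega)
  · exact (hC.lt i hi hin).le

theorem IsCompositeRule.error_eq_sum (hC : IsCompositeRule κ α ξ x w) (hα1 : α < 1) {t : ℝ}
    (ht : 0 < t) :
    κ * (∫ y in Ioi 0, y ^ (-α) * Real.exp (-t * y)) - approxKernel x w t =
      ∑ i, pieceError κ α ξ x w i t +
        κ * ∫ y in Ioi (ξ n), y ^ (-α) * Real.exp (-t * y) := by
  set f := fun y : ℝ => y ^ (-α) * Real.exp (-t * y)
  have hf : IntegrableOn f (Ioi 0) := integrableOn_rpow_mul_exp hα1 ht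
  have h1 : ∑ i : Fin n, ∫ y in Ioc (ξ i) (ξ (i + 1)), f y = ∫ y in Ioc 0 (ξ n), f y := by
    have h2 := intervalIntegral.sum_integral_adjacent_intervals (a := ξ) (n := n) (f := f)
      (μ := volume) (fun k hk => by
        rw [intervalIntegrable_iff_integrableOn_Ioc_of_le (hC.le_succ hk)]
        exact hf.mono_set fun y hy => (hC.nonneg hk.le).trans_lt hy.1)
    rw [hC.zero, intervalIntegral.integral_of_le (hC.nonneg le_rfl)] at h2
    rw [← h2, Finset.sum_range]
    exact Finset.sum_congr rfl fun i _ =>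
      (intervalIntegral.integral_of_le (hC.le_succ i.2)).symm
  have h3 : ∫ y in Ioi 0, f y = (∫ y in Ioc 0 (ξ n), f y) + ∫ y in Ioi (ξ n), f y := by
    rw [← setIntegral_union (Set.Ioc_disjoint_Ioi le_rfl) measurableSet_Ioi
      (hf.mono_set Ioc_subset_Ioi_self) (hf.mono_set (Ioi_subset_Ioi (hC.nonneg le_rfl))),
      Ioc_union_Ioi_eq_Ioi (hC.nonneg le_rfl)]
  simp only [pieceError, approxKernel, Finset.sum_sub_distrib, ← Finset.mul_sum]
  rw [h3, ← h1]
  ring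

theorem IsCompositeRule.intervalIntegrable_density (hα1 : α < 1) (p q : ℝ) :
    IntervalIntegrable (fun y : ℝ => κ * y ^ (-α)) volume p q :=
  (intervalIntegral.intervalIntegrable_rpow' (by linarith)).const_mul κ

/-- On the first interval the singular power is the weight function and e^(-ty) the integrand; on
the others the power belongs to the integrand. -/
theorem IsCompositeRule.pieceError_nonneg (hC : IsCompositeRule κ α ξ x w) (hκ : 0 < κ)
    (hα : 0 < α) (hα1 : α < 1) (i : Fin n) {t : ℝ} (ht : 0 ≤ t) :
    0 ≤ pieceError κ α ξ x w i t := by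
  rw [pieceError, sub_nonneg, ← intervalIntegral.integral_of_le (hC.le_succ i.2)]
  rcases Nat.eq_zero_or_pos i with hi | hi
  · have h := (hC.first i hi).error_exp_nonneg hC.pos.le
      (IsCompositeRule.intervalIntegrable_density hα1 _ _)
      (fun y hy => mul_nonneg hκ.le (Real.rpow_nonneg hy.1 _)) t
    rw [hi, hC.zero, ← intervalIntegral.integral_const_mul]
    calc _ = ∑ j, w i j * Real.exp (-t * x i j) := by
          refine Finset.sum_congr rfl fun j _ => ?_
          ring_nf
      _ ≤ _ := h
      _ = _ := by
          congr 1; ext y; ring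
  · obtain ⟨v, hv, hw⟩ := hC.rest i hi
    have hp := hC.pos_of_le hi i.2.le
    have h := hv.error_rpow_mul_exp_nonneg hp (hC.le_succ i.2) hα.le ht
    calc _ = κ * ∑ j, v j * (x i j ^ (-α) * Real.exp (-t * x i j)) := by
          rw [Finset.mul_sum]
          refine Finset.sum_congr rfl fun j _ => ?_
          rw [hw]; ring_nf
      _ ≤ _ := mul_le_mul_of_nonneg_left h hκ.le

theorem IsCompositeRule.pieceError_first_le (hC : IsCompositeRule κ α ξ x w) (hκ : 0 < κ)
    (hα1 : α < 1) (i : Fin n) (hi : (i : ℕ) = 0) {t : ℝ} (ht : 0 ≤ t) :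
    pieceError κ α ξ x w i t ≤
      (ξ 1 * t) ^ (2 * m) / (2 * m).factorial * ∫ y in 0..ξ 1, κ * y ^ (-α) := by
  have h := (hC.first i hi).error_exp_le hC.pos.le
      (IsCompositeRule.intervalIntegrable_density hα1 _ _)
      (fun y hy => mul_nonneg hκ.le (Real.rpow_nonneg hy.1 _)) ht
  rw [pieceError, ← intervalIntegral.integral_of_le (hC.le_succ i.2), hi, hC.zero, zero_add,
    ← intervalIntegral.integral_const_mul]
  convert h using 2
  · congr 1; ext y; ring
  · refine Finset.sum_congr rfl fun j _ => ?_
    ring_nf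

theorem IsCompositeRule.Ioc_subset (hC : IsCompositeRule κ α ξ x w) (i : Fin n) :
    Ioc (ξ i) (ξ (i + 1)) ⊆ Ioi 0 := fun _ hy => (hC.nonneg i.2.le).trans_lt hy.1

theorem IsCompositeRule.intervalIntegrable_pieceError (hC : IsCompositeRule κ α ξ x w)
    (hα : 0 < α) (hα1 : α < 1) (hT : 0 < T) (i : Fin n) :
    IntervalIntegrable (pieceError κ α ξ x w i) volume 0 T :=
  ((intervalIntegrable_laplace hα hα1 hT (hC.Ioc_subset i)).const_mul κ).sub
    (Continuous.intervalIntegrable (by fun_prop) _ _)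

/-- The time integral of the error on an interval away from `0`. -/
theorem IsCompositeRule.integral_pieceError (hC : IsCompositeRule κ α ξ x w)
    (hα : 0 < α) (hα1 : α < 1) (hT : 0 < T) (i : Fin n) (hi : 1 ≤ (i : ℕ)) {v : Fin m → ℝ}
    (hv : IsGaussQuadrature (fun _ => 1) (ξ i) (ξ (i + 1)) m (x i) v)
    (hw : ∀ j, w i j = κ * v j * x i j ^ (-α)) :
    ∫ t in (0 : ℝ)..T, pieceError κ α ξ x w i t =
      κ * (((∫ y in ξ i..ξ (i + 1), y ^ (-(α + 1))) - ∑ j, v j * x i j ^ (-(α + 1))) -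
        ((∫ y in ξ i..ξ (i + 1), y ^ (-(α + 1)) * Real.exp (-T * y)) -
          ∑ j, v j * (x i j ^ (-(α + 1)) * Real.exp (-T * x i j)))) := by
  have hp := hC.pos_of_le hi i.2.le
  have hpq := hC.le_succ i.2
  have hx : ∀ j, 0 < x i j := fun j => hp.trans_le (hv.mem j).1
  simp only [pieceError]
  rw [intervalIntegral.integral_sub
      ((intervalIntegrable_laplace hα hα1 hT (hC.Ioc_subset i)).const_mul κ)
      (Continuous.intervalIntegrable (by fun_prop) _ _),
    intervalIntegral.integral_const_mul,
    integral_laplace hα hα1 hT (hC.Ioc_subset i) measurableSet_Ioc,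
    ← intervalIntegral.integral_of_le hpq,
    intervalIntegral.integral_finsetSum
      (fun j _ => Continuous.intervalIntegrable (by fun_prop) _ _)]
  have h1 : ∫ y in ξ i..ξ (i + 1), y ^ (-α) * ((1 - Real.exp (-T * y)) / y) =
      (∫ y in ξ i..ξ (i + 1), y ^ (-(α + 1))) -
        ∫ y in ξ i..ξ (i + 1), y ^ (-(α + 1)) * Real.exp (-T * y) := by
    rw [← intervalIntegral.integral_sub (intervalIntegrable_rpow_neg hp hpq)
      ((intervalIntegrable_rpow_neg hp hpq).mul_continuousOn (by fun_prop))]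
    refine intervalIntegral.integral_congr fun y hy => ?_
    rw [uIcc_of_le hpq] at hy
    exact rpow_mul_one_sub_exp_div (hp.trans_le hy.1) T
  have h2 : ∀ j, ∫ t in (0 : ℝ)..T, w i j * Real.exp (-x i j * t) =
      κ * (v j * x i j ^ (-(α + 1)) - v j * (x i j ^ (-(α + 1)) * Real.exp (-T * x i j))) := by
    intro j
    have : ∀ t, Real.exp (-x i j * t) = Real.exp (-t * x i j) := fun t => by ring_nf
    simp only [this]
    rw [intervalIntegral.integral_const_mul, integral_exp_neg_mul (hx j).ne', hw, ← mul_sub,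
      ← rpow_mul_one_sub_exp_div (hx j) T]
    ring
  simp only [h1, h2]
  rw [← Finset.mul_sum, Finset.sum_sub_distrib]
  ring

/-- The part with e^(-Ty) has a nonnegative quadrature error and enters with a minus sign, so it can
be dropped. -/
theorem IsCompositeRule.integral_pieceError_le (hC : IsCompositeRule κ α ξ x w) (hκ : 0 < κ)
    (hα : 0 < α) (hα1 : α < 1) (hT : 0 < T) (hm : 0 < m) (i : Fin n) (hi : 1 ≤ (i : ℕ)) {θ : ℝ}
    (hθ : ξ (i + 1) + ξ i = (ξ (i + 1) - ξ i) * Real.cosh θ) :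
    ∫ t in (0 : ℝ)..T, pieceError κ α ξ x w i t ≤
      κ * ((2 * m + 1) * ξ i ^ (-α) *
        (2 * (ξ (i + 1) - ξ i) / ξ i / Real.cosh (2 * m * θ))) := by
  obtain ⟨v, hv, hw⟩ := hC.rest i hi
  have hp := hC.pos_of_le hi i.2.le
  have hpq := hC.lt i hi i.2
  rw [hC.integral_pieceError hα hα1 hT i hi hv hw]
  refine mul_le_mul_of_nonneg_left ?_ hκ.le
  have h1 := hv.error_rpow_mul_exp_nonneg hp hpq.le (r := α + 1) (by linarith) hT.le
  have h2 := hv.error_rpow_le hp hpq.le hα hα1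
  have h3 := hv.error_inv_le hp hpq hm hθ
  have h4 : 0 ≤ (2 * m + 1) * ξ i ^ (-α) := by positivity
  have h5 := mul_le_mul_of_nonneg_left h3 h4
  linarith

/-- Here the error of the part with e^(-Ty) must be bounded from above; since its quadrature sum is
nonnegative, it is at most the integral. -/
theorem IsCompositeRule.le_integral_pieceError (hC : IsCompositeRule κ α ξ x w) (hκ : 0 < κ)
    (hα : 0 < α) (hα1 : α < 1) (hT : 0 < T) (i : Fin n) (hi : 1 ≤ (i : ℕ)) {θ : ℝ} (hθ0 : 0 < θ)
    (hθ : ξ (i + 1) + ξ i = (ξ (i + 1) - ξ i) * Real.cosh θ) :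
    κ * (ξ (i + 1) ^ (-α) * ((1 - ξ i / ξ (i + 1)) * Real.sinh θ *
        Real.exp (-((2 * m + 1) * θ)) / (2 * m + 1)) -
      ∫ y in ξ i..ξ (i + 1), y ^ (-(α + 1)) * Real.exp (-T * y)) ≤
      ∫ t in (0 : ℝ)..T, pieceError κ α ξ x w i t := by
  obtain ⟨v, hv, hw⟩ := hC.rest i hi
  have hp := hC.pos_of_le hi i.2.le
  have hpq := hC.lt i hi i.2
  rw [hC.integral_pieceError hα hα1 hT i hi hv hw]
  refine mul_le_mul_of_nonneg_left ?_ hκ.le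
  have h1 : 0 ≤ ∑ j, v j * (x i j ^ (-(α + 1)) * Real.exp (-T * x i j)) :=
    Finset.sum_nonneg fun j _ => mul_nonneg
      (hv.weight_nonneg hpq.le (fun _ _ => zero_le_one) j)
      (mul_nonneg (Real.rpow_nonneg (hp.trans_le (hv.mem j).1).le _) (Real.exp_pos _).le)
  have h2 := hv.le_error_rpow hp hpq.le hα
  have h3 := hv.le_error_inv hp hpq hθ0 hθ
  have h4 : 0 ≤ ξ (i + 1) ^ (-α) := Real.rpow_nonneg (hp.trans hpq).le _
  have h5 := mul_le_mul_of_nonneg_left h3 h4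
  linarith

/-- The `L¹`-error of a composite rule: all errors are positive, so that they add up. -/
theorem IsCompositeRule.kernelError_eq {H : ℝ} (hH : -1 / 2 < H) (hH' : H < 1 / 2)
    (hκ : 0 < cH H) (hC : IsCompositeRule (cH H) (H + 1 / 2) ξ x w) (hn : 0 < n) (hT : 0 < T) :
    kernelError H T x w = ∑ i, (∫ t in (0 : ℝ)..T, pieceError (cH H) (H + 1 / 2) ξ x w i t) +
      cH H * (ξ n ^ (-(H + 1 / 2)) / (H + 1 / 2) -
        ∫ y in Ioi (ξ n), y ^ (-(H + 1 / 2 + 1)) * Real.exp (-T * y)) := by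
  have hα : 0 < H + 1 / 2 := by linarith
  have hα1 : H + 1 / 2 < 1 := by linarith
  have hξ : 0 < ξ n := hC.pos_of_le hn le_rfl
  have hsub : Ioi (ξ n) ⊆ Ioi 0 := Ioi_subset_Ioi hξ.le
  rw [← integral_tail hα hξ hT.le, ← integral_laplace hα hα1 hT hsub measurableSet_Ioi,
    ← intervalIntegral.integral_finsetSum
      (fun i _ => hC.intervalIntegrable_pieceError hα hα1 hT i),
    ← intervalIntegral.integral_const_mul, ← intervalIntegral.integral_add ?_
      ((intervalIntegrable_laplace hα hα1 hT hsub).const_mul _), kernelError]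
  · rw [intervalIntegral.integral_of_le hT.le, intervalIntegral.integral_of_le hT.le]
    refine setIntegral_congr_fun measurableSet_Ioc fun t ht => ?_
    rw [fracKernel_eq_laplace hH hH' ht.1, hC.error_eq_sum hα1 ht.1]
    refine abs_of_nonneg (add_nonneg (Finset.sum_nonneg fun i _ =>
      hC.pieceError_nonneg hκ hα hα1 i ht.1.le) (mul_nonneg hκ.le ?_))
    exact setIntegral_nonneg measurableSet_Ioi fun y hy =>
      mul_nonneg (Real.rpow_nonneg (hsub hy).le _) (Real.exp_pos _).le
  · have := IntervalIntegrable.sum Finset.univ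
      (fun i _ => hC.intervalIntegrable_pieceError hα hα1 hT i)
    convert! this using 1
    ext t; simp

end Composite

end RoughKernel
end

/-! ### The differential equation and its travel time -/

noncomputable section

namespace RoughKernel
open MeasureTheory

/-- The right-hand side of the equation, in terms of `x = log (e^u / c) < 0`. -/
def rate (x : ℝ) : ℝ := 2 * Real.log ((1 + Real.exp x) / (1 - Real.exp x))

theorem exp_lt_one_of_neg {x : ℝ} (hx : x < 0) : 0 < 1 - Real.exp x :=
  sub_pos.2 (Real.exp_lt_one_iff.2 hx)

theorem exp_half_rate {x : ℝ} (hx : x < 0) :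
    Real.exp (rate x / 2) = (1 + Real.exp x) / (1 - Real.exp x) := by
  rw [rate, mul_div_cancel_left₀ _ two_ne_zero, Real.exp_log]
  have := exp_lt_one_of_neg hx
  positivity

theorem exp_rate {x : ℝ} (hx : x < 0) :
    Real.exp (rate x) = ((1 + Real.exp x) / (1 - Real.exp x)) ^ 2 := by
  rw [← exp_half_rate hx, ← Real.exp_nat_mul]
  congr 1; push_cast; ring

theorem rate_pos_of_neg {x : ℝ} (hx : x < 0) : 0 < rate x := by
  have h := exp_lt_one_of_neg hx
  refine mul_pos two_pos (Real.log_pos ?_)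
  rw [one_lt_div h]
  linarith [Real.exp_pos x]

/-- Since `Real.log` ignores signs, `rate` extends evenly across 0. This makes `travel` an odd
bijection of ℝ, although only x < 0 matters for the equation. -/
theorem rate_neg (x : ℝ) : rate (-x) = rate x := by
  rcases eq_or_ne x 0 with rfl | hx
  · simp
  have h : (1 + Real.exp (-x)) / (1 - Real.exp (-x)) = -((1 + Real.exp x) / (1 - Real.exp x)) := by
    have h1 : Real.exp x ≠ 1 := by simpa using hx
    have h2 : 1 - Real.exp x ≠ 0 := sub_ne_zero.2 h1.symm
    have h3 : Real.exp x - 1 ≠ 0 := sub_ne_zero.2 h1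
    rw [Real.exp_neg]
    have := Real.exp_pos x
    field_simp
    ring
  rw [rate, h, Real.log_neg_eq_log, rate]

theorem rate_zero : rate 0 = 0 := by simp [rate]

theorem rate_pos {x : ℝ} (hx : x ≠ 0) : 0 < rate x := by
  rcases lt_or_gt_of_ne hx with h | h
  · exact rate_pos_of_neg h
  · rw [← rate_neg]; exact rate_pos_of_neg (by linarith)

/-- Equivalent to e^x = tanh(rate(x)/4). It makes the derivative of `rate` a function of `rate`
alone. -/
theorem sinh_half_rate {x : ℝ} (hx : x < 0) :
    Real.sinh (rate x / 2) = 2 * Real.exp x / (1 - Real.exp x ^ 2) := by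
  have h := exp_lt_one_of_neg hx
  have h2 := Real.exp_pos x
  rw [Real.sinh_eq, Real.exp_neg, exp_half_rate hx,
    show 1 - Real.exp x ^ 2 = (1 - Real.exp x) * (1 + Real.exp x) by ring]
  field_simp
  ring

theorem hasDerivAt_rate {x : ℝ} (hx : x < 0) :
    HasDerivAt rate (2 * Real.sinh (rate x / 2)) x := by
  have h := exp_lt_one_of_neg hx
  have h2 := Real.exp_pos x
  have h3 : HasDerivAt (fun x => (1 + Real.exp x) / (1 - Real.exp x))
      ((Real.exp x * (1 - Real.exp x) - (1 + Real.exp x) * (0 - Real.exp x)) /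
        (1 - Real.exp x) ^ 2) x := by
    have := ((Real.hasDerivAt_exp x).const_add 1).div
      ((hasDerivAt_const x (1 : ℝ)).sub (Real.hasDerivAt_exp x)) h.ne'
    exact this
  have h4 := (h3.log (by positivity)).const_mul 2
  convert! h4 using 1
  rw [sinh_half_rate hx, show 1 - Real.exp x ^ 2 = (1 - Real.exp x) * (1 + Real.exp x) by ring]
  field_simp
  ring

theorem continuousAt_rate {x : ℝ} (hx : x < 0) : ContinuousAt rate x :=
  (hasDerivAt_rate hx).continuousAt

theorem strictMonoOn_rate : StrictMonoOn rate (Iio 0) := by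
  refine strictMonoOn_of_deriv_pos (convex_Iio 0)
    (fun x hx => (continuousAt_rate hx).continuousWithinAt) fun x hx => ?_
  rw [interior_Iio] at hx
  rw [(hasDerivAt_rate hx).deriv]
  have := Real.sinh_pos_iff.2 (half_pos (rate_pos_of_neg hx))
  positivity

theorem rate_le {x y : ℝ} (hxy : x ≤ y) (hy : y < 0) : rate x ≤ rate y :=
  strictMonoOn_rate.monotoneOn (hxy.trans_lt hy) hy hxy

theorem tendsto_rate_zero : Tendsto rate (𝓝[≠] 0) atTop := by
  have h1 : Tendsto (fun x => 1 - Real.exp x) (𝓝[≠] 0) (𝓝[≠] 0) := by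
    refine tendsto_nhdsWithin_iff.2 ⟨?_, ?_⟩
    · have : Tendsto (fun x => 1 - Real.exp x) (𝓝 0) (𝓝 (1 - Real.exp 0)) :=
        Continuous.tendsto (by fun_prop) 0
      rw [Real.exp_zero, sub_self] at this
      exact this.mono_left nhdsWithin_le_nhds
    · filter_upwards [self_mem_nhdsWithin] with x hx
      simp only [mem_compl_iff, mem_singleton_iff] at hx ⊢
      rw [sub_eq_zero, eq_comm, Real.exp_eq_one_iff]
      exact hx
  have h2 : Tendsto (fun x => |(1 - Real.exp x)⁻¹|) (𝓝[≠] 0) atTop :=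
    tendsto_norm_inv_nhdsNE_zero_atTop.comp h1
  have h3 : Tendsto (fun x => 2 * Real.log |(1 - Real.exp x)⁻¹|) (𝓝[≠] 0) atTop :=
    (Real.tendsto_log_atTop.comp h2).const_mul_atTop two_pos
  refine tendsto_atTop_mono' _ ?_ h3
  filter_upwards [self_mem_nhdsWithin] with x hx
  have hne : (1 - Real.exp x) ≠ 0 := by
    rw [sub_ne_zero, ne_comm, Ne, Real.exp_eq_one_iff]; exact hx
  rw [rate, ← Real.log_abs ((1 + Real.exp x) / (1 - Real.exp x)), div_eq_mul_inv, abs_mul]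
  have h4 : 0 < |(1 - Real.exp x)⁻¹| := abs_pos.2 (inv_ne_zero hne)
  have h5 : 1 ≤ |1 + Real.exp x| := by
    rw [abs_of_pos (by positivity)]; linarith [Real.exp_pos x]
  gcongr
  exact le_mul_of_one_le_left h4.le h5

/-- As `rate` blows up at 0, its inverse tends to 0, which is also the default value there because
`rate 0 = 0`. Hence the time to the boundary is finite and `travel` needs no improper integral. -/
theorem continuous_inv_rate : Continuous fun x => (rate x)⁻¹ := by
  have hneg : ∀ x < 0, ContinuousAt (fun x => (rate x)⁻¹) x := fun x hx =>
    (continuousAt_rate hx).inv₀ (rate_pos_of_neg hx).ne'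
  rw [continuous_iff_continuousAt]
  intro x
  rcases lt_trichotomy x 0 with h | rfl | h
  · exact hneg x h
  · rw [continuousAt_iff_punctured_nhds, rate_zero, inv_zero]
    exact tendsto_inv_atTop_zero.comp tendsto_rate_zero
  · have h1 : ContinuousAt (fun y => (rate (-y))⁻¹) x :=
      (hneg (-x) (by linarith)).comp (f := fun y : ℝ => -y) continuousAt_neg
    simpa only [rate_neg] using h1

/-- The (negative) time that the flow of `rate` needs from `x < 0` to the boundary `0`. -/
def travel (x : ℝ) : ℝ := ∫ y in (0 : ℝ)..x, (rate y)⁻¹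

theorem travel_zero : travel 0 = 0 := by simp [travel]

theorem travel_neg (x : ℝ) : travel (-x) = -travel x := by
  rw [travel, travel, ← intervalIntegral.integral_symm]
  have := intervalIntegral.integral_comp_neg (a := 0) (b := -x) fun y => (rate y)⁻¹
  simpa only [rate_neg, neg_neg, neg_zero] using this

theorem travel_sub (x y : ℝ) : travel y - travel x = ∫ z in x..y, (rate z)⁻¹ := by
  rw [travel, travel, intervalIntegral.integral_interval_sub_left] <;>
    exact continuous_inv_rate.intervalIntegrable _ _

theorem hasDerivAt_travel (x : ℝ) : HasDerivAt travel (rate x)⁻¹ x :=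
  intervalIntegral.integral_hasDerivAt_right (continuous_inv_rate.intervalIntegrable _ _)
    (continuous_inv_rate.stronglyMeasurableAtFilter _ _) continuous_inv_rate.continuousAt

theorem continuous_travel : Continuous travel :=
  continuous_iff_continuousAt.2 fun x => (hasDerivAt_travel x).continuousAt

theorem strictMono_travel : StrictMono travel := by
  refine StrictMonoOn.Iic_union_Ici (a := 0)
    (strictMonoOn_of_deriv_pos (convex_Iic 0) continuous_travel.continuousOn fun x hx => ?_)
    (strictMonoOn_of_deriv_pos (convex_Ici 0) continuous_travel.continuousOn fun x hx => ?_)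
  · rw [interior_Iic] at hx
    rw [(hasDerivAt_travel x).deriv]
    exact inv_pos.2 (rate_pos (ne_of_lt hx))
  · rw [interior_Ici] at hx
    rw [(hasDerivAt_travel x).deriv]
    exact inv_pos.2 (rate_pos (ne_of_gt hx))

theorem tendsto_travel_atTop : Tendsto travel atTop atTop := by
  have h1 : ∀ᶠ x : ℝ in atTop, travel 1 + (rate (-1))⁻¹ * (x - 1) ≤ travel x := by
    filter_upwards [eventually_ge_atTop 1] with x hx
    have h2 : ∫ _ in (1 : ℝ)..x, (rate (-1))⁻¹ ≤ ∫ z in (1 : ℝ)..x, (rate z)⁻¹ := by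
      refine intervalIntegral.integral_mono_on hx intervalIntegrable_const
        (continuous_inv_rate.intervalIntegrable _ _) fun z hz => ?_
      rw [← rate_neg z]
      exact inv_anti₀ (rate_pos_of_neg (by linarith [hz.1])) (rate_le (by linarith [hz.1])
        (by norm_num))
    rw [← travel_sub, intervalIntegral.integral_const, smul_eq_mul] at h2
    linarith
  refine tendsto_atTop_mono' _ h1 (tendsto_atTop_add_const_left _ _ ?_)
  exact (tendsto_atTop_add_const_right _ _ tendsto_id).const_mul_atTop
    (inv_pos.2 (rate_pos_of_neg (by norm_num)))

theorem surjective_travel : Function.Surjective travel := by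
  refine continuous_travel.surjective tendsto_travel_atTop ?_
  have h1 : Tendsto (fun x => -travel (-x)) atBot atBot :=
    tendsto_neg_atTop_atBot.comp (tendsto_travel_atTop.comp tendsto_neg_atBot_atTop)
  simpa only [travel_neg, neg_neg] using h1

/-- `travel` as an order isomorphism. -/
def travelIso : ℝ ≃o ℝ := strictMono_travel.orderIsoOfSurjective _ surjective_travel

/-- The inverse function of `travel`. -/
def position (t : ℝ) : ℝ := travelIso.symm t

theorem travel_position (t : ℝ) : travel (position t) = t := travelIso.apply_symm_apply t

theorem position_travel (x : ℝ) : position (travel x) = x := travelIso.symm_apply_apply x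

theorem strictMono_position : StrictMono position := travelIso.symm.strictMono

theorem continuous_position : Continuous position := travelIso.symm.continuous

theorem position_zero : position 0 = 0 := by
  conv_lhs => rw [← travel_zero]
  exact position_travel 0

theorem position_neg_of_neg {t : ℝ} (ht : t < 0) : position t < 0 := by
  rw [← position_zero]; exact strictMono_position ht

theorem hasDerivAt_position {t : ℝ} (ht : t < 0) :
    HasDerivAt position (rate (position t)) t := by
  have h := rate_pos_of_neg (position_neg_of_neg ht)
  have := HasDerivAt.of_local_left_inverse continuous_position.continuousAt
    (hasDerivAt_travel (position t)) (inv_ne_zero h.ne')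
    (Eventually.of_forall travel_position)
  rwa [inv_inv] at this

section ODE

variable {c β : ℝ}

/-- The time `travel (-log c) + t / (2β²)` of the solution, counted from the explosion. -/
def clock (c β t : ℝ) : ℝ := travel (-Real.log c) + t / (2 * β ^ 2)

/-- The solution of the equation. -/
def etaSolution (c β t : ℝ) : ℝ := 2 * β ^ 2 * (position (clock c β t) + Real.log c)

theorem exp_etaSolution (hc : 0 < c) (hβ : 0 < β) (t : ℝ) :
    Real.exp (etaSolution c β t / (2 * β ^ 2)) = c * Real.exp (position (clock c β t)) := by
  rw [etaSolution, mul_div_cancel_left₀ _ (by positivity), Real.exp_add, Real.exp_log hc, mul_comm]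

theorem rhs_eq_rate (hc : 0 < c) (x : ℝ) :
    2 * Real.log (1 + 2 * (c * Real.exp x) / (c - c * Real.exp x)) = rate x := by
  rcases eq_or_ne (Real.exp x) 1 with h | h
  · have : x = 0 := by simpa using h
    simp [this, rate_zero]
  · have h1 : 1 - Real.exp x ≠ 0 := sub_ne_zero.2 h.symm
    rw [rate]
    congr 2
    rw [show c - c * Real.exp x = c * (1 - Real.exp x) by ring]
    field_simp
    ring

theorem isEtaSolution_etaSolution (hc : 0 < c) (hβ : 0 < β) {s : Set ℝ}
    (hs : ∀ t ∈ s, clock c β t < 0) : IsEtaSolution c β s (etaSolution c β) where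
  initial := by simp [etaSolution, clock, position_travel]
  lt t ht := by
    rw [exp_etaSolution hc hβ]
    exact mul_lt_of_lt_one_right hc (Real.exp_lt_one_iff.2 (position_neg_of_neg (hs t ht)))
  deriv t ht := by
    rw [exp_etaSolution hc hβ, rhs_eq_rate hc]
    refine HasDerivAt.hasDerivWithinAt ?_
    have h1 : HasDerivAt (clock c β) (1 / (2 * β ^ 2)) t :=
      ((hasDerivAt_id t).div_const _).const_add _
    have h2 := (((hasDerivAt_position (hs t ht)).comp t h1).add_const
      (Real.log c)).const_mul (2 * β ^ 2)
    convert! h2 using 1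
    field_simp

theorem one_lt_of_explodes {η : ℝ → ℝ} (h : ExplodesAtOne c β η) : 1 < c := by
  have := h.solution.lt 0 ⟨le_rfl, one_pos⟩
  rwa [h.solution.initial, zero_div, Real.exp_zero] at this

theorem tendsto_of_explodes {η : ℝ → ℝ} (h : ExplodesAtOne c β η) (hβ : 0 < β) :
    Tendsto η (𝓝[<] 1) (𝓝 (2 * β ^ 2 * Real.log c)) := by
  have hc := one_lt_of_explodes h
  have h1 := (h.explodes.log (by positivity)).const_mul (2 * β ^ 2)
  simp only [Real.log_exp] at h1
  refine h1.congr fun t => ?_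
  field_simp

/-- Along every solution travel(η/(2β²) - log c) - t/(2β²) is constant; comparing its value at time
0 with its limit at the explosion gives the equation. No uniqueness theorem for the equation is
needed. -/
theorem clock_one_of_explodes {η : ℝ → ℝ} (h : ExplodesAtOne c β η) (hβ : 0 < β) :
    clock c β 1 = 0 := by
  have hc := one_lt_of_explodes h
  have hc0 : 0 < c := one_pos.trans hc
  set U : ℝ → ℝ := fun t => η t / (2 * β ^ 2) - Real.log c with hU
  have hexp : ∀ t, Real.exp (η t / (2 * β ^ 2)) = c * Real.exp (U t) := by
    intro t
    rw [hU, Real.exp_sub, Real.exp_log hc0]; field_simp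
  have hneg : ∀ t ∈ Ico (0 : ℝ) 1, U t < 0 := by
    intro t ht
    have := h.solution.lt t ht
    rw [← Real.lt_log_iff_exp_lt hc0] at this
    simp only [hU]; linarith
  have hder : ∀ t ∈ Ico (0 : ℝ) 1,
      HasDerivWithinAt (fun t => travel (U t) - t / (2 * β ^ 2)) 0 (Ico 0 1) t := by
    intro t ht
    have h1 := h.solution.deriv t ht
    rw [hexp, rhs_eq_rate hc0] at h1
    have h2 : HasDerivWithinAt U (rate (U t) / (2 * β ^ 2)) (Ico 0 1) t :=
      (h1.div_const _).sub_const _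
    have h3 := ((hasDerivAt_travel (U t)).comp_hasDerivWithinAt t h2).sub
      ((hasDerivWithinAt_id t (Ico 0 1)).div_const (2 * β ^ 2))
    convert! h3 using 1
    have := rate_pos_of_neg (hneg t ht)
    field_simp
    ring
  have hconst : ∀ t ∈ Ico (0 : ℝ) 1, travel (U t) - t / (2 * β ^ 2) = travel (-Real.log c) := by
    intro t ht
    have hsub : Icc 0 t ⊆ Ico (0 : ℝ) 1 := fun y hy => ⟨hy.1, hy.2.trans_lt ht.2⟩
    have := constant_of_has_deriv_right_zero (a := 0) (b := t)
      (f := fun t => travel (U t) - t / (2 * β ^ 2))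
      (fun y hy => ((hder y (hsub hy)).continuousWithinAt).mono hsub)
      (fun y hy => (hder y (hsub ⟨hy.1, hy.2.le⟩)).mono_of_mem_nhdsWithin
        (mem_of_superset (Ico_mem_nhdsGE (hy.2.trans ht.2)) (Ico_subset_Ico_left hy.1)))
      t ⟨ht.1, le_rfl⟩
    simpa [hU, h.solution.initial] using this
  have hlim : Tendsto (fun t => travel (U t) - t / (2 * β ^ 2)) (𝓝[<] 1)
      (𝓝 (travel 0 - 1 / (2 * β ^ 2))) := by
    have h1 := (h.explodes.log (by positivity)).sub_const (Real.log c)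
    simp only [Real.log_exp, sub_self] at h1
    refine ((continuous_travel.tendsto 0).comp h1).sub (Tendsto.div_const ?_ _)
    exact tendsto_id.mono_left nhdsWithin_le_nhds
  have hev : ∀ᶠ t in 𝓝[<] (1 : ℝ), travel (U t) - t / (2 * β ^ 2) = travel (-Real.log c) := by
    filter_upwards [Ico_mem_nhdsLT (zero_lt_one' ℝ)] with t ht using hconst t ht
  have := tendsto_nhds_unique (hlim.congr' hev) tendsto_const_nhds
  rw [travel_zero] at this
  rw [clock]; linarith

theorem clock_strictMono (hβ : 0 < β) : StrictMono (clock c β) := fun s t hst => by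
  rw [clock, clock]
  have : s / (2 * β ^ 2) < t / (2 * β ^ 2) := by gcongr
  linarith

theorem explodesAtOne_etaSolution (hc : 1 < c) (hβ : 0 < β) (h : clock c β 1 = 0) :
    ExplodesAtOne c β (etaSolution c β) where
  solution := isEtaSolution_etaSolution (one_pos.trans hc) hβ fun t ht => by
    rw [← h]; exact clock_strictMono hβ ht.2
  explodes := by
    have hcont : Continuous fun t => c * Real.exp (position (clock c β t)) := by
      have := continuous_position
      unfold clock
      fun_prop
    have h1 := hcont.tendsto 1
    simp only [h, position_zero, Real.exp_zero, mul_one] at h1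
    simp only [exp_etaSolution (one_pos.trans hc) hβ]
    exact h1.mono_left nhdsWithin_le_nhds

theorem isThreshold_iff : IsThreshold c β ↔ 0 < β ∧ 1 < c ∧ clock c β 1 = 0 :=
  ⟨fun ⟨hβ, _, h⟩ => ⟨hβ, one_lt_of_explodes h, clock_one_of_explodes h hβ⟩,
    fun ⟨hβ, hc, h⟩ => ⟨hβ, _, explodesAtOne_etaSolution hc hβ h⟩⟩

theorem clock_one_neg_of_admissible {c₀ β₀ : ℝ} (h : IsThreshold c₀ β₀)
    (hp : (c, β) ∈ admissible c₀ β₀) : clock c β 1 < 0 := by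
  obtain ⟨hβ₀, hc₀, h0⟩ := isThreshold_iff.1 h
  obtain ⟨h1, h2, h3⟩ := hp
  simp only at h1 h2 h3
  have h4 : travel (-Real.log c) ≤ travel (-Real.log c₀) :=
    strictMono_travel.monotone (neg_le_neg (Real.log_le_log (by linarith) h1))
  have h5 : 1 / (2 * β ^ 2) ≤ 1 / (2 * β₀ ^ 2) := by gcongr
  rw [clock] at h0 ⊢
  rcases h3 with h3 | h3
  · have : travel (-Real.log c) < travel (-Real.log c₀) :=
      strictMono_travel (neg_lt_neg (Real.log_lt_log (by linarith) h3))
    linarith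
  · have : 1 / (2 * β ^ 2) < 1 / (2 * β₀ ^ 2) := by gcongr
    linarith

end ODE

end RoughKernel
end

/-! ### The Euler scheme measured in travel time -/

noncomputable section

namespace RoughKernel
open MeasureTheory

section Euler

variable {x y b s : ℝ}

theorem travel_sub_le (hxy : x ≤ y) (hy : y < 0) : travel y - travel x ≤ (y - x) / rate x := by
  rw [travel_sub]
  have : ∫ z in x..y, (rate z)⁻¹ ≤ ∫ _ in x..y, (rate x)⁻¹ :=
    intervalIntegral.integral_mono_on hxy (continuous_inv_rate.intervalIntegrable _ _)
      intervalIntegrable_const fun z hz =>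
        inv_anti₀ (rate_pos_of_neg (hxy.trans_lt hy)) (rate_le hz.1 (hz.2.trans_lt hy))
  rwa [intervalIntegral.integral_const, smul_eq_mul, ← div_eq_mul_inv] at this

theorem le_travel_sub (hxy : x ≤ y) (hy : y < 0) : (y - x) / rate y ≤ travel y - travel x := by
  rw [travel_sub]
  have : ∫ _ in x..y, (rate y)⁻¹ ≤ ∫ z in x..y, (rate z)⁻¹ :=
    intervalIntegral.integral_mono_on hxy intervalIntegrable_const
      (continuous_inv_rate.intervalIntegrable _ _) fun z hz =>
        inv_anti₀ (rate_pos_of_neg (hz.2.trans_lt hy)) (rate_le hz.2 hy)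
  rwa [intervalIntegral.integral_const, smul_eq_mul, ← div_eq_mul_inv] at this

theorem sub_le_of_travel_le {B : ℝ} (hB : 0 ≤ B) (hy : y < 0) (h : travel y - travel x ≤ B) :
    y - x ≤ rate y * B := by
  have hr := rate_pos_of_neg hy
  rcases le_total x y with hxy | hxy
  · have := (le_travel_sub hxy hy).trans h
    rwa [div_le_iff₀ hr, mul_comm] at this
  · nlinarith

/-- An Euler step uses the rate at its left end, while the flow only accelerates, so the flow covers
the step in time at most s. -/
theorem travel_step_le (hx : x < 0) (hs : 0 ≤ s) (hy : x + s * rate x < 0) :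
    travel (x + s * rate x) ≤ travel x + s := by
  have hr := rate_pos_of_neg hx
  have := travel_sub_le (x := x) (y := x + s * rate x) (by nlinarith) hy
  rw [add_sub_cancel_left, mul_div_cancel_right₀ _ hr.ne'] at this
  linarith

/-- The Lipschitz constant of `rate` on `(-∞, b]`. -/
def rateSlope (b : ℝ) : ℝ := 2 * Real.sinh (rate b / 2)

theorem rateSlope_pos (hb : b < 0) : 0 < rateSlope b :=
  mul_pos two_pos (Real.sinh_pos_iff.2 (half_pos (rate_pos_of_neg hb)))

theorem rateSlope_le (hxy : x ≤ y) (hy : y < 0) : rateSlope x ≤ rateSlope y := by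
  have := Real.sinh_le_sinh.2 (div_le_div_of_nonneg_right (rate_le hxy hy) zero_le_two)
  unfold rateSlope; linarith

theorem hasDerivAt_rateSlope (hx : x < 0) :
    HasDerivAt rateSlope (Real.cosh (rate x / 2) * rateSlope x) x := by
  have := (((hasDerivAt_rate hx).div_const 2).sinh).const_mul 2
  convert! this using 1
  unfold rateSlope; ring

theorem exists_rate_sub_eq (hxy : x < y) (hy : y < 0) :
    ∃ z ∈ Ioo x y, rate y - rate x = rateSlope z * (y - x) := by
  obtain ⟨z, hz, h⟩ := exists_hasDerivAt_eq_slope rate rateSlope hxy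
    (fun z hz => (continuousAt_rate (hz.2.trans_lt hy)).continuousWithinAt)
    (fun z hz => hasDerivAt_rate (hz.2.trans hy))
  refine ⟨z, hz, ?_⟩
  rw [h, div_mul_cancel₀ _ (sub_pos.2 hxy).ne']

theorem rate_sub_le (hxy : x ≤ y) (hyb : y ≤ b) (hb : b < 0) :
    rate y - rate x ≤ rateSlope b * (y - x) := by
  rcases hxy.eq_or_lt with rfl | hlt
  · simp
  obtain ⟨z, hz, h⟩ := exists_rate_sub_eq hlt (hyb.trans_lt hb)
  rw [h]
  exact mul_le_mul_of_nonneg_right (rateSlope_le (hz.2.le.trans hyb) hb) (by linarith)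

theorem le_rate_sub (hxy : x ≤ y) (hy : y < 0) : rateSlope x * (y - x) ≤ rate y - rate x := by
  rcases hxy.eq_or_lt with rfl | hlt
  · simp
  obtain ⟨z, hz, h⟩ := exists_rate_sub_eq hlt hy
  rw [h]
  exact mul_le_mul_of_nonneg_right (rateSlope_le hz.1.le (hz.2.trans hy)) (by linarith)

/-- The slope f' of f = `rate` satisfies f'' = cosh(f/2) f', so over a length of at most 1/(2
cosh(f(b)/2)) it grows by at most half of its final value. -/
theorem rateSlope_le_two_mul (hxy : x ≤ y) (hyb : y ≤ b) (hb : b < 0)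
    (h : (y - x) * Real.cosh (rate b / 2) ≤ 1 / 2) : rateSlope y ≤ 2 * rateSlope x := by
  have hy := hyb.trans_lt hb
  rcases hxy.eq_or_lt with rfl | hlt
  · have := rateSlope_pos hy; linarith
  obtain ⟨z, hz, hz'⟩ := exists_hasDerivAt_eq_slope rateSlope _ hlt
    (fun z hz => (hasDerivAt_rateSlope (hz.2.trans_lt hy)).continuousAt.continuousWithinAt)
    (fun z hz => hasDerivAt_rateSlope (hz.2.trans hy))
  rw [eq_div_iff (sub_pos.2 hlt).ne'] at hz'
  have hz0 : z < 0 := hz.2.trans hy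
  have h1 : Real.cosh (rate z / 2) ≤ Real.cosh (rate b / 2) := by
    rw [Real.cosh_le_cosh, abs_of_pos (half_pos (rate_pos_of_neg hz0)),
      abs_of_pos (half_pos (rate_pos_of_neg hb))]
    linarith [rate_le (hz.2.le.trans hyb) hb]
  have h2 := rateSlope_le hz.2.le hy
  have h3 := rateSlope_pos hz0
  have h4 : Real.cosh (rate z / 2) * rateSlope z * (y - x) ≤
      Real.cosh (rate b / 2) * rateSlope y * (y - x) := by
    have := sub_pos.2 hlt
    gcongr
  have h5 : Real.cosh (rate b / 2) * rateSlope y * (y - x) ≤ 1 / 2 * rateSlope y := by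
    have := mul_le_mul_of_nonneg_right h (rateSlope_pos hy).le
    linarith
  linarith

/-- Over the step `rate` grows at most by the factor 1 + s K with K = `rateSlope b`, and 1/(1 + sK)
≥ 1 - sK. -/
theorem le_travel_step (hs : 0 ≤ s) (hyb : x + s * rate x ≤ b) (hb : b < 0) :
    travel x + s * (1 - s * rateSlope b) ≤ travel (x + s * rate x) := by
  have hx : x < 0 := by
    by_contra! hx
    have : 0 ≤ rate x := by
      rcases hx.eq_or_lt with rfl | h
      · exact rate_zero.ge
      · exact (rate_pos h.ne').le
    nlinarith
  have hr := rate_pos_of_neg hx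
  have hxy : x ≤ x + s * rate x := by nlinarith
  have hy0 := hyb.trans_lt hb
  have h1 := le_travel_sub hxy hy0
  have h2 := rate_sub_le hxy hyb hb
  have hry := rate_pos_of_neg hy0
  have hK := rateSlope_pos hb
  rw [add_sub_cancel_left] at h1 h2
  have h3 : s * (1 - s * rateSlope b) ≤ s * rate x / rate (x + s * rate x) := by
    rw [le_div_iff₀ hry]
    set R := rate (x + s * rate x)
    rcases le_total 0 (1 - s * rateSlope b) with h | h
    · have : (1 - s * rateSlope b) * R ≤
          (1 - s * rateSlope b) * (rate x * (1 + s * rateSlope b)) :=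
        mul_le_mul_of_nonneg_left (by linarith) h
      have h4 : (1 - s * rateSlope b) * (rate x * (1 + s * rateSlope b)) ≤ rate x := by
        nlinarith [mul_nonneg hr.le (sq_nonneg (s * rateSlope b))]
      nlinarith
    · have : s * (1 - s * rateSlope b) * R ≤ 0 :=
        mul_nonpos_of_nonpos_of_nonneg (mul_nonpos_of_nonneg_of_nonpos hs h) hry.le
      have : 0 ≤ s * rate x := by positivity
      linarith
  linarith

/-- A refined estimate for a step: the Euler scheme lags behind the flow. -/
theorem travel_step_add_log_le (hx : x < 0) (hs : 0 ≤ s) (hyb : x + s * rate x ≤ b) (hb : b < 0)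
    (h1 : s * rateSlope b ≤ 1) (h2 : s * rate b * Real.cosh (rate b / 2) ≤ 1 / 2) :
    travel (x + s * rate x) + s / 4 * Real.log (rate (x + s * rate x)) ≤
      travel x + s / 4 * Real.log (rate x) + s := by
  set f := rate x with hf
  have hfpos : 0 < f := rate_pos_of_neg hx
  have hxb : x ≤ b := le_trans (by nlinarith) hyb
  have hfb : f ≤ rate b := rate_le hxb hb
  -- The step length r varies from 0 to s, and φ decreases. With Z the rate at the moving point, the
  -- travel time contributes -(Z - f)/Z to φ', and each of the two terms from the logarithm at most
  -- (Z - f)/(2Z); this is where the constant 1/4 comes from.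
  let φ : ℝ → ℝ := fun r => travel (x + r * f) + r / 4 * (Real.log (rate (x + r * f)) -
    Real.log f) - r
  have hz : ∀ r ∈ Icc 0 s, x + r * f ≤ b := fun r hr => le_trans (by nlinarith [hr.2]) hyb
  have hder : ∀ r ∈ Icc 0 s, HasDerivAt φ ((rate (x + r * f))⁻¹ * f +
      (1 / 4 * (Real.log (rate (x + r * f)) - Real.log f) +
        r / 4 * (rateSlope (x + r * f) * f / rate (x + r * f))) - 1) r := by
    intro r hr
    have hz0 := (hz r hr).trans_lt hb
    have hlin : HasDerivAt (fun r => x + r * f) f r := by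
      simpa using ((hasDerivAt_id r).mul_const f).const_add x
    have ht := (hasDerivAt_travel (x + r * f)).comp r hlin
    have hr' : HasDerivAt (fun r => rate (x + r * f)) (rateSlope (x + r * f) * f) r :=
      HasDerivAt.comp (h₂ := rate) (h := fun r => x + r * f) r (hasDerivAt_rate hz0) hlin
    have hl := (hr'.log (rate_pos_of_neg hz0).ne').sub_const (Real.log f)
    exact (ht.add (((hasDerivAt_id r).div_const 4).mul hl)).sub (hasDerivAt_id r)
  have hanti : AntitoneOn φ (Icc 0 s) := by
    refine antitoneOn_of_deriv_nonpos (convex_Icc 0 s)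
      (fun r hr => (hder r hr).continuousAt.continuousWithinAt)
      (fun r hr => ((hder r (interior_subset hr)).differentiableAt).differentiableWithinAt)
      fun r hr => ?_
    have hr := interior_subset hr
    rw [(hder r hr).deriv]
    have hzb := hz r hr
    have hz0 := hzb.trans_lt hb
    set Z := rate (x + r * f) with hZ
    have hZpos : 0 < Z := rate_pos_of_neg hz0
    have hxz : x ≤ x + r * f := by nlinarith [hr.1]
    have e1 : rateSlope x * (r * f) ≤ Z - f := by
      have := le_rate_sub hxz hz0
      rwa [add_sub_cancel_left] at this
    have e2 : Z - f ≤ f := by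
      have h3 := rate_sub_le hxz hzb hb
      rw [add_sub_cancel_left] at h3
      have h4 : rateSlope b * (r * f) ≤ f := by
        have : r * rateSlope b ≤ 1 :=
          (mul_le_mul_of_nonneg_right hr.2 (rateSlope_pos hb).le).trans h1
        nlinarith
      exact h3.trans h4
    have e3 : rateSlope (x + r * f) ≤ 2 * rateSlope x := by
      refine rateSlope_le_two_mul hxz hzb hb ?_
      rw [add_sub_cancel_left]
      refine le_trans ?_ h2
      have := Real.cosh_pos (rate b / 2)
      have := rate_pos_of_neg hb
      have := hr.2
      gcongr
    have e4 : Real.log Z - Real.log f ≤ (Z - f) / f := by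
      rw [← Real.log_div hZpos.ne' hfpos.ne', sub_div, div_self hfpos.ne']
      exact Real.log_le_sub_one_of_pos (by positivity)
    have e0 : 0 ≤ Z - f := by
      have := rateSlope_pos hx
      exact le_trans (by have := hr.1; positivity) e1
    have e5 : Z * (Real.log Z - Real.log f) ≤ 2 * (Z - f) := by
      calc Z * (Real.log Z - Real.log f) ≤ Z * ((Z - f) / f) :=
            mul_le_mul_of_nonneg_left e4 hZpos.le
        _ = Z / f * (Z - f) := by ring
        _ ≤ 2 * (Z - f) := by
            refine mul_le_mul_of_nonneg_right ?_ e0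
            rw [div_le_iff₀ hfpos]; linarith
    have e6 : r * (rateSlope (x + r * f) * f) ≤ 2 * (Z - f) := by
      have : r * (rateSlope (x + r * f) * f) ≤ r * (2 * rateSlope x * f) := by
        have := hr.1
        gcongr
      linarith
    have e7 : Z⁻¹ * f + (1 / 4 * (Real.log Z - Real.log f) +
        r / 4 * (rateSlope (x + r * f) * f / Z)) - 1 =
        (f - Z + (1 / 4) * (Z * (Real.log Z - Real.log f)) +
          (1 / 4) * (r * (rateSlope (x + r * f) * f))) / Z := by
      field_simp
      ring
    rw [e7]
    exact div_nonpos_of_nonpos_of_nonneg (by linarith) hZpos.le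
  have := hanti ⟨le_rfl, hs⟩ ⟨hs, le_rfl⟩ hs
  simp only [φ, zero_mul, add_zero, zero_div, sub_zero] at this
  linarith

end Euler

section Scheme

variable {U : ℕ → ℝ} {s W b : ℝ} {n : ℕ}

/-- The Euler scheme stays behind the flow. -/
theorem euler_le (hs : 0 ≤ s) (hrec : ∀ k, 1 ≤ k → U k < 0 → U (k + 1) = U k + s * rate (U k))
    (hWb : W + s * rate W < 0) (hW : W < 0) (h : travel (U 1) + (n - 1) * s ≤ travel W) {k : ℕ}
    (hk : 1 ≤ k) (hkn : k ≤ n) :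
    U k ≤ W ∧ travel (U k) ≤ travel (U 1) + (k - 1) * s := by
  -- W is a barrier: the available travel time keeps the scheme behind W, and a step from behind W
  -- stays negative.
  have hW' : ∀ k : ℕ, k ≤ n → travel (U k) ≤ travel (U 1) + (k - 1) * s → U k ≤ W := by
    intro k hkn hk
    have hkn' : (k : ℝ) ≤ n := by exact_mod_cast hkn
    exact strictMono_travel.le_iff_le.1 (hk.trans (le_trans (by nlinarith) h))
  induction k, hk using Nat.le_induction with
  | base =>
    have : travel (U 1) ≤ travel (U 1) + ((1 : ℕ) - 1) * s := by simp
    exact ⟨hW' 1 hkn this, this⟩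
  | succ k hk ih =>
    obtain ⟨h1, h2⟩ := ih (by omega)
    have h0 := h1.trans_lt hW
    have h3 : U k + s * rate (U k) < 0 := by
      have := mul_le_mul_of_nonneg_left (rate_le h1 hW) hs
      linarith
    have h4 := travel_step_le h0 hs h3
    rw [← hrec k hk h0] at h4
    have h5 : travel (U (k + 1)) ≤ travel (U 1) + ((k + 1 : ℕ) - 1) * s := by
      push_cast; linarith
    exact ⟨hW' _ hkn h5, h5⟩

theorem le_euler (hs : 0 ≤ s) (hrec : ∀ k, 1 ≤ k → U k < 0 → U (k + 1) = U k + s * rate (U k))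
    (hW : W < 0) (hU : ∀ k, 1 ≤ k → k ≤ n → U k ≤ W) {k : ℕ} (hk : 1 ≤ k) (hkn : k ≤ n) :
    travel (U 1) + (k - 1) * (s * (1 - s * rateSlope W)) ≤ travel (U k) := by
  induction k, hk using Nat.le_induction with
  | base => simp
  | succ k hk ih =>
    have h1 := ih (by omega)
    have h2 := hrec k hk ((hU k hk (by omega)).trans_lt hW)
    have h3 := le_travel_step hs (x := U k) (b := W) (by rw [← h2]; exact hU _ (by omega) hkn) hW
    rw [← h2] at h3
    push_cast
    linarith

/-- The logarithmic corrections telescope: the total lag is at least (s/4) log(rate(U_k)/rate(U_1)),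
which is of order s but large when U_k is close to 0. -/
theorem euler_add_log_le (hs : 0 ≤ s)
    (hrec : ∀ k, 1 ≤ k → U k < 0 → U (k + 1) = U k + s * rate (U k))
    (hW : W < 0) (hU : ∀ k, 1 ≤ k → k ≤ n → U k ≤ W) (h1 : s * rateSlope W ≤ 1)
    (h2 : s * rate W * Real.cosh (rate W / 2) ≤ 1 / 2) {k : ℕ} (hk : 1 ≤ k) (hkn : k ≤ n) :
    travel (U k) + s / 4 * Real.log (rate (U k)) ≤
      travel (U 1) + s / 4 * Real.log (rate (U 1)) + (k - 1) * s := by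
  induction k, hk using Nat.le_induction with
  | base => simp
  | succ k hk ih =>
    have h3 := ih (by omega)
    have h0 := (hU k hk (by omega)).trans_lt hW
    have h4 := hrec k hk h0
    have h5 := travel_step_add_log_le h0 hs (by rw [← h4]; exact hU _ (by omega) hkn) hW h1 h2
    rw [← h4] at h5
    push_cast
    linarith

end Scheme

end RoughKernel
end

/-! ### Rounding, and the interval end points as an Euler scheme -/

noncomputable section

namespace RoughKernel

theorem abs_rd_sub_le {x : ℝ} (hx : 1 ≤ x) : |(rd x : ℝ) - x| ≤ 1 / 2 := by
  have h1 : (1 : ℤ) ≤ round x := by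
    rw [round_eq, Int.le_floor]; push_cast; linarith
  have h2 : (rd x : ℤ) = round x := by
    rw [rd, Nat.cast_max, Int.toNat_of_nonneg (by omega)]
    push_cast; omega
  have h3 : (rd x : ℝ) = (round x : ℝ) := by exact_mod_cast congrArg (Int.cast (R := ℝ)) h2
  rw [h3, abs_sub_comm]
  exact abs_sub_round x

theorem one_le_rd (x : ℝ) : 1 ≤ rd x := le_max_left _ _

theorem tendsto_rd : Tendsto (fun x => (rd x : ℝ)) atTop atTop := by
  refine tendsto_atTop_mono' _ ?_ (tendsto_atTop_add_const_right _ (-(1 / 2)) tendsto_id)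
  filter_upwards [eventually_ge_atTop 1] with x hx
  have := (abs_le.1 (abs_rd_sub_le hx)).1
  simp only [id]; linarith

section

variable {H c β a : ℝ}

theorem level_pos (H β : ℝ) (N : ℕ) : (0 : ℝ) < level H β N := by
  exact_mod_cast one_le_rd _

theorem xiExponent_pos (hH : -1 / 2 < H) (β : ℝ) (N : ℕ) : 0 < xiExponent H β N := by
  have := level_pos H β N
  have : 0 < 1 / 2 + H := by linarith
  unfold xiExponent; positivity

theorem two_mul_level_mul_xiExponent (H β : ℝ) (N : ℕ) :
    2 * level H β N * xiExponent H β N = 1 / 2 + H := by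
  have := level_pos H β N
  unfold xiExponent; field_simp

theorem tendsto_sqrt_mul {k : ℝ} (hk : 0 < k) : Tendsto (fun N : ℕ => √(k * N)) atTop atTop :=
  Real.tendsto_sqrt_atTop.comp (tendsto_natCast_atTop_atTop.const_mul_atTop hk)

theorem tendsto_level_arg (hH : -1 / 2 < H) (hβ : 0 < β) :
    Tendsto (fun N : ℕ => β * √((1 / 2 + H) * N)) atTop atTop :=
  (tendsto_sqrt_mul (by linarith)).const_mul_atTop hβ

theorem numIntervals_arg (hH : -1 / 2 < H) (N : ℕ) :
    1 / β * √(N / (1 / 2 + H)) = 1 / (β * (1 / 2 + H)) * √((1 / 2 + H) * N) := by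
  have h : 0 < 1 / 2 + H := by linarith
  have : (N : ℝ) / (1 / 2 + H) = ((1 / 2 + H) * N) / (1 / 2 + H) ^ 2 := by field_simp
  rw [this, Real.sqrt_div' _ (by positivity), Real.sqrt_sq h.le]
  field_simp

theorem tendsto_numIntervals_arg (hH : -1 / 2 < H) (hβ : 0 < β) :
    Tendsto (fun N : ℕ => 1 / β * √(N / (1 / 2 + H))) atTop atTop := by
  have h : 0 < 1 / 2 + H := by linarith
  simp only [numIntervals_arg hH]
  exact (tendsto_sqrt_mul h).const_mul_atTop (by positivity)

theorem tendsto_level (hH : -1 / 2 < H) (hβ : 0 < β) :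
    Tendsto (fun N => (level H β N : ℝ)) atTop atTop :=
  tendsto_rd.comp (tendsto_level_arg hH hβ)

theorem tendsto_numIntervals (hH : -1 / 2 < H) (hβ : 0 < β) :
    Tendsto (fun N => (numIntervals H β N : ℝ)) atTop atTop :=
  tendsto_rd.comp (tendsto_numIntervals_arg hH hβ)

theorem tendsto_xiExponent (hH : -1 / 2 < H) (hβ : 0 < β) :
    Tendsto (xiExponent H β) atTop (𝓝 0) :=
  ((tendsto_level hH hβ).const_mul_atTop two_pos).const_div_atTop _

theorem eventually_abs_level_sub_le (hH : -1 / 2 < H) (hβ : 0 < β) :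
    ∀ᶠ N : ℕ in atTop, |(level H β N : ℝ) - β * √((1 / 2 + H) * N)| ≤ 1 / 2 := by
  filter_upwards [(tendsto_level_arg hH hβ).eventually_ge_atTop 1] with N hN
  exact abs_rd_sub_le hN

/-- The bound for the rounding effects. -/
def roundingBound (H β : ℝ) : ℝ := (1 / (2 * β ^ 2) + (1 / 2 + H) / 2) / (1 / 2 + H)

theorem roundingBound_pos (hH : -1 / 2 < H) (hβ : 0 < β) : 0 < roundingBound H β := by
  have : 0 < 1 / 2 + H := by linarith
  unfold roundingBound; positivity

/-- Because 2ms = 1/2 + H, the product n s would equal 1/(2β²) without rounding. The identity `key`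
expresses the deviation through the rounding errors of m and n, which are at most 1/2. -/
theorem eventually_abs_numIntervals_mul_sub_le (hH : -1 / 2 < H) (hβ : 0 < β) :
    ∀ᶠ N : ℕ in atTop, |numIntervals H β N * xiExponent H β N - 1 / (2 * β ^ 2)| ≤
      roundingBound H β * xiExponent H β N := by
  have hα : 0 < 1 / 2 + H := by linarith
  filter_upwards [eventually_abs_level_sub_le hH hβ,
    (tendsto_numIntervals_arg hH hβ).eventually_ge_atTop 1] with N h1 h2
  have h3 : |(numIntervals H β N : ℝ) - 1 / β * √(N / (1 / 2 + H))| ≤ 1 / 2 := abs_rd_sub_le h2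
  rw [numIntervals_arg hH] at h3
  have hs := xiExponent_pos hH β N
  have hms := two_mul_level_mul_xiExponent H β N
  set s := xiExponent H β N
  set m := (level H β N : ℝ)
  set n := (numIntervals H β N : ℝ)
  set R := √((1 / 2 + H) * N)
  have key : ∀ α : ℝ, 0 < α → 2 * m * s = α → n * s - 1 / (2 * β ^ 2) =
      (α * (n - 1 / (β * α) * R) - 1 / β ^ 2 * (m - β * R)) / α * s := by
    intro α hα h
    have h5 : 1 / (2 * β ^ 2) = 1 / β ^ 2 * m * s / α := by
      have : m ≠ 0 := (level_pos H β N).ne'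
      rw [← h]
      field_simp
    rw [h5]
    field_simp
    ring
  have h4 := key _ hα hms
  rw [h4, abs_mul, abs_of_pos hs, abs_div, abs_of_pos hα]
  refine mul_le_mul_of_nonneg_right (div_le_div_of_nonneg_right ?_ hα.le) hs.le
  refine (abs_sub _ _).trans ?_
  rw [abs_mul, abs_mul, abs_of_pos hα, abs_of_pos (by positivity : 0 < 1 / β ^ 2)]
  have h5 := mul_le_mul_of_nonneg_left h3 hα.le
  have h6 := mul_le_mul_of_nonneg_left h1 (by positivity : 0 ≤ 1 / β ^ 2)
  have h7 : 1 / (2 * β ^ 2) = 1 / β ^ 2 * (1 / 2) := by field_simp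
  rw [h7]
  linarith

/-- The Euler scheme for the flow of `rate`. -/
def eulerSeq (u s : ℝ) : ℕ → ℝ
  | 0 => u
  | k + 1 => eulerSeq u s k + s * rate (eulerSeq u s k)

/-- The points `s log ξ_k - log c`, for `k ≥ 1`. -/
def gridPoint (H c β a : ℝ) (N k : ℕ) : ℝ :=
  eulerSeq (xiExponent H β N * Real.log a - Real.log c) (xiExponent H β N) (k - 1)

theorem gridPoint_one (H c β a : ℝ) (N : ℕ) :
    gridPoint H c β a N 1 = xiExponent H β N * Real.log a - Real.log c := rfl

theorem gridPoint_succ (H c β a : ℝ) (N : ℕ) {k : ℕ} (hk : 1 ≤ k) :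
    gridPoint H c β a N (k + 1) =
      gridPoint H c β a N k + xiExponent H β N * rate (gridPoint H c β a N k) := by
  obtain ⟨j, rfl⟩ := Nat.exists_eq_add_of_le' hk
  rfl

theorem xi_zero (H c β a : ℝ) (N : ℕ) : xi H c β a N 0 = 0 := by rw [xi, xiAux]

theorem xi_succ (H c β a : ℝ) (N : ℕ) {k : ℕ} (hk : 1 ≤ k) : xi H c β a N (k + 1) =
    ((c + xi H c β a N k ^ xiExponent H β N) / (c - xi H c β a N k ^ xiExponent H β N)) ^ 2 *
      xi H c β a N k := by
  obtain ⟨j, rfl⟩ := Nat.exists_eq_add_of_le' hk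
  simp only [xi]
  rw [xiAux]

theorem exp_rpow_xiExponent (hH : -1 / 2 < H) (hc : 0 < c) (N : ℕ) (u : ℝ) :
    Real.exp ((u + Real.log c) / xiExponent H β N) ^ xiExponent H β N = c * Real.exp u := by
  rw [← Real.exp_mul, div_mul_cancel₀ _ (xiExponent_pos hH β N).ne', Real.exp_add,
    Real.exp_log hc, mul_comm]

/-- If ξ_k^s = c e^u, the factor in the recursion is e^(rate u); taking logarithms and multiplying
by s gives an Euler step for u. -/
theorem xi_eq_exp (hH : -1 / 2 < H) (hc : 0 < c) (ha : 0 < a) {N k : ℕ} (hk : 1 ≤ k)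
    (hneg : ∀ j, 1 ≤ j → j < k → gridPoint H c β a N j < 0) :
    xi H c β a N k = Real.exp ((gridPoint H c β a N k + Real.log c) / xiExponent H β N) := by
  have hs := xiExponent_pos hH β N
  induction k, hk using Nat.le_induction with
  | base =>
    rw [xi, xiAux, gridPoint_one, sub_add_cancel, mul_div_cancel_left₀ _ hs.ne', Real.exp_log ha]
  | succ k hk ih =>
    have h0 := hneg k hk (Nat.lt_succ_self k)
    have h1 := exp_lt_one_of_neg h0
    rw [xi_succ _ _ _ _ _ hk, ih fun j h1 h2 => hneg j h1 (by omega), exp_rpow_xiExponent hH hc,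
      gridPoint_succ _ _ _ _ _ hk]
    set u := gridPoint H c β a N k
    have h2 : (c + c * Real.exp u) / (c - c * Real.exp u) =
        (1 + Real.exp u) / (1 - Real.exp u) := by
      rw [show c - c * Real.exp u = c * (1 - Real.exp u) by ring,
        show c + c * Real.exp u = c * (1 + Real.exp u) by ring, mul_div_mul_left _ _ hc.ne']
    rw [h2, ← exp_rate h0, ← Real.exp_add]
    congr 1
    field_simp
    ring

/-- The final point `log (e^(η_1 / (2β²)) / c)` of the flow. -/
def endPoint (c β : ℝ) : ℝ := position (clock c β 1)

theorem endPoint_neg (h : clock c β 1 < 0) : endPoint c β < 0 := position_neg_of_neg h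

theorem travel_endPoint (c β : ℝ) :
    travel (endPoint c β) = travel (-Real.log c) + 1 / (2 * β ^ 2) := travel_position _

/-- The Lipschitz bound for the influence of `ξ_1 = a`. -/
def startBound (c a : ℝ) : ℝ := |Real.log a| / rate (-Real.log c - 1)

theorem tendsto_gridPoint_one (hH : -1 / 2 < H) (hβ : 0 < β) (c a : ℝ) :
    Tendsto (fun N => gridPoint H c β a N 1) atTop (𝓝 (-Real.log c)) := by
  have := ((tendsto_xiExponent hH hβ).mul_const (Real.log a)).sub_const (Real.log c)
  simp only [zero_mul, zero_sub] at this
  exact this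

/-- The start is shifted by s log a, and `travel` has Lipschitz constant 1/rate(-log c - 1) on [-log
c - 1, 0). -/
theorem eventually_abs_travel_start_le (hH : -1 / 2 < H) (hβ : 0 < β) (hc : 1 < c) (a : ℝ) :
    ∀ᶠ N in atTop, |travel (gridPoint H c β a N 1) - travel (-Real.log c)| ≤
      startBound c a * xiExponent H β N := by
  have hlc := Real.log_pos hc
  have h := tendsto_gridPoint_one hH hβ c a
  filter_upwards [h.eventually_const_lt (show -Real.log c - 1 < -Real.log c by linarith),
    h.eventually_lt_const (show -Real.log c < 0 by linarith)] with N h1 h2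
  have hs := xiExponent_pos hH β N
  set x := gridPoint H c β a N 1 with hx
  have hr := rate_pos_of_neg (show -Real.log c - 1 < 0 by linarith)
  have habs : |x - -Real.log c| = |Real.log a| * xiExponent H β N := by
    rw [hx, gridPoint_one, sub_neg_eq_add, sub_add_cancel, abs_mul, abs_of_pos hs, mul_comm]
  have key : ∀ u v, -Real.log c - 1 ≤ u → u ≤ v → v < 0 →
      |travel v - travel u| ≤ |v - u| / rate (-Real.log c - 1) := by
    intro u v h1 h2 h3
    rw [abs_of_nonneg (sub_nonneg.2 (strictMono_travel.monotone h2)),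
      abs_of_nonneg (sub_nonneg.2 h2)]
    refine (travel_sub_le h2 h3).trans ?_
    exact div_le_div_of_nonneg_left (sub_nonneg.2 h2) hr (rate_le h1 (by linarith))
  rw [startBound, div_mul_eq_mul_div, ← habs]
  rcases le_total x (-Real.log c) with hle | hle
  · rw [abs_sub_comm, abs_sub_comm x]
    exact key _ _ h1.le hle (by linarith)
  · exact key _ _ (by linarith) hle h2

theorem startBound_nonneg (hc : 1 < c) (a : ℝ) : 0 ≤ startBound c a :=
  div_nonneg (abs_nonneg _) (rate_pos_of_neg (by linarith [Real.log_pos hc])).le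

/-- Compares the end of the flow with a scheme whose steps would take exactly the time s. The extra
1 in the lower bound accounts for there being only n - 1 steps. -/
theorem eventually_travel_start_le (hH : -1 / 2 < H) (hβ : 0 < β) (hc : 1 < c) (a : ℝ) :
    ∀ᶠ N in atTop,
      travel (gridPoint H c β a N 1) + (numIntervals H β N - 1) * xiExponent H β N ≤
        travel (endPoint c β) + (roundingBound H β + startBound c a) * xiExponent H β N ∧
      travel (endPoint c β) - (roundingBound H β + startBound c a + 1) * xiExponent H β N ≤
        travel (gridPoint H c β a N 1) + (numIntervals H β N - 1) * xiExponent H β N := by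
  filter_upwards [eventually_abs_travel_start_le hH hβ hc a,
    eventually_abs_numIntervals_mul_sub_le hH hβ] with N h1 h2
  have hs := xiExponent_pos hH β N
  rw [travel_endPoint]
  rw [abs_le] at h1 h2
  constructor <;> nlinarith [h1.1, h1.2, h2.1, h2.2]

/-- Half the end point serves as the barrier in `euler_le`: the flow ends strictly before it, with a
margin that absorbs the O(s) errors. -/
theorem eventually_gridPoint_le (hH : -1 / 2 < H) (hβ : 0 < β) (hc : 1 < c)
    (h : clock c β 1 < 0) (a : ℝ) :
    ∀ᶠ N in atTop, ∀ k, 1 ≤ k → k ≤ numIntervals H β N →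
      gridPoint H c β a N k ≤ endPoint c β / 2 ∧
      travel (gridPoint H c β a N k) ≤
        travel (gridPoint H c β a N 1) + (k - 1) * xiExponent H β N := by
  have hV := endPoint_neg h
  have hs0 := tendsto_xiExponent hH hβ
  have h1 : Tendsto (fun N => travel (endPoint c β) +
      (roundingBound H β + startBound c a) * xiExponent H β N) atTop
      (𝓝 (travel (endPoint c β))) := by
    simpa using (hs0.const_mul (roundingBound H β + startBound c a)).const_add
      (travel (endPoint c β))
  have h2 : Tendsto (fun N => endPoint c β / 2 + xiExponent H β N * rate (endPoint c β / 2))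
      atTop (𝓝 (endPoint c β / 2)) := by
    simpa using (hs0.mul_const (rate (endPoint c β / 2))).const_add (endPoint c β / 2)
  filter_upwards [eventually_travel_start_le hH hβ hc a,
    h1.eventually_lt_const (strictMono_travel (show endPoint c β < endPoint c β / 2 by linarith)),
    h2.eventually_lt_const (show endPoint c β / 2 < 0 by linarith)] with N h3 h4 h5 k hk hkn
  exact euler_le (xiExponent_pos hH β N).le (fun k hk _ => gridPoint_succ H c β a N hk) h5
    (by linarith) (h3.1.trans h4.le) hk hkn

/-- Start and rounding cost a time O(s), and each of the n - 1 steps loses at most s² K with n s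
bounded. Times become distances since speeds behind the barrier are bounded. The order s is what
keeps 2m (u_n - V) bounded. -/
theorem exists_abs_gridPoint_sub_le (hH : -1 / 2 < H) (hβ : 0 < β) (hc : 1 < c)
    (h : clock c β 1 < 0) (a : ℝ) :
    ∃ A, ∀ᶠ N in atTop, |gridPoint H c β a N (numIntervals H β N) - endPoint c β| ≤
      A * xiExponent H β N := by
  have hV := endPoint_neg h
  have hV2 : endPoint c β / 2 < 0 := by linarith
  set B := roundingBound H β + startBound c a + 1 with hB
  have hB0 : 0 < B := by
    have := roundingBound_pos hH hβ
    have := startBound_nonneg hc a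
    positivity
  set K := rateSlope (endPoint c β / 2)
  have hK : 0 < K := rateSlope_pos hV2
  have hr := rate_pos_of_neg hV2
  set τ := 1 / (2 * β ^ 2)
  have hτ : 0 < τ := by positivity
  refine ⟨rate (endPoint c β / 2) * (B + K * (τ + roundingBound H β)), ?_⟩
  filter_upwards [eventually_travel_start_le hH hβ hc a, eventually_gridPoint_le hH hβ hc h a,
    eventually_abs_numIntervals_mul_sub_le hH hβ,
    (tendsto_xiExponent hH hβ).eventually_le_const one_pos] with N h1 h2 h3 h4
  have hn : 1 ≤ numIntervals H β N := one_le_rd _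
  have hs := xiExponent_pos hH β N
  obtain ⟨h5, h6⟩ := h2 _ hn le_rfl
  have h7 := le_euler hs.le (U := gridPoint H c β a N)
    (fun k hk _ => gridPoint_succ H c β a N hk) hV2 (fun k hk hkn => (h2 k hk hkn).1) hn le_rfl
  set u := gridPoint H c β a N (numIntervals H β N)
  set s := xiExponent H β N
  set n := (numIntervals H β N : ℝ)
  have hn1 : (1 : ℝ) ≤ n := Nat.one_le_cast.2 hn
  have hE : 0 ≤ K * (τ + roundingBound H β) := by
    have := roundingBound_pos hH hβ
    positivity
  rw [abs_le] at h3
  have hRB := roundingBound_pos hH hβ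
  have h8 : (n - 1) * s ≤ τ + roundingBound H β := by nlinarith [h3.2]
  have up : travel u - travel (endPoint c β) ≤ (B + K * (τ + roundingBound H β)) * s := by
    nlinarith [h1.1]
  have low : travel (endPoint c β) - travel u ≤ (B + K * (τ + roundingBound H β)) * s := by
    have : (n - 1) * s * (s * K) ≤ (τ + roundingBound H β) * (s * K) :=
      mul_le_mul_of_nonneg_right h8 (by positivity)
    nlinarith [h1.2]
  have hP : 0 ≤ (B + K * (τ + roundingBound H β)) * s := by positivity
  rw [abs_le]
  constructor
  · have h9 := sub_le_of_travel_le hP hV low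
    have h10 := mul_le_mul_of_nonneg_right
      (rate_le (show endPoint c β ≤ endPoint c β / 2 by linarith) hV2) hP
    linarith
  · have h9 := sub_le_of_travel_le hP (h5.trans_lt hV2) up
    have h10 := mul_le_mul_of_nonneg_right (rate_le h5 hV2) hP
    linarith

theorem tendsto_gridPoint (hH : -1 / 2 < H) (hβ : 0 < β) (hc : 1 < c) (h : clock c β 1 < 0)
    (a : ℝ) : Tendsto (fun N => gridPoint H c β a N (numIntervals H β N)) atTop
      (𝓝 (endPoint c β)) := by
  obtain ⟨A, hA⟩ := exists_abs_gridPoint_sub_le hH hβ hc h a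
  rw [tendsto_iff_dist_tendsto_zero]
  refine squeeze_zero' (Eventually.of_forall fun _ => dist_nonneg) (hA.mono fun N hN => ?_)
    (show Tendsto (fun N => A * xiExponent H β N) atTop (𝓝 0) by
      simpa using (tendsto_xiExponent hH hβ).const_mul A)
  exact hN

/-- The lag of the Euler scheme, up to the factor `s`. -/
def lag (H c β a : ℝ) : ℝ :=
  1 / 4 * (Real.log (rate (endPoint c β) / 2) - Real.log (rate (-Real.log c / 2))) -
    (roundingBound H β + startBound c a)

/-- The scheme is late by a time of at least s·`lag`; the speed between u_n and V is at least
rate(V)/2 for large N, and 2ms = 1/2 + H cancels s. -/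
theorem eventually_lag_le (hH : -1 / 2 < H) (hβ : 0 < β) (hc : 1 < c) (h : clock c β 1 < 0)
    (a : ℝ) (hlag : 0 ≤ lag H c β a) :
    ∀ᶠ N in atTop, (1 / 2 + H) * (rate (endPoint c β) / 2 * lag H c β a) ≤
      2 * level H β N * (endPoint c β - gridPoint H c β a N (numIntervals H β N)) := by
  have hV := endPoint_neg h
  have hV2 : endPoint c β / 2 < 0 := by linarith
  have hrV := rate_pos_of_neg hV
  have hlc := Real.log_pos hc
  have hs0 := tendsto_xiExponent hH hβ
  have t1 : Tendsto (fun N => xiExponent H β N * rateSlope (endPoint c β / 2)) atTop (𝓝 0) := by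
    simpa using hs0.mul_const (rateSlope (endPoint c β / 2))
  have t2 : Tendsto (fun N => xiExponent H β N * rate (endPoint c β / 2) *
      Real.cosh (rate (endPoint c β / 2) / 2)) atTop (𝓝 0) := by
    simpa using (hs0.mul_const (rate (endPoint c β / 2))).mul_const
      (Real.cosh (rate (endPoint c β / 2) / 2))
  have t3 : Tendsto (fun N => rate (gridPoint H c β a N (numIntervals H β N))) atTop
      (𝓝 (rate (endPoint c β))) :=
    (continuousAt_rate hV).tendsto.comp (tendsto_gridPoint hH hβ hc h a)
  filter_upwards [eventually_travel_start_le hH hβ hc a, eventually_gridPoint_le hH hβ hc h a,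
    t1.eventually_le_const one_pos, t2.eventually_le_const (show (0 : ℝ) < 1 / 2 by norm_num),
    t3.eventually_const_le (show rate (endPoint c β) / 2 < rate (endPoint c β) by linarith),
    (tendsto_gridPoint_one hH hβ c a).eventually_le_const
      (show -Real.log c < -Real.log c / 2 by linarith)] with N h1 h2 h3 h4 h5 h6
  have hn : 1 ≤ numIntervals H β N := one_le_rd _
  have hs := xiExponent_pos hH β N
  have h7 := euler_add_log_le hs.le (U := gridPoint H c β a N)
    (fun k hk _ => gridPoint_succ H c β a N hk) hV2 (fun k hk hkn => (h2 k hk hkn).1) h3 h4 hn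
    le_rfl
  have hu0 := (h2 _ hn le_rfl).1.trans_lt hV2
  have h8 : Real.log (rate (gridPoint H c β a N 1)) ≤ Real.log (rate (-Real.log c / 2)) :=
    Real.log_le_log (rate_pos_of_neg ((h2 1 le_rfl hn).1.trans_lt hV2))
      (rate_le h6 (by linarith))
  have h9 := Real.log_le_log (half_pos hrV) h5
  have hms := two_mul_level_mul_xiExponent H β N
  set u := gridPoint H c β a N (numIntervals H β N)
  set s := xiExponent H β N
  have h10 : s * lag H c β a ≤ travel (endPoint c β) - travel u := by
    have e1 := mul_le_mul_of_nonneg_left h8 (show 0 ≤ s / 4 by positivity)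
    have e2 := mul_le_mul_of_nonneg_left h9 (show 0 ≤ s / 4 by positivity)
    unfold lag
    linarith [h1.1]
  have h11 : u ≤ endPoint c β :=
    strictMono_travel.le_iff_le.1 (by linarith [mul_nonneg hs.le hlag])
  have h12 := h10.trans (travel_sub_le h11 hV)
  rw [le_div_iff₀ (rate_pos_of_neg hu0)] at h12
  have h13 : s * lag H c β a * (rate (endPoint c β) / 2) ≤ endPoint c β - u :=
    (mul_le_mul_of_nonneg_left h5 (mul_nonneg hs.le hlag)).trans h12
  have h14 := mul_le_mul_of_nonneg_left h13
    (show 0 ≤ 2 * (level H β N : ℝ) by positivity)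
  calc (1 / 2 + H) * (rate (endPoint c β) / 2 * lag H c β a)
      = 2 * level H β N * (s * lag H c β a * (rate (endPoint c β) / 2)) := by
        rw [← hms]; ring
    _ ≤ _ := h14

end

end RoughKernel
end

/-! ### Error bounds for a fixed N -/

noncomputable section

namespace RoughKernel
open MeasureTheory

section

variable {H c β a T : ℝ} {N : ℕ}

theorem cH_pos (hH : -1 / 2 < H) (hH' : H < 1 / 2) : 0 < cH H := by
  have h2 := Real.Gamma_pos_of_pos (show 0 < H + 1 / 2 by linarith)
  have h3 := Real.Gamma_pos_of_pos (show 0 < 1 / 2 - H by linarith)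
  unfold cH; positivity

/-- All grid points are negative, i.e. `ξ_k ^ s < c`. -/
def GridNeg (H c β a : ℝ) (N : ℕ) : Prop :=
  ∀ k, 1 ≤ k → k ≤ numIntervals H β N → gridPoint H c β a N k < 0

theorem GridNeg.xi_eq (hg : GridNeg H c β a N) (hH : -1 / 2 < H) (hc : 0 < c) (ha : 0 < a) {k : ℕ}
    (hk : 1 ≤ k) (hkn : k ≤ numIntervals H β N) :
    xi H c β a N k = Real.exp ((gridPoint H c β a N k + Real.log c) / xiExponent H β N) :=
  xi_eq_exp hH hc ha hk fun j h1 h2 => hg j h1 (by omega)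

theorem GridNeg.xi_pos (hg : GridNeg H c β a N) (hH : -1 / 2 < H) (hc : 0 < c) (ha : 0 < a) {k : ℕ}
    (hk : 1 ≤ k) (hkn : k ≤ numIntervals H β N) : 0 < xi H c β a N k := by
  rw [hg.xi_eq hH hc ha hk hkn]; exact Real.exp_pos _

theorem GridNeg.xi_succ_eq (hg : GridNeg H c β a N) (hH : -1 / 2 < H) (hc : 0 < c) (ha : 0 < a)
    {k : ℕ} (hk : 1 ≤ k) (hkn : k < numIntervals H β N) :
    xi H c β a N (k + 1) = Real.exp (rate (gridPoint H c β a N k)) * xi H c β a N k := by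
  have hs := xiExponent_pos hH β N
  rw [hg.xi_eq hH hc ha (by omega) hkn, hg.xi_eq hH hc ha hk hkn.le, ← Real.exp_add,
    gridPoint_succ _ _ _ _ _ hk]
  congr 1
  field_simp
  ring

theorem GridNeg.xi_lt_succ (hg : GridNeg H c β a N) (hH : -1 / 2 < H) (hc : 0 < c) (ha : 0 < a)
    {k : ℕ} (hk : 1 ≤ k) (hkn : k < numIntervals H β N) :
    xi H c β a N k < xi H c β a N (k + 1) := by
  rw [hg.xi_succ_eq hH hc ha hk hkn]
  exact lt_mul_of_one_lt_left (hg.xi_pos hH hc ha hk hkn.le)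
    (Real.one_lt_exp_iff.2 (rate_pos_of_neg (hg k hk hkn.le)))

theorem GridNeg.xi_rpow (hg : GridNeg H c β a N) (hH : -1 / 2 < H) (hc : 0 < c) (ha : 0 < a)
    {k : ℕ} (hk : 1 ≤ k) (hkn : k ≤ numIntervals H β N) :
    xi H c β a N k ^ (-(H + 1 / 2)) =
      Real.exp (-(2 * level H β N * (gridPoint H c β a N k + Real.log c))) := by
  have hs := xiExponent_pos hH β N
  rw [hg.xi_eq hH hc ha hk hkn, ← Real.exp_mul]
  congr 1
  rw [add_comm H, ← two_mul_level_mul_xiExponent H β N]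
  field_simp

/-- The reason for the form of the recursion: the parameter θ of the Chebyshev bounds on the
interval k is exactly -u_k. -/
theorem GridNeg.cosh_eq (hg : GridNeg H c β a N) (hH : -1 / 2 < H) (hc : 0 < c) (ha : 0 < a)
    {k : ℕ} (hk : 1 ≤ k) (hkn : k < numIntervals H β N) :
    xi H c β a N (k + 1) + xi H c β a N k =
      (xi H c β a N (k + 1) - xi H c β a N k) * Real.cosh (-gridPoint H c β a N k) := by
  have h0 := hg k hk hkn.le
  rw [hg.xi_succ_eq hH hc ha hk hkn, exp_rate h0, Real.cosh_neg, Real.cosh_eq, Real.exp_neg]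
  have h1 := exp_lt_one_of_neg h0
  have h2 := Real.exp_pos (gridPoint H c β a N k)
  field_simp
  ring

theorem GridNeg.leadingTerm_eq (hg : GridNeg H c β a N) (hH : -1 / 2 < H) (hc : 0 < c)
    (ha : 0 < a) : leadingTerm H c β a N = cH H / (H + 1 / 2) *
      Real.exp (-(2 * level H β N *
        (gridPoint H c β a N (numIntervals H β N) + Real.log c))) := by
  rw [leadingTerm, show -1 / 2 - H = -(H + 1 / 2) by ring,
    hg.xi_rpow hH hc ha (k := numIntervals H β N) (one_le_rd _) le_rfl]

theorem GridNeg.exists_rule (hg : GridNeg H c β a N) (hH : -1 / 2 < H) (hH' : H < 1 / 2)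
    (hc : 0 < c) (ha : 0 < a) : ∃ x w, IsNonGeometricRule H c β a N x w := by
  have hκ := cH_pos hH hH'
  have h1 : ∃ x₀ w₀, IsGaussQuadrature (fun y => cH H * y ^ (-H - 1 / 2))
      (xi H c β a N 0) (xi H c β a N 1) (level H β N) x₀ w₀ := by
    rw [xi_zero, show xi H c β a N 1 = a by rw [xi, xiAux]]
    refine exists_gaussQuadrature ha
      ((intervalIntegral.intervalIntegrable_rpow' (by linarith)).const_mul _) (fun y hy => ?_) _
    exact mul_pos hκ (Real.rpow_pos_of_pos hy.1 _)
  have h2 : ∀ i : Fin (numIntervals H β N), 1 ≤ (i : ℕ) → ∃ x₁ v₁,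
      IsGaussQuadrature (fun _ => 1) (xi H c β a N i) (xi H c β a N (i + 1))
        (level H β N) x₁ v₁ := fun i hi =>
    exists_gaussQuadrature (hg.xi_lt_succ hH hc ha hi i.2) intervalIntegrable_const
      (fun _ _ => one_pos) _
  obtain ⟨x₀, w₀, h1⟩ := h1
  choose! x₁ v₁ h2 using h2
  refine ⟨fun i => if (i : ℕ) = 0 then x₀ else x₁ i, fun i => if (i : ℕ) = 0 then w₀ else
    fun j => cH H * v₁ i j * x₁ i j ^ (-H - 1 / 2), ?_, ?_, ?_⟩
  · intro i hi hin
    rw [hg.xi_eq hH hc ha hi hin.le, exp_rpow_xiExponent hH hc]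
    exact mul_lt_of_lt_one_right hc (Real.exp_lt_one_iff.2 (hg i hi hin.le))
  · intro i hi
    simpa [hi] using h1
  · intro i hi
    have hi0 : (i : ℕ) ≠ 0 := by omega
    refine ⟨v₁ i, ?_, fun j => ?_⟩
    · simpa [hi0] using h2 i hi
    · simp [hi0]

variable {x w : Fin (numIntervals H β N) → Fin (level H β N) → ℝ}

theorem GridNeg.isCompositeRule (hg : GridNeg H c β a N) (hH : -1 / 2 < H) (hc : 0 < c)
    (ha : 0 < a) (hR : IsNonGeometricRule H c β a N x w) :
    IsCompositeRule (cH H) (H + 1 / 2) (xi H c β a N) x w where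
  zero := xi_zero _ _ _ _ _
  pos := hg.xi_pos hH hc ha le_rfl (one_le_rd _)
  lt i hi hin := hg.xi_lt_succ hH hc ha hi hin
  first i hi := by
    have := hR.first i hi
    rwa [xi_zero, show -H - 1 / 2 = -(H + 1 / 2) by ring] at this
  rest i hi := by
    obtain ⟨v, hv, hw⟩ := hR.rest i hi
    refine ⟨v, hv, fun j => ?_⟩
    rw [hw, show -H - 1 / 2 = -(H + 1 / 2) by ring]

/-- The power of ξ_k gives e^(-2m(u + log c)) and the Chebyshev factor at most 2 e^(2mu). The point
u cancels, so all intervals share the size c^(-2m). -/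
theorem GridNeg.integral_pieceError_le (hg : GridNeg H c β a N) (hH : -1 / 2 < H)
    (hH' : H < 1 / 2) (hc : 0 < c) (ha : 0 < a) (hT : 0 < T)
    (hR : IsNonGeometricRule H c β a N x w) {b : ℝ} (hb : b < 0)
    (hgb : ∀ k, 1 ≤ k → k ≤ numIntervals H β N → gridPoint H c β a N k ≤ b)
    (i : Fin (numIntervals H β N)) (hi : 1 ≤ (i : ℕ)) :
    ∫ t in (0 : ℝ)..T, pieceError (cH H) (H + 1 / 2) (xi H c β a N) x w i t ≤
      cH H * (4 * Real.exp (rate b) * (2 * level H β N + 1) *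
        Real.exp (-(2 * level H β N * Real.log c))) := by
  have hκ := cH_pos hH hH'
  have hm : 0 < level H β N := one_le_rd _
  refine ((hg.isCompositeRule hH hc ha hR).integral_pieceError_le hκ (by linarith) (by linarith) hT
    hm i hi (hg.cosh_eq hH hc ha hi i.2)).trans (mul_le_mul_of_nonneg_left ?_ hκ.le)
  have h0 := hg i hi i.2.le
  have hξ := hg.xi_pos hH hc ha hi i.2.le
  rw [hg.xi_rpow hH hc ha hi i.2.le, hg.xi_succ_eq hH hc ha hi i.2]
  set u := gridPoint H c β a N i
  set m := (level H β N : ℝ)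
  have hm0 : 0 < m := level_pos H β N
  have h1 : 2 * (Real.exp (rate u) * xi H c β a N i - xi H c β a N i) / xi H c β a N i ≤
      2 * Real.exp (rate b) := by
    rw [div_le_iff₀ hξ]
    have : Real.exp (rate u) ≤ Real.exp (rate b) :=
      Real.exp_le_exp.2 (rate_le (hgb i hi i.2.le) hb)
    nlinarith
  have h2 : Real.exp (-(2 * m * u)) / 2 ≤ Real.cosh (2 * m * -u) := by
    rw [Real.cosh_eq, show 2 * m * -u = -(2 * m * u) by ring]
    have := Real.exp_pos (-(-(2 * m * u)))
    linarith
  have h3 : 2 * (Real.exp (rate u) * xi H c β a N i - xi H c β a N i) / xi H c β a N i /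
      Real.cosh (2 * m * -u) ≤ 2 * Real.exp (rate b) / (Real.exp (-(2 * m * u)) / 2) :=
    div_le_div₀ (by positivity) h1 (by positivity) h2
  calc (2 * m + 1) * Real.exp (-(2 * m * (u + Real.log c))) * _
      ≤ (2 * m + 1) * Real.exp (-(2 * m * (u + Real.log c))) *
        (2 * Real.exp (rate b) / (Real.exp (-(2 * m * u)) / 2)) :=
        mul_le_mul_of_nonneg_left h3 (by positivity)
    _ = _ := by
        rw [show -(2 * m * (u + Real.log c)) = -(2 * m * u) + -(2 * m * Real.log c) by ring,
          Real.exp_add]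
        field_simp
        ring

/-- The upper bound for the error at a fixed `N`. -/
theorem GridNeg.kernelError_le (hg : GridNeg H c β a N) (hH : -1 / 2 < H)
    (hH' : H < 1 / 2) (hc : 0 < c) (ha : 0 < a) (hT : 0 < T)
    (hR : IsNonGeometricRule H c β a N x w) {b : ℝ} (hb : b < 0)
    (hgb : ∀ k, 1 ≤ k → k ≤ numIntervals H β N → gridPoint H c β a N k ≤ b) :
    kernelError H T x w ≤
      T * ((a * T) ^ (2 * level H β N) / (2 * level H β N).factorial *
        ∫ y in 0..a, cH H * y ^ (-(H + 1 / 2))) +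
      numIntervals H β N * (cH H * (4 * Real.exp (rate b) * (2 * level H β N + 1) *
        Real.exp (-(2 * level H β N * Real.log c)))) + leadingTerm H c β a N := by
  have hκ := cH_pos hH hH'
  have hC := hg.isCompositeRule hH hc ha hR
  have hn : 0 < numIntervals H β N := one_le_rd _
  have hα : 0 < H + 1 / 2 := by linarith
  have hα1 : H + 1 / 2 < 1 := by linarith
  have hI : 0 ≤ ∫ y in 0..a, cH H * y ^ (-(H + 1 / 2)) :=
    intervalIntegral.integral_nonneg ha.le fun y hy =>
      mul_nonneg hκ.le (Real.rpow_nonneg hy.1 _)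
  rw [hC.kernelError_eq hH hH' hκ hn hT]
  set B := cH H * (4 * Real.exp (rate b) * (2 * level H β N + 1) *
        Real.exp (-(2 * level H β N * Real.log c))) with hB
  have hB0 : 0 ≤ B := by positivity
  set A := T * ((a * T) ^ (2 * level H β N) / (2 * level H β N).factorial *
        ∫ y in 0..a, cH H * y ^ (-(H + 1 / 2))) with hA
  have hA0 : 0 ≤ A := by positivity
  have hfirst : ∀ i : Fin (numIntervals H β N), (i : ℕ) = 0 →
      ∫ t in (0 : ℝ)..T, pieceError (cH H) (H + 1 / 2) (xi H c β a N) x w i t ≤ A := by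
    intro i hi
    have h1 : ∫ t in (0 : ℝ)..T, pieceError (cH H) (H + 1 / 2) (xi H c β a N) x w i t ≤
        ∫ _ in (0 : ℝ)..T, (a * T) ^ (2 * level H β N) / (2 * level H β N).factorial *
          ∫ y in 0..a, cH H * y ^ (-(H + 1 / 2)) := by
      refine intervalIntegral.integral_mono_on hT.le
        (hC.intervalIntegrable_pieceError hα hα1 hT i) intervalIntegrable_const fun t ht => ?_
      have h2 := hC.pieceError_first_le hκ hα1 i hi ht.1
      rw [show xi H c β a N 1 = a by rw [xi, xiAux]] at h2
      refine h2.trans (mul_le_mul_of_nonneg_right ?_ hI)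
      have := ht.1
      have := ht.2
      gcongr
    rwa [intervalIntegral.integral_const, sub_zero, smul_eq_mul] at h1
  have hsum : ∑ i, (∫ t in (0 : ℝ)..T, pieceError (cH H) (H + 1 / 2) (xi H c β a N) x w i t) ≤
      A + numIntervals H β N * B := by
    calc _ ≤ ∑ i : Fin (numIntervals H β N), ((if (i : ℕ) = 0 then A else 0) + B) := by
          refine Finset.sum_le_sum fun i _ => ?_
          split_ifs with hi
          · exact (hfirst i hi).trans (le_add_of_nonneg_right hB0)
          · rw [zero_add]
            exact hg.integral_pieceError_le hH hH' hc ha hT hR hb hgb i (by omega)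
      _ = A + numIntervals H β N * B := by
          rw [Finset.sum_add_distrib, Finset.sum_const, Finset.card_univ, Fintype.card_fin,
            nsmul_eq_mul, Finset.sum_eq_single ⟨0, hn⟩]
          · simp
          · intro i _ hi
            rw [if_neg fun h => hi (Fin.ext h)]
          · simp
  have htail : 0 ≤ ∫ y in Ioi (xi H c β a N (numIntervals H β N)),
      y ^ (-(H + 1 / 2 + 1)) * Real.exp (-T * y) :=
    setIntegral_nonneg measurableSet_Ioi fun y hy =>
      mul_nonneg (Real.rpow_nonneg ((hg.xi_pos hH hc ha hn le_rfl).trans hy).le _)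
        (Real.exp_pos _).le
  have hlead : leadingTerm H c β a N = cH H * (xi H c β a N (numIntervals H β N) ^
      (-(H + 1 / 2)) / (H + 1 / 2)) := by
    rw [leadingTerm, show -1 / 2 - H = -(H + 1 / 2) by ring]; ring
  rw [hlead, mul_sub]
  have := mul_nonneg hκ.le htail
  linarith

/-- The lower bound for the error at a fixed `N`, from the last interval. -/
theorem GridNeg.le_kernelError (hg : GridNeg H c β a N) (hH : -1 / 2 < H)
    (hH' : H < 1 / 2) (hc : 0 < c) (ha : 0 < a) (hT : 0 < T)
    (hR : IsNonGeometricRule H c β a N x w) {k : ℕ} (hk : 1 ≤ k)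
    (hkn : k + 1 = numIntervals H β N) {u : ℝ} (hu : gridPoint H c β a N k = u) :
    leadingTerm H c β a N * (1 + (H + 1 / 2) * ((1 - Real.exp (-rate u)) * Real.sinh (-u) *
        Real.exp (-((2 * level H β N + 1) * -u)) / (2 * level H β N + 1)) -
      Real.exp (rate u) * Real.exp (-T * xi H c β a N k)) ≤ kernelError H T x w := by
  have hκ := cH_pos hH hH'
  have hC := hg.isCompositeRule hH hc ha hR
  have hn : 0 < numIntervals H β N := one_le_rd _
  have hα : 0 < H + 1 / 2 := by linarith
  have hα1 : H + 1 / 2 < 1 := by linarith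
  have hkn' : k < numIntervals H β N := by omega
  have hu0 : u < 0 := hu ▸ hg k hk hkn'.le
  have hp := hg.xi_pos hH hc ha hk hkn'.le
  have hq := hg.xi_pos hH hc ha (k := k + 1) (by omega) hkn'
  have hpq := hg.xi_lt_succ hH hc ha hk hkn'
  have hqp := hg.xi_succ_eq hH hc ha hk hkn'
  rw [hu] at hqp
  have h1 := hC.le_integral_pieceError (T := T) hκ hα hα1 hT ⟨k, hkn'⟩ hk (θ := -u) (by linarith)
    (by rw [← hu]; exact hg.cosh_eq hH hc ha hk hkn')
  simp only at h1
  have h2 : ∫ t in (0 : ℝ)..T, pieceError (cH H) (H + 1 / 2) (xi H c β a N) x w ⟨k, hkn'⟩ t ≤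
      ∑ i, (∫ t in (0 : ℝ)..T, pieceError (cH H) (H + 1 / 2) (xi H c β a N) x w i t) :=
    Finset.single_le_sum (f := fun i => ∫ t in (0 : ℝ)..T,
        pieceError (cH H) (H + 1 / 2) (xi H c β a N) x w i t)
      (fun i _ => intervalIntegral.integral_nonneg hT.le fun t ht =>
        hC.pieceError_nonneg hκ hα hα1 i ht.1) (Finset.mem_univ _)
  have hxi : xi H c β a N (numIntervals H β N) = xi H c β a N (k + 1) := by rw [hkn]
  rw [hC.kernelError_eq hH hH' hκ hn hT, hxi]
  -- The damped integrals from the last interval and from the tail join to one integral over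
  -- (ξ_{n-1}, ∞).
  have h3 : (∫ y in xi H c β a N k..xi H c β a N (k + 1),
        y ^ (-(H + 1 / 2 + 1)) * Real.exp (-T * y)) +
      (∫ y in Ioi (xi H c β a N (k + 1)), y ^ (-(H + 1 / 2 + 1)) * Real.exp (-T * y)) ≤
      Real.exp (-T * xi H c β a N k) * (xi H c β a N k ^ (-(H + 1 / 2)) / (H + 1 / 2)) := by
    have hint := integrableOn_rpow_mul_exp_Ioi (α := H + 1 / 2) (T := T) hα hp hT.le
    rw [intervalIntegral.integral_of_le hpq.le,
      ← setIntegral_union (Set.Ioc_disjoint_Ioi le_rfl) measurableSet_Ioi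
        (hint.mono_set Ioc_subset_Ioi_self) (hint.mono_set (Ioi_subset_Ioi hpq.le)),
      Ioc_union_Ioi_eq_Ioi hpq.le]
    exact integral_rpow_mul_exp_Ioi_le hα hp hT.le
  have h4 : xi H c β a N k ^ (-(H + 1 / 2)) ≤
      Real.exp (rate u) * xi H c β a N (k + 1) ^ (-(H + 1 / 2)) := by
    rw [hqp, Real.mul_rpow (Real.exp_pos _).le hp.le, ← mul_assoc, ← Real.exp_mul, ← Real.exp_add]
    refine le_mul_of_one_le_left (Real.rpow_nonneg hp.le _) (Real.one_le_exp ?_)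
    nlinarith [rate_pos_of_neg hu0]
  have h5 : xi H c β a N k / xi H c β a N (k + 1) = Real.exp (-rate u) := by
    rw [hqp, Real.exp_neg]
    field_simp
  rw [h5] at h1
  have hlead : leadingTerm H c β a N = cH H * (xi H c β a N (k + 1) ^
      (-(H + 1 / 2)) / (H + 1 / 2)) := by
    rw [leadingTerm, show -1 / 2 - H = -(H + 1 / 2) by ring, hkn]; ring
  rw [hlead]
  set Q := xi H c β a N (k + 1) ^ (-(H + 1 / 2))
  set P := xi H c β a N k ^ (-(H + 1 / 2))
  set S := (1 - Real.exp (-rate u)) * Real.sinh (-u) *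
        Real.exp (-((2 * level H β N + 1) * -u)) / (2 * level H β N + 1)
  set E := Real.exp (-T * xi H c β a N k)
  have hE : 0 < E := Real.exp_pos _
  have h6 : E * (P / (H + 1 / 2)) ≤ Real.exp (rate u) * E * (Q / (H + 1 / 2)) := by
    have := mul_le_mul_of_nonneg_left (div_le_div_of_nonneg_right h4 hα.le) hE.le
    calc _ ≤ _ := this
      _ = _ := by ring
  have h7 : cH H * (Q / (H + 1 / 2)) * (1 + (H + 1 / 2) * S - Real.exp (rate u) * E) =
      cH H * (Q / (H + 1 / 2) + Q * S - Real.exp (rate u) * E * (Q / (H + 1 / 2))) := by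
    rw [mul_assoc, mul_sub, mul_add, mul_one, ← mul_assoc (Q / _), div_mul_cancel₀ _ hα.ne',
      mul_comm (Q / _)]
  rw [h7]
  refine le_trans ?_ (add_le_add_left (h1.trans h2) _)
  rw [← mul_add]
  refine mul_le_mul_of_nonneg_left ?_ hκ.le
  linarith

end

end RoughKernel
end

/-! ### Asymptotics as N tends to infinity, and limits at the threshold -/

noncomputable section

namespace RoughKernel
open MeasureTheory

section

variable {H c β a T : ℝ}

theorem eventually_gridNeg (hH : -1 / 2 < H) (hβ : 0 < β) (hc : 1 < c) (h : clock c β 1 < 0)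
    (a : ℝ) : ∀ᶠ N in atTop, GridNeg H c β a N ∧
      ∀ k, 1 ≤ k → k ≤ numIntervals H β N → gridPoint H c β a N k ≤ endPoint c β / 2 := by
  have hV := endPoint_neg h
  filter_upwards [eventually_gridPoint_le hH hβ hc h a] with N hN
  exact ⟨fun k hk hkn => by linarith [(hN k hk hkn).1], fun k hk hkn => (hN k hk hkn).1⟩

theorem endPoint_add_log_pos (hβ : 0 < β) : 0 < endPoint c β + Real.log c := by
  have : -Real.log c < endPoint c β := by
    rw [← strictMono_travel.lt_iff_lt, travel_endPoint]
    have : 0 < 1 / (2 * β ^ 2) := by positivity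
    linarith
  linarith

theorem tendsto_level_sq_mul_exp (hH : -1 / 2 < H) (hβ : 0 < β) {v : ℝ} (hv : v < 0) :
    Tendsto (fun N => (level H β N : ℝ) ^ 2 * Real.exp (level H β N * v)) atTop (𝓝 0) := by
  have h1 : Tendsto (fun N => (level H β N : ℝ) * -v) atTop atTop :=
    (tendsto_level hH hβ).atTop_mul_const (by linarith)
  have h2 := ((Real.tendsto_pow_mul_exp_neg_atTop_nhds_zero 2).comp h1).const_mul (1 / v ^ 2)
  rw [mul_zero] at h2
  refine h2.congr fun N => ?_
  simp only [Function.comp]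
  rw [show -((level H β N : ℝ) * -v) = level H β N * v by ring]
  have := hv.ne
  field_simp

theorem eventually_numIntervals_le (hH : -1 / 2 < H) (hβ : 0 < β) :
    ∃ D, 0 < D ∧ ∀ᶠ N in atTop, (numIntervals H β N : ℝ) ≤ D * level H β N := by
  have hα : 0 < 1 / 2 + H := by linarith
  have hR := roundingBound_pos hH hβ
  refine ⟨2 * (1 / (2 * β ^ 2) + roundingBound H β) / (1 / 2 + H), by positivity, ?_⟩
  filter_upwards [eventually_abs_numIntervals_mul_sub_le hH hβ,
    (tendsto_xiExponent hH hβ).eventually_le_const one_pos] with N h1 h2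
  have h3 := (abs_le.1 h1).2
  have h4 := two_mul_level_mul_xiExponent H β N
  have hm := level_pos H β N
  rw [div_mul_eq_mul_div, le_div_iff₀ hα, ← h4]
  have h5 : (numIntervals H β N : ℝ) * xiExponent H β N ≤
      1 / (2 * β ^ 2) + roundingBound H β := by nlinarith
  nlinarith [mul_le_mul_of_nonneg_left h5 hm.le]

/-- Relative to the leading term, the first interval is of order at most (aTc)^(2m)/(2m)!, and the
others together at most of order m² e^(mV), because n = O(m) and u_n ≤ V/2. Both tend to 0. -/
theorem eventually_kernelError_le (hH : -1 / 2 < H) (hH' : H < 1 / 2) (hβ : 0 < β) (hc : 1 < c)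
    (h : clock c β 1 < 0) (hT : 0 < T) (ha : 0 < a) {ε : ℝ} (hε : 0 < ε) :
    ∀ᶠ N : ℕ in atTop, ∀ x w, IsNonGeometricRule H c β a N x w →
      kernelError H T x w ≤ (1 + ε) * leadingTerm H c β a N := by
  have hκ := cH_pos hH hH'
  have hV := endPoint_neg h
  have hα : 0 < H + 1 / 2 := by linarith
  have hc0 : 0 < c := by linarith
  obtain ⟨D, hD, hn⟩ := eventually_numIntervals_le hH hβ
  set I := ∫ y in 0..a, cH H * y ^ (-(H + 1 / 2))
  have hI : 0 ≤ I := intervalIntegral.integral_nonneg ha.le fun y hy =>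
      mul_nonneg hκ.le (Real.rpow_nonneg hy.1 _)
  have t1 : Tendsto (fun N => T * I * ((H + 1 / 2) / cH H) *
      ((a * T * c) ^ (2 * level H β N) / (2 * level H β N).factorial)) atTop (𝓝 0) := by
    have h1 : Tendsto (level H β) atTop atTop :=
      tendsto_natCast_atTop_iff.1 (tendsto_level hH hβ)
    have h2 := ((FloorSemiring.tendsto_pow_div_factorial_atTop (a * T * c)).comp
      (h1.const_mul_atTop' two_pos)).const_mul (T * I * ((H + 1 / 2) / cH H))
    rwa [mul_zero] at h2
  have t2 : Tendsto (fun N => D * (4 * Real.exp (rate (endPoint c β / 2))) * 3 * (H + 1 / 2) *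
      ((level H β N : ℝ) ^ 2 * Real.exp (level H β N * endPoint c β))) atTop (𝓝 0) := by
    have := (tendsto_level_sq_mul_exp hH hβ hV).const_mul
      (D * (4 * Real.exp (rate (endPoint c β / 2))) * 3 * (H + 1 / 2))
    rwa [mul_zero] at this
  filter_upwards [eventually_gridNeg hH hβ hc h a, hn, t1.eventually_le_const (half_pos hε),
    t2.eventually_le_const (half_pos hε)] with N hg h1 h2 h3 x w hR
  obtain ⟨hg, hgb⟩ := hg
  refine (hg.kernelError_le hH hH' hc0 ha hT hR (by linarith) hgb).trans ?_
  have hU := hgb (numIntervals H β N) (one_le_rd _) le_rfl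
  rw [hg.leadingTerm_eq hH hc0 ha]
  have hm1 : (1 : ℝ) ≤ level H β N := by exact_mod_cast one_le_rd _
  have hcm : Real.exp (2 * level H β N * Real.log c) = c ^ (2 * level H β N) := by
    rw [← Real.exp_log (pow_pos hc0 _), Real.log_pow]; push_cast; rfl
  have hmU : level H β N * (2 * gridPoint H c β a N (numIntervals H β N)) ≤
      level H β N * endPoint c β := mul_le_mul_of_nonneg_left (by linarith) (by linarith)
  rw [show (-(2 * (level H β N : ℝ) * (gridPoint H c β a N (numIntervals H β N) + Real.log c))) =
    -(2 * level H β N * Real.log c) +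
      -(level H β N * (2 * gridPoint H c β a N (numIntervals H β N))) by ring, Real.exp_add]
  set U := gridPoint H c β a N (numIntervals H β N)
  have hE1 : 1 ≤ Real.exp (-(level H β N * (2 * U))) := Real.one_le_exp (by nlinarith)
  have hE2 : Real.exp (-(level H β N * endPoint c β)) ≤ Real.exp (-(level H β N * (2 * U))) :=
    Real.exp_le_exp.2 (by linarith)
  set E := Real.exp (-(level H β N * (2 * U)))
  set L := Real.exp (-(2 * level H β N * Real.log c)) with hL
  have hL0 : 0 < L := Real.exp_pos _
  have hLc : c ^ (2 * level H β N) * L = 1 := by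
    rw [← hcm, hL, ← Real.exp_add, add_neg_cancel, Real.exp_zero]
  have e1 : T * ((a * T) ^ (2 * level H β N) / (2 * level H β N).factorial * I) ≤
      ε / 2 * (cH H / (H + 1 / 2) * (L * E)) := by
    calc T * ((a * T) ^ (2 * level H β N) / (2 * level H β N).factorial * I)
        = (T * I * ((H + 1 / 2) / cH H) *
          ((a * T * c) ^ (2 * level H β N) / (2 * level H β N).factorial)) *
            (cH H / (H + 1 / 2) * (L * 1)) := by
          rw [mul_pow (a * T), show ∀ A B C F G P : ℝ, A * ((P * G) / F) * (B * (C * 1)) =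
            A * B * (P / F) * (G * C) by intros; ring, hLc]
          generalize H + 1 / 2 = α at hα
          field_simp
      _ ≤ ε / 2 * (cH H / (H + 1 / 2) * (L * 1)) :=
          mul_le_mul_of_nonneg_right h2 (by positivity)
      _ ≤ _ := by gcongr
  have e2 : numIntervals H β N * (cH H * (4 * Real.exp (rate (endPoint c β / 2)) *
        (2 * level H β N + 1) * L)) ≤ ε / 2 * (cH H / (H + 1 / 2) * (L * E)) := by
    calc numIntervals H β N * (cH H * (4 * Real.exp (rate (endPoint c β / 2)) *
        (2 * level H β N + 1) * L))
        ≤ (D * level H β N) * (cH H * (4 * Real.exp (rate (endPoint c β / 2)) *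
        (3 * level H β N) * L)) := by
          gcongr
          linarith
      _ = (D * (4 * Real.exp (rate (endPoint c β / 2))) * 3 * (H + 1 / 2) *
      ((level H β N : ℝ) ^ 2 * Real.exp (level H β N * endPoint c β))) *
        (cH H / (H + 1 / 2) * (L * Real.exp (-(level H β N * endPoint c β)))) := by
          have : Real.exp (level H β N * endPoint c β) *
            Real.exp (-(level H β N * endPoint c β)) = 1 := by
              rw [← Real.exp_add, add_neg_cancel, Real.exp_zero]
          rw [show ∀ A B M C F G : ℝ, A * (M * F) * (B * (C * G)) = A * B * M * C * (F * G) by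
            intros; ring, this]
          generalize H + 1 / 2 = α at hα
          field_simp
      _ ≤ ε / 2 * (cH H / (H + 1 / 2) * (L * Real.exp (-(level H β N * endPoint c β)))) :=
          mul_le_mul_of_nonneg_right h3 (by positivity)
      _ ≤ _ := by gcongr
  linarith

theorem etaSolution_one_div (hβ : 0 < β) :
    etaSolution c β 1 / β = 2 * β * (endPoint c β + Real.log c) := by
  rw [etaSolution, endPoint]
  field_simp

/-- The exponents 2m(u_n + log c) and 2β(V + log c)√(αN) differ by a bounded amount: m is within 1/2
of β√(αN), and 2m |u_n - V| ≤ 2m A s = α A. -/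
theorem leadingTerm_isTheta (hH : -1 / 2 < H) (hH' : H < 1 / 2) (hβ : 0 < β) (hc : 1 < c)
    (h : clock c β 1 < 0) (ha : 0 < a) :
    (fun N : ℕ => leadingTerm H c β a N) =Θ[atTop]
      (fun N : ℕ => Real.exp (-(etaSolution c β 1 / β) * √((H + 1 / 2) * N))) := by
  have hκ := cH_pos hH hH'
  have hα : 0 < H + 1 / 2 := by linarith
  have hc0 : 0 < c := by linarith
  obtain ⟨A, hA⟩ := exists_abs_gridPoint_sub_le hH hβ hc h a
  set D := (1 / 2 + H) * A + |endPoint c β + Real.log c|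
  have key : ∀ᶠ N : ℕ in atTop,
      leadingTerm H c β a N ≤ cH H / (H + 1 / 2) * Real.exp D *
        Real.exp (-(etaSolution c β 1 / β) * √((H + 1 / 2) * N)) ∧
      Real.exp (-(etaSolution c β 1 / β) * √((H + 1 / 2) * N)) ≤
        Real.exp D / (cH H / (H + 1 / 2)) * leadingTerm H c β a N := by
    filter_upwards [eventually_gridNeg hH hβ hc h a, hA, eventually_abs_level_sub_le hH hβ]
      with N hg h1 h2
    rw [hg.1.leadingTerm_eq hH hc0 ha, etaSolution_one_div hβ, add_comm H]
    have hm := level_pos H β N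
    have h4 := two_mul_level_mul_xiExponent H β N
    set U := gridPoint H c β a N (numIntervals H β N)
    set V := endPoint c β
    set m := (level H β N : ℝ)
    set R := √((1 / 2 + H) * N)
    have h5 : |2 * m * (U + Real.log c) - 2 * β * (V + Real.log c) * R| ≤ D := by
      rw [show 2 * m * (U + Real.log c) - 2 * β * (V + Real.log c) * R =
        2 * m * (U - V) + 2 * (m - β * R) * (V + Real.log c) by ring]
      refine (abs_add_le _ _).trans (add_le_add ?_ ?_)
      · rw [abs_mul, abs_of_pos (by positivity : 0 < 2 * m)]
        calc _ ≤ 2 * m * (A * xiExponent H β N) := by gcongr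
          _ = _ := by rw [← h4]; ring
      · rw [abs_mul, abs_mul, abs_two]
        refine mul_le_of_le_one_left (abs_nonneg _) (by linarith)
    rw [abs_le] at h5
    have hα' : 0 < 1 / 2 + H := by linarith
    constructor
    · rw [mul_assoc (cH H / _), ← Real.exp_add]
      refine mul_le_mul_of_nonneg_left (Real.exp_le_exp.2 ?_) (by positivity)
      linarith [h5.1]
    · rw [← mul_assoc, div_mul_cancel₀ _ (by positivity), ← Real.exp_add]
      refine Real.exp_le_exp.2 ?_
      linarith [h5.2]
  constructor
  · refine IsBigO.of_bound (cH H / (H + 1 / 2) * Real.exp D) ?_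
    filter_upwards [key, eventually_gridNeg hH hβ hc h a] with N hN hg
    rw [Real.norm_of_nonneg (Real.exp_pos _).le, Real.norm_of_nonneg]
    · exact hN.1
    · rw [hg.1.leadingTerm_eq hH hc0 ha]; positivity
  · refine IsBigO.of_bound (Real.exp D / (cH H / (H + 1 / 2))) ?_
    filter_upwards [key, eventually_gridNeg hH hβ hc h a] with N hN hg
    rw [Real.norm_of_nonneg (Real.exp_pos _).le, Real.norm_of_nonneg]
    · exact hN.2
    · rw [hg.1.leadingTerm_eq hH hc0 ha]; positivity

-- The last interval has relative size at least a constant times e^(-(2m+1)W)/(2m+1) for any W > -V.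
-- With g = γ/(β√α), the term e^(-γ√N) is at most a constant times e^(-gm), and the assumption
-- leaves room for g > 2W. The damping term e^(-Tξ_{n-1}) is smaller still.
set_option maxHeartbeats 800000 in
theorem eventually_lt_kernelError (hH : -1 / 2 < H) (hH' : H < 1 / 2) (hβ : 0 < β) (hc : 1 < c)
    (h : clock c β 1 < 0) (hT : 0 < T) (ha : 0 < a) {γ : ℝ} (hγ : 0 < γ) (C : ℝ)
    (hγV : 2 * -endPoint c β < γ / (β * √(1 / 2 + H))) :
    ∀ᶠ N : ℕ in atTop, ∀ x w, IsNonGeometricRule H c β a N x w →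
      (1 + C * Real.exp (-γ * √N)) * leadingTerm H c β a N < kernelError H T x w := by
  have hκ := cH_pos hH hH'
  have hα : 0 < 1 / 2 + H := by linarith
  have hc0 : 0 < c := by linarith
  have hV := endPoint_neg h
  have hVc := endPoint_add_log_pos (c := c) hβ
  set V := endPoint c β
  set g := γ / (β * √(1 / 2 + H)) with hg_def
  have hsα : 0 < √(1 / 2 + H) := Real.sqrt_pos.2 hα
  have hg0 : 0 < g := by positivity
  obtain ⟨W, hVW, hWg⟩ := exists_between (show -V < g / 2 by linarith)
  have hW : 0 < W := by linarith
  have hs0 := tendsto_xiExponent hH hβ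
  have hgrid := tendsto_gridPoint hH hβ hc h a
  have hn2 : ∀ᶠ N in atTop, 2 ≤ numIntervals H β N :=
    (tendsto_natCast_atTop_iff.1 (tendsto_numIntervals hH hβ)).eventually_ge_atTop 2
  set u := fun N => gridPoint H c β a N (numIntervals H β N - 1) with hu_def
  have hu : Tendsto u atTop (𝓝 V) := by
    have h1 : Tendsto (fun N => gridPoint H c β a N (numIntervals H β N) -
        xiExponent H β N * rate (V / 2)) atTop (𝓝 V) := by
      simpa using hgrid.sub (hs0.mul_const (rate (V / 2)))
    -- The last step has positive length at most s rate(V/2), so the last point but one also tends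
    -- to V.
    refine tendsto_of_tendsto_of_tendsto_of_le_of_le' h1 hgrid ?_ ?_
    · filter_upwards [hn2, eventually_gridNeg hH hβ hc h a] with N hN hg
      have h2 := gridPoint_succ H c β a N (show 1 ≤ numIntervals H β N - 1 by omega)
      rw [Nat.sub_add_cancel (by omega)] at h2
      have h3 := hg.2 (numIntervals H β N - 1) (by omega) (by omega)
      have h4 := mul_le_mul_of_nonneg_left (rate_le h3 (by linarith)) (xiExponent_pos hH β N).le
      simp only [hu_def]
      linarith
    · filter_upwards [hn2, eventually_gridNeg hH hβ hc h a] with N hN hg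
      have h2 := gridPoint_succ H c β a N (show 1 ≤ numIntervals H β N - 1 by omega)
      rw [Nat.sub_add_cancel (by omega)] at h2
      have h3 := hg.1 (numIntervals H β N - 1) (by omega) (by omega)
      have h4 := mul_pos (xiExponent_pos hH β N) (rate_pos_of_neg h3)
      simp only [hu_def]
      linarith
  set q := (1 - Real.exp (-rate V)) * Real.sinh (-V) with hq_def
  have hrV := rate_pos_of_neg hV
  have hq : 0 < q := mul_pos (sub_pos.2 (Real.exp_lt_one_iff.2 (by linarith)))
    (Real.sinh_pos_iff.2 (by linarith))
  have hqu : Tendsto (fun N => (1 - Real.exp (-rate (u N))) * Real.sinh (-u N)) atTop (𝓝 q) := by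
    have h1 : ContinuousAt (fun x => (1 - Real.exp (-rate x)) * Real.sinh (-x)) V := by
      have := continuousAt_rate hV
      fun_prop
    exact h1.tendsto.comp hu
  set κ := (V + Real.log c) / (1 / 2 + H)
  have hκ0 : 0 < κ := by positivity
  -- A decay rate to spare in both competing terms: g - 2W in e^(-γ√N), and 1 in the damping term.
  -- It pays for the powers of m.
  set ρ := min (g - 2 * W) 1
  have hρ : 0 < ρ := lt_min (by linarith) one_pos
  set D := (|C| * Real.exp (g / 2) + Real.exp (rate (V / 2))) * Real.exp W * 3 with hD
  have t1 : Tendsto (fun N => D * ((level H β N : ℝ) ^ 2 * Real.exp (level H β N * -ρ)))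
      atTop (𝓝 0) := by
    simpa using (tendsto_level_sq_mul_exp hH hβ (neg_lt_zero.2 hρ)).const_mul D
  filter_upwards [hn2, eventually_gridNeg hH hβ hc h a, eventually_abs_level_sub_le hH hβ,
    hu.eventually_const_lt (show -W < V by linarith),
    hu.eventually_const_lt (show V - (V + Real.log c) / 2 < V by linarith),
    hqu.eventually_const_lt (half_lt_self hq),
    t1.eventually_lt_const (show 0 < (1 / 2 + H) * (q / 2) by positivity),
    (tendsto_level hH hβ).eventually_ge_atTop ((2 * W + 1) / (T * (κ ^ 2 / 2)))]
    with N hn hg h1 h2 h3 h4 h5 h6 x w hR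
  obtain ⟨hg, hgb⟩ := hg
  have hmain := hg.le_kernelError hH hH' hc0 ha hT hR (k := numIntervals H β N - 1) (by omega)
    (Nat.sub_add_cancel (by omega)) (u := u N) rfl
  refine lt_of_lt_of_le ?_ hmain
  have hlead : 0 < leadingTerm H c β a N := by
    rw [hg.leadingTerm_eq hH hc0 ha]
    have : 0 < H + 1 / 2 := by linarith
    positivity
  rw [mul_comm, add_comm H]
  refine mul_lt_mul_of_pos_left ?_ hlead
  have hm1 : (1 : ℝ) ≤ level H β N := by exact_mod_cast one_le_rd _
  have hms := two_mul_level_mul_xiExponent H β N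
  have hs := xiExponent_pos hH β N
  have hub : u N ≤ V / 2 := hgb _ (by omega) (by omega)
  have hxi := hg.xi_eq hH hc0 ha (k := numIntervals H β N - 1) (by omega) (by omega)
  set m := (level H β N : ℝ)
  have hm0 : 0 < m := by linarith
  have hxi_ge : (2 * W + 1) * m ≤
      T * xi H c β a N (numIntervals H β N - 1) := by
    have e1 : κ * m ≤ (u N + Real.log c) / xiExponent H β N := by
      rw [le_div_iff₀ hs, show κ * m * xiExponent H β N =
        (V + Real.log c) / (1 / 2 + H) * (2 * m * xiExponent H β N) / 2 by ring, hms,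
        div_mul_cancel₀ _ hα.ne']
      linarith
    -- The bound e^x ≥ x²/2 suffices: T ξ_{n-1} only has to exceed a multiple of m.
    have e2 : (κ * m) ^ 2 / 2 ≤ xi H c β a N (numIntervals H β N - 1) := by
      rw [hxi]
      have := Real.quadratic_le_exp_of_nonneg (show 0 ≤ κ * m by positivity)
      have e3 := Real.exp_le_exp.2 e1
      have : 0 < κ * m := by positivity
      linarith
    rw [div_le_iff₀ (by positivity)] at h6
    calc (2 * W + 1) * m ≤ m * (T * (κ ^ 2 / 2)) * m := by gcongr
      _ = T * ((κ * m) ^ 2 / 2) := by ring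
      _ ≤ _ := by gcongr
  have hρ1 : ρ ≤ g - 2 * W := min_le_left _ _
  have hρ2 : ρ ≤ 1 := min_le_right _ _
  have f1 : Real.exp (-γ * √N) ≤ Real.exp (g / 2) * Real.exp (-((2 * W + ρ) * m)) := by
    rw [← Real.exp_add, Real.exp_le_exp]
    have e1 := (abs_le.1 h1).2
    rw [Real.sqrt_mul hα.le] at e1
    have e2 : γ * √N = g * (β * (√(1 / 2 + H) * √N)) := by
      rw [hg_def, ← mul_assoc β, ← mul_assoc, div_mul_cancel₀ _ (by positivity)]
    have e3 : g * (m - 1 / 2) ≤ γ * √N := by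
      rw [e2]; exact mul_le_mul_of_nonneg_left (by linarith) hg0.le
    have e4 := mul_le_mul_of_nonneg_right (show 2 * W + ρ ≤ g by linarith) hm0.le
    linarith
  have f2 : Real.exp (rate (u N)) * Real.exp (-T * xi H c β a N (numIntervals H β N - 1)) ≤
      Real.exp (rate (V / 2)) * Real.exp (-((2 * W + ρ) * m)) := by
    have e4 := mul_le_mul_of_nonneg_right (show 2 * W + ρ ≤ 2 * W + 1 by linarith) hm0.le
    exact mul_le_mul (Real.exp_le_exp.2 (rate_le hub (by linarith)))
      (Real.exp_le_exp.2 (by linarith)) (Real.exp_pos _).le (Real.exp_pos _).le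
  have f3 : q / 2 * Real.exp (-((2 * m + 1) * W)) / (2 * m + 1) ≤
      (1 - Real.exp (-rate (u N))) * Real.sinh (-u N) *
        Real.exp (-((2 * m + 1) * -u N)) / (2 * m + 1) := by
    gcongr
    · linarith
    · linarith
  have f4 : (|C| * Real.exp (g / 2) + Real.exp (rate (V / 2))) * Real.exp (-((2 * W + ρ) * m)) <
      (1 / 2 + H) * (q / 2 * Real.exp (-((2 * m + 1) * W)) / (2 * m + 1)) := by
    rw [← mul_div_assoc, lt_div_iff₀ (by positivity)]
    have e1 : Real.exp (-((2 * W + ρ) * m)) =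
        Real.exp W * Real.exp (m * -ρ) * Real.exp (-((2 * m + 1) * W)) := by
      rw [← Real.exp_add, ← Real.exp_add]; congr 1; ring
    have e2 : (|C| * Real.exp (g / 2) + Real.exp (rate (V / 2))) * Real.exp W *
        Real.exp (m * -ρ) * (2 * m + 1) ≤ D * (m ^ 2 * Real.exp (m * -ρ)) := by
      rw [hD, show ∀ A B : ℝ, A * B * 3 * (m ^ 2 * Real.exp (m * -ρ)) =
        A * B * Real.exp (m * -ρ) * (3 * m ^ 2) by intros; ring]
      gcongr
      nlinarith
    rw [e1, show ∀ A B F G P : ℝ, A * (B * F * G) * P = (A * B * F * P) * G by intros; ring,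
      ← mul_assoc]
    exact mul_lt_mul_of_pos_right (e2.trans_lt h5) (Real.exp_pos _)
  have f5 : C * Real.exp (-γ * √N) ≤ |C| * (Real.exp (g / 2) * Real.exp (-((2 * W + ρ) * m))) :=
    (mul_le_mul_of_nonneg_right (le_abs_self C) (Real.exp_pos _).le).trans
      (mul_le_mul_of_nonneg_left f1 (abs_nonneg C))
  have f6 := mul_le_mul_of_nonneg_left f3 hα.le
  rw [add_mul] at f4
  linarith

/-- The term -log c in the assumption on C pays for the rounding of m: it changes the exponent by at
most V + log c, which is below log c. -/
theorem eventually_le_leadingTerm (hH : -1 / 2 < H) (hH' : H < 1 / 2) (hβ : 0 < β) (hc : 1 < c)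
    (h : clock c β 1 < 0) (ha : 0 < a) (hlag : 0 ≤ lag H c β a) {C : ℝ}
    (hC : C ≤ cH H / (H + 1 / 2) *
      Real.exp ((1 / 2 + H) * (rate (endPoint c β) / 2 * lag H c β a) - Real.log c)) :
    ∀ᶠ N : ℕ in atTop,
      C * Real.exp (-(etaSolution c β 1 / β) * √((H + 1 / 2) * N)) ≤ leadingTerm H c β a N := by
  have hκ := cH_pos hH hH'
  have hα : 0 < H + 1 / 2 := by linarith
  have hc0 : 0 < c := by linarith
  have hV := endPoint_neg h
  have hVc := endPoint_add_log_pos (c := c) hβ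
  filter_upwards [eventually_gridNeg hH hβ hc h a, eventually_abs_level_sub_le hH hβ,
    eventually_lag_le hH hβ hc h a hlag] with N hg h1 h2
  rw [hg.1.leadingTerm_eq hH hc0 ha, etaSolution_one_div hβ]
  refine (mul_le_mul_of_nonneg_right hC (Real.exp_pos _).le).trans ?_
  rw [mul_assoc, ← Real.exp_add]
  have h3 := (abs_le.1 h1).2
  rw [add_comm (1 / 2) H] at h3
  have h4 := mul_le_mul_of_nonneg_right h3 hVc.le
  gcongr
  linarith

end

section

variable {c₀ β₀ : ℝ}

theorem continuousAt_endPoint (hc : 0 < c₀) (hβ : 0 < β₀) :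
    ContinuousAt (fun p : ℝ × ℝ => endPoint p.1 p.2) (c₀, β₀) := by
  unfold endPoint clock
  refine continuous_position.continuousAt.comp (f := fun p : ℝ × ℝ => _) ?_
  refine ContinuousAt.add ?_ ?_
  · refine continuous_travel.continuousAt.comp (f := fun p : ℝ × ℝ => _) ?_
    exact (continuousAt_fst.log hc.ne').neg
  · refine continuousAt_const.div (by fun_prop) (by positivity)

theorem tendsto_endPoint (h : IsThreshold c₀ β₀) :
    Tendsto (fun p : ℝ × ℝ => endPoint p.1 p.2) (𝓝 (c₀, β₀)) (𝓝 0) := by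
  obtain ⟨hβ, hc, h0⟩ := isThreshold_iff.1 h
  have := (continuousAt_endPoint (show 0 < c₀ by linarith) hβ).tendsto
  simpa only [endPoint, h0, position_zero] using this

theorem tendsto_rate_endPoint (h : IsThreshold c₀ β₀) :
    Tendsto (fun p : ℝ × ℝ => rate (endPoint p.1 p.2)) (𝓝[admissible c₀ β₀] (c₀, β₀)) atTop := by
  refine tendsto_rate_zero.comp (tendsto_nhdsWithin_iff.2
    ⟨(tendsto_endPoint h).mono_left nhdsWithin_le_nhds, ?_⟩)
  filter_upwards [self_mem_nhdsWithin] with p hp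
  exact (endPoint_neg (clock_one_neg_of_admissible h hp)).ne

/-- Everything in `lag` is continuous at the threshold except the logarithm of rate(V), which tends
to infinity. -/
theorem tendsto_lag {H : ℝ} (a : ℝ) (h : IsThreshold c₀ β₀) :
    Tendsto (fun p : ℝ × ℝ => lag H p.1 p.2 a) (𝓝[admissible c₀ β₀] (c₀, β₀)) atTop := by
  obtain ⟨hβ, hc, -⟩ := isThreshold_iff.1 h
  have hlc := Real.log_pos hc
  have hc0 : c₀ ≠ 0 := by linarith
  have h1 : ContinuousAt (fun p : ℝ × ℝ => -(1 / 4 * Real.log (rate (-Real.log p.1 / 2)) +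
      (roundingBound H p.2 + startBound p.1 a))) (c₀, β₀) := by
    have e1 : ContinuousAt (fun p : ℝ × ℝ => rate (-Real.log p.1 / 2)) (c₀, β₀) := by
      refine ContinuousAt.comp (f := fun p : ℝ × ℝ => -Real.log p.1 / 2) (g := rate)
        (continuousAt_rate ?_) ?_
      · simp only; linarith
      · exact ((continuousAt_fst.log hc0).neg).div_const _
    have e2 : ContinuousAt (fun p : ℝ × ℝ => rate (-Real.log p.1 - 1)) (c₀, β₀) := by
      refine ContinuousAt.comp (f := fun p : ℝ × ℝ => -Real.log p.1 - 1) (g := rate)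
        (continuousAt_rate ?_) ?_
      · simp only; linarith
      · exact ((continuousAt_fst.log hc0).neg).sub continuousAt_const
    refine ((continuousAt_const.mul (e1.log ?_)).add (ContinuousAt.add ?_ ?_)).neg
    · exact (rate_pos_of_neg (by simp only; linarith)).ne'
    · unfold roundingBound
      refine ContinuousAt.div_const (ContinuousAt.add (continuousAt_const.div ?_ ?_)
        continuousAt_const) _
      · fun_prop
      · positivity
    · exact continuousAt_const.div e2 (rate_pos_of_neg (by simp only; linarith)).ne'
  have h2 : Tendsto (fun p : ℝ × ℝ => 1 / 4 * Real.log (rate (endPoint p.1 p.2) / 2))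
      (𝓝[admissible c₀ β₀] (c₀, β₀)) atTop :=
    (Real.tendsto_log_atTop.comp ((tendsto_rate_endPoint h).atTop_div_const two_pos)).const_mul_atTop
      (by norm_num)
  refine (h2.atTop_add (h1.tendsto.mono_left nhdsWithin_le_nhds)).congr fun p => ?_
  unfold lag
  ring

end

end RoughKernel
end

/-! ### Numerical evaluation of the travel time -/

noncomputable section

namespace RoughKernel
open MeasureTheory

/-- The integrand of the transformed travel time. -/
def cothDiv (y : ℝ) : ℝ := Real.cosh y / (Real.sinh y * y)

theorem continuousOn_cothDiv : ContinuousOn cothDiv (Ioi 0) := by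
  unfold cothDiv
  refine Real.continuous_cosh.continuousOn.div
    (Real.continuous_sinh.mul continuous_id).continuousOn fun y hy => ?_
  exact (mul_pos (Real.sinh_pos_iff.2 hy) hy).ne'

theorem intervalIntegrable_cothDiv {x y : ℝ} (hx : 0 < x) (hy : 0 < y) :
    IntervalIntegrable cothDiv volume x y :=
  (continuousOn_cothDiv.mono fun _ hz => (lt_min hx hy).trans_le hz.1).intervalIntegrable

theorem hasDerivAt_integral_cothDiv {v : ℝ} (hv : 0 < v) :
    HasDerivAt (fun v => ∫ y in (1 : ℝ)..v, cothDiv y) (cothDiv v) v :=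
  intervalIntegral.integral_hasDerivAt_right (intervalIntegrable_cothDiv one_pos hv)
    (continuousOn_cothDiv.stronglyMeasurableAtFilter isOpen_Ioi v hv)
    (continuousOn_cothDiv.continuousAt (Ioi_mem_nhds hv))

theorem integral_cothDiv_eq {v : ℝ} (hv : 0 < v) : ∫ y in (v / 2)..v, cothDiv y =
    (∫ y in (1 : ℝ)..v, cothDiv y) - ∫ y in (1 : ℝ)..(v / 2), cothDiv y := by
  rw [intervalIntegral.integral_interval_sub_left (intervalIntegrable_cothDiv one_pos hv)
    (intervalIntegrable_cothDiv one_pos (half_pos hv))]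

/-- This is coth(v/2) - coth(v) = 1/sinh(v), divided by v. -/
theorem cothDiv_sub_half {v : ℝ} (hv : 0 < v) :
    cothDiv v - cothDiv (v / 2) / 2 = -1 / (v * Real.sinh v) := by
  have h1 : Real.sinh v = 2 * Real.sinh (v / 2) * Real.cosh (v / 2) := by
    rw [← Real.sinh_two_mul]; congr 1; ring
  have h2 : Real.cosh v = Real.cosh (v / 2) ^ 2 + Real.sinh (v / 2) ^ 2 := by
    rw [← Real.cosh_two_mul]; congr 1; ring
  have h3 := Real.cosh_sq (v / 2)
  have h4 : 0 < Real.sinh (v / 2) := Real.sinh_pos_iff.2 (half_pos hv)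
  have h5 := Real.cosh_pos (v / 2)
  unfold cothDiv
  rw [h1, h2]
  field_simp
  linarith

theorem hasDerivAt_integral_cothDiv_half {v : ℝ} (hv : 0 < v) :
    HasDerivAt (fun v => ∫ y in (v / 2)..v, cothDiv y) (-1 / (v * Real.sinh v)) v := by
  have h1 := (hasDerivAt_integral_cothDiv (half_pos hv)).comp v ((hasDerivAt_id v).div_const 2)
  have h2 := (hasDerivAt_integral_cothDiv hv).sub h1
  rw [← cothDiv_sub_half hv]
  refine (h2.congr_of_eventuallyEq ?_).congr_deriv (by ring)
  filter_upwards [lt_mem_nhds hv] with w hw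
  exact integral_cothDiv_eq hw

theorem cothDiv_le {v y : ℝ} (hv : 0 < v) (hy : v ≤ y) :
    cothDiv y ≤ Real.cosh v / Real.sinh v * (1 / y) := by
  have hy0 := hv.trans_le hy
  have h1 := Real.sinh_pos_iff.2 hv
  have h2 := Real.sinh_pos_iff.2 hy0
  have h3 : 0 ≤ Real.sinh (y - v) := Real.sinh_nonneg_iff.2 (by linarith)
  rw [Real.sinh_sub] at h3
  rw [cothDiv, div_mul_div_comm, mul_one, div_le_div_iff₀ (by positivity) (by positivity)]
  nlinarith

theorem le_cothDiv {y : ℝ} (hy : 0 < y) : 1 / y ≤ cothDiv y := by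
  have h2 := Real.sinh_pos_iff.2 hy
  rw [cothDiv, div_le_div_iff₀ hy (by positivity), one_mul]
  exact mul_le_mul_of_nonneg_right (Real.sinh_lt_cosh y).le hy.le

theorem integral_one_div_half {v : ℝ} (hv : 0 < v) : ∫ y in (v / 2)..v, 1 / y = Real.log 2 := by
  rw [integral_one_div_of_pos (half_pos hv) hv]
  congr 1
  field_simp

theorem tendsto_integral_cothDiv :
    Tendsto (fun v => ∫ y in (v / 2)..v, cothDiv y) atTop (𝓝 (Real.log 2)) := by
  have hint : ∀ v : ℝ, 0 < v → IntervalIntegrable (fun y => 1 / y) volume (v / 2) v := by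
    intro v hv
    refine (ContinuousOn.div continuousOn_const continuousOn_id fun y hy => ?_).intervalIntegrable
    exact ((lt_min (half_pos hv) hv).trans_le hy.1).ne'
  have hlim : Tendsto (fun v => Real.cosh (v / 2) / Real.sinh (v / 2) * Real.log 2) atTop
      (𝓝 (1 * Real.log 2)) := by
    refine Tendsto.mul_const _ ?_
    have h1 : Tendsto (fun v : ℝ => Real.exp (-v)) atTop (𝓝 0) :=
      Real.tendsto_exp_neg_atTop_nhds_zero
    have h2 : Tendsto (fun v : ℝ => (1 + Real.exp (-v)) / (1 - Real.exp (-v))) atTop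
        (𝓝 ((1 + 0) / (1 - 0))) := (h1.const_add 1).div (h1.const_sub 1) (by norm_num)
    rw [add_zero, sub_zero, div_one] at h2
    refine h2.congr' ?_
    filter_upwards [eventually_gt_atTop 0] with v hv
    have h3 : Real.exp (-v) = Real.exp (-(v / 2)) * Real.exp (-(v / 2)) := by
      rw [← Real.exp_add]; congr 1; ring
    have h4 : Real.exp (v / 2) * Real.exp (-(v / 2)) = 1 := by
      rw [← Real.exp_add, add_neg_cancel, Real.exp_zero]
    have h5 : Real.exp (-v) < 1 := Real.exp_lt_one_iff.2 (by linarith)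
    have h6 : 0 < Real.sinh (v / 2) := Real.sinh_pos_iff.2 (half_pos hv)
    rw [div_eq_div_iff (by linarith) h6.ne', Real.cosh_eq, Real.sinh_eq, h3]
    linear_combination Real.exp (-(v / 2)) * h4
  rw [one_mul] at hlim
  refine tendsto_of_tendsto_of_tendsto_of_le_of_le' tendsto_const_nhds hlim ?_ ?_
  · filter_upwards [eventually_gt_atTop 0] with v hv
    rw [← integral_one_div_half hv]
    exact intervalIntegral.integral_mono_on (by linarith) (hint v hv)
      (intervalIntegrable_cothDiv (half_pos hv) hv) fun y hy =>
        le_cothDiv ((half_pos hv).trans_le hy.1)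
  · filter_upwards [eventually_gt_atTop 0] with v hv
    rw [← integral_one_div_half hv, ← intervalIntegral.integral_const_mul]
    exact intervalIntegral.integral_mono_on (by linarith)
      (intervalIntegrable_cothDiv (half_pos hv) hv) ((hint v hv).const_mul _) fun y hy =>
        cothDiv_le (half_pos hv) hy.1

/-- In the variable v = rate(x)/2 one has dv/dx = sinh v, so `travel` has the differential dv/(2 v
sinh v), which matches the derivative of the integral. The constant is found as x tends to 0 from
below, where v tends to infinity and the integral to log 2. -/
theorem travel_eq_integral_cothDiv {x : ℝ} (hx : x < 0) :
    -2 * travel x = (∫ y in (rate x / 2 / 2)..(rate x / 2), cothDiv y) - Real.log 2 := by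
  set F : ℝ → ℝ := fun x => -2 * travel x -
    ((∫ y in (rate x / 2 / 2)..(rate x / 2), cothDiv y) - Real.log 2) with hF
  have hd : ∀ z ∈ Iio (0 : ℝ), HasDerivAt F 0 z := by
    intro z hz
    have hr := rate_pos_of_neg hz
    have h1 := (hasDerivAt_integral_cothDiv_half (half_pos hr)).comp z
      ((hasDerivAt_rate hz).div_const 2)
    refine (((hasDerivAt_travel z).const_mul (-2)).sub (h1.sub_const (Real.log 2))).congr_deriv ?_
    have := Real.sinh_pos_iff.2 (half_pos hr)
    field_simp
    ring
  have hconst : ∀ z ∈ Iio (0 : ℝ), F z = F x := fun z hz =>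
    (convex_Iio (0 : ℝ)).is_const_of_fderivWithin_eq_zero (𝕜 := ℝ)
      (fun w hw => (hd w hw).differentiableAt.differentiableWithinAt)
      (fun w hw => by
        rw [fderivWithin_of_isOpen isOpen_Iio hw, (hd w hw).hasFDerivAt.fderiv]
        simp) hz hx
  have hlim : Tendsto F (𝓝[<] 0) (𝓝 0) := by
    have h1 : Tendsto (fun z => rate z / 2) (𝓝[<] 0) atTop :=
      (tendsto_rate_zero.mono_left (nhdsWithin_mono _ fun z hz => ne_of_lt hz)).atTop_div_const
        two_pos
    have h2 : Tendsto travel (𝓝[<] 0) (𝓝 0) := by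
      have := continuous_travel.tendsto 0
      rw [travel_zero] at this
      exact this.mono_left nhdsWithin_le_nhds
    have h3 := (h2.const_mul (-2)).sub ((tendsto_integral_cothDiv.comp h1).sub_const (Real.log 2))
    simpa [hF] using h3
  have h0 : F x = 0 := by
    refine tendsto_nhds_unique (tendsto_const_nhds.congr' ?_) hlim
    filter_upwards [self_mem_nhdsWithin] with z hz
    exact (hconst z hz).symm
  simp only [hF] at h0
  linarith

theorem exp_sub_sum_le {x : ℝ} (hx : |x| ≤ 1) :
    |Real.exp x - (1 + x + x ^ 2 / 2 + x ^ 3 / 6 + x ^ 4 / 24 + x ^ 5 / 120 + x ^ 6 / 720 +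
      x ^ 7 / 5040 + x ^ 8 / 40320 + x ^ 9 / 362880)| ≤ |x| ^ 10 / 3000000 := by
  have h := Real.exp_bound hx (n := 10) (by norm_num)
  simp only [Finset.sum_range_succ, Finset.sum_range_zero, Nat.factorial] at h
  norm_num at h
  refine h.trans ?_
  have : 0 ≤ |x| ^ 10 := by positivity
  linarith

theorem cosh_sinh_bounds {y : ℝ} (hy : 0 < y) (hy1 : y ≤ 1) :
    |Real.cosh y - (1 + y ^ 2 / 2 + y ^ 4 / 24 + y ^ 6 / 720 + y ^ 8 / 40320)| ≤
      y ^ 10 / 3000000 ∧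
    |Real.sinh y - (y + y ^ 3 / 6 + y ^ 5 / 120 + y ^ 7 / 5040 + y ^ 9 / 362880)| ≤
      y ^ 10 / 3000000 := by
  have h1 := exp_sub_sum_le (x := y) (by rwa [abs_of_pos hy])
  have h2 := exp_sub_sum_le (x := -y) (by rwa [abs_neg, abs_of_pos hy])
  rw [abs_neg, abs_of_pos hy, abs_le] at h2
  rw [abs_of_pos hy, abs_le] at h1
  rw [Real.cosh_eq, Real.sinh_eq, abs_le, abs_le]
  obtain ⟨h3, h4⟩ := h1
  obtain ⟨h5, h6⟩ := h2
  ring_nf at h3 h4 h5 h6 ⊢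
  refine ⟨⟨?_, ?_⟩, ?_, ?_⟩ <;> linarith

/-- Truncated Laurent series of coth(y)/y. The next term is -y⁶/4725; omitting it leaves room for
the Taylor remainders of cosh and sinh. In `taylor_le_cothDiv` the coefficient is enlarged to 1/2000
for the same purpose. -/
theorem cothDiv_le_taylor {y : ℝ} (hy : 0 < y) (hy1 : y ≤ 1) :
    cothDiv y ≤ 1 / y ^ 2 + 1 / 3 - y ^ 2 / 45 + 2 * y ^ 4 / 945 := by
  obtain ⟨h1, h2⟩ := cosh_sinh_bounds hy hy1
  have h3 := (abs_le.1 h1).2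
  have h4 := (abs_le.1 h2).1
  have hs := Real.sinh_pos_iff.2 hy
  have hy2 : y ^ 2 ≤ 1 := pow_le_one₀ hy.le hy1
  set Q := 1 + y ^ 2 / 3 - y ^ 4 / 45 + 2 * y ^ 6 / 945 with hQ
  have hQ0 : 0 ≤ Q := by
    rw [hQ]
    have : 0 ≤ y ^ 6 := by positivity
    nlinarith [sq_nonneg y]
  have hQ2 : Q ≤ 2 := by
    rw [hQ]
    have e1 : y ^ 6 ≤ 1 := pow_le_one₀ hy.le hy1
    have e2 : 0 ≤ y ^ 4 := by positivity
    linarith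
  rw [cothDiv, div_le_iff₀ (by positivity), show 1 / y ^ 2 + 1 / 3 - y ^ 2 / 45 + 2 * y ^ 4 / 945 =
    Q / y ^ 2 by rw [hQ]; field_simp, div_mul_eq_mul_div, le_div_iff₀ (by positivity)]
  have h5 : Real.cosh y * y ≤ Q * Real.sinh y := by
    have e1 := mul_le_mul_of_nonneg_left h4 hQ0
    have e2 := mul_le_mul_of_nonneg_right h3 hy.le
    have e3 : Q * (y ^ 10 / 3000000) ≤ 2 * (y ^ 10 / 3000000) :=
      mul_le_mul_of_nonneg_right hQ2 (by positivity)
    have e4 : y ^ 11 ≤ y ^ 9 := pow_le_pow_of_le_one hy.le hy1 (by norm_num)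
    have e5 : y ^ 10 ≤ y ^ 9 := pow_le_pow_of_le_one hy.le hy1 (by norm_num)
    have e6 : Q * (y + y ^ 3 / 6 + y ^ 5 / 120 + y ^ 7 / 5040 + y ^ 9 / 362880) =
        (1 + y ^ 2 / 2 + y ^ 4 / 24 + y ^ 6 / 720 + y ^ 8 / 40320) * y + (y ^ 9 / 4725 +
          (11 / 777600 * y ^ 11 + 41 / 114307200 * y ^ 13 + 1 / 171460800 * y ^ 15)) := by
      rw [hQ]; ring
    have e7 : 0 ≤ 11 / 777600 * y ^ 11 + 41 / 114307200 * y ^ 13 + 1 / 171460800 * y ^ 15 := by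
      positivity
    have e8 : 0 ≤ y ^ 9 := by positivity
    nlinarith
  nlinarith

theorem taylor_le_cothDiv {y : ℝ} (hy : 0 < y) (hy1 : y ≤ 1) :
    1 / y ^ 2 + 1 / 3 - y ^ 2 / 45 + 2 * y ^ 4 / 945 - y ^ 6 / 2000 ≤ cothDiv y := by
  obtain ⟨h1, h2⟩ := cosh_sinh_bounds hy hy1
  have h3 := (abs_le.1 h1).1
  have h4 := (abs_le.1 h2).2
  have hs := Real.sinh_pos_iff.2 hy
  have hy2 : y ^ 2 ≤ 1 := pow_le_one₀ hy.le hy1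
  set Q := 1 + y ^ 2 / 3 - y ^ 4 / 45 + 2 * y ^ 6 / 945 - y ^ 8 / 2000 with hQ
  have d1 : y ^ 8 ≤ y ^ 4 := pow_le_pow_of_le_one hy.le hy1 (by norm_num)
  have d2 : y ^ 4 ≤ y ^ 2 := pow_le_pow_of_le_one hy.le hy1 (by norm_num)
  have hQ0 : 0 ≤ Q := by
    rw [hQ]
    have : 0 ≤ y ^ 6 := by positivity
    nlinarith [sq_nonneg y]
  have hQ2 : Q ≤ 2 := by
    rw [hQ]
    have e1 : y ^ 6 ≤ 1 := pow_le_one₀ hy.le hy1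
    have e2 : 0 ≤ y ^ 4 := by positivity
    have e3 : 0 ≤ y ^ 8 := by positivity
    linarith
  rw [cothDiv, le_div_iff₀ (by positivity),
    show 1 / y ^ 2 + 1 / 3 - y ^ 2 / 45 + 2 * y ^ 4 / 945 - y ^ 6 / 2000 =
    Q / y ^ 2 by rw [hQ]; field_simp, div_mul_eq_mul_div, div_le_iff₀ (by positivity)]
  have h5 : Q * Real.sinh y ≤ Real.cosh y * y := by
    have e1 := mul_le_mul_of_nonneg_left h4 hQ0
    have e2 := mul_le_mul_of_nonneg_right h3 hy.le
    have e3 : Q * (y ^ 10 / 3000000) ≤ 2 * (y ^ 10 / 3000000) :=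
      mul_le_mul_of_nonneg_right hQ2 (by positivity)
    have e4 : y ^ 11 ≤ y ^ 9 := pow_le_pow_of_le_one hy.le hy1 (by norm_num)
    have e5 : y ^ 10 ≤ y ^ 9 := pow_le_pow_of_le_one hy.le hy1 (by norm_num)
    have e6 : Q * (y + y ^ 3 / 6 + y ^ 5 / 120 + y ^ 7 / 5040 + y ^ 9 / 362880) =
        (1 + y ^ 2 / 2 + y ^ 4 / 24 + y ^ 6 / 720 + y ^ 8 / 40320) * y - (109 / 378000 * y ^ 9 +
          (269 / 3888000 * y ^ 11 + 5441 / 1428840000 * y ^ 13 + 1601 / 17146080000 * y ^ 15 +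
            1 / 725760000 * y ^ 17)) := by
      rw [hQ]; ring
    have e7 : 0 ≤ 269 / 3888000 * y ^ 11 + 5441 / 1428840000 * y ^ 13 +
        1601 / 17146080000 * y ^ 15 + 1 / 725760000 * y ^ 17 := by positivity
    have e8 : 0 ≤ y ^ 9 := by positivity
    nlinarith
  nlinarith

theorem integral_taylor {v : ℝ} (hv : 0 < v) (k : ℝ) :
    IntervalIntegrable (fun y : ℝ => 1 / y ^ 2 + 1 / 3 - y ^ 2 / 45 + 2 * y ^ 4 / 945 - k * y ^ 6)
      volume (v / 2) v ∧
    ∫ y in (v / 2)..v, (1 / y ^ 2 + 1 / 3 - y ^ 2 / 45 + 2 * y ^ 4 / 945 - k * y ^ 6) =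
      1 / v + v / 6 - 7 * v ^ 3 / 1080 + 31 * v ^ 5 / 75600 - k * (127 * v ^ 7 / 896) := by
  have hpos : ∀ y ∈ uIcc (v / 2) v, 0 < y := fun y hy => (lt_min (half_pos hv) hv).trans_le hy.1
  have hint : IntervalIntegrable
      (fun y : ℝ => 1 / y ^ 2 + 1 / 3 - y ^ 2 / 45 + 2 * y ^ 4 / 945 - k * y ^ 6)
      volume (v / 2) v := by
    refine ContinuousOn.intervalIntegrable ?_
    have h1 : ContinuousOn (fun y : ℝ => 1 / y ^ 2) (uIcc (v / 2) v) :=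
      continuousOn_const.div (by fun_prop) fun y hy => (pow_pos (hpos y hy) 2).ne'
    fun_prop
  refine ⟨hint, ?_⟩
  rw [intervalIntegral.integral_eq_sub_of_hasDerivAt
    (f := fun y => -y⁻¹ + y / 3 - y ^ 3 / 135 + 2 * y ^ 5 / 4725 - k * y ^ 7 / 7) (fun y hy => ?_)
    hint]
  · field_simp
    ring
  · have hy0 := hpos y hy
    refine ((((hasDerivAt_inv hy0.ne').neg.add ((hasDerivAt_id y).div_const 3)).sub
      ((hasDerivAt_pow 3 y).div_const 135)).add
      (((hasDerivAt_pow 5 y).const_mul 2).div_const 4725)).sub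
      (((hasDerivAt_pow 7 y).const_mul k).div_const 7) |>.congr_deriv ?_
    field_simp
    norm_num
    ring

theorem integral_cothDiv_le {v : ℝ} (hv : 0 < v) (hv1 : v ≤ 1) :
    ∫ y in (v / 2)..v, cothDiv y ≤ 1 / v + v / 6 - 7 * v ^ 3 / 1080 + 31 * v ^ 5 / 75600 := by
  obtain ⟨h1, h2⟩ := integral_taylor hv 0
  have h3 := intervalIntegral.integral_mono_on (by linarith)
    (intervalIntegrable_cothDiv (half_pos hv) hv) h1 fun y hy => by
      have := cothDiv_le_taylor ((half_pos hv).trans_le hy.1) (hy.2.trans hv1)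
      rwa [zero_mul, sub_zero]
  rw [h2] at h3
  linarith

theorem le_integral_cothDiv {v : ℝ} (hv : 0 < v) (hv1 : v ≤ 1) :
    1 / v + v / 6 - 7 * v ^ 3 / 1080 + 31 * v ^ 5 / 75600 - 127 * v ^ 7 / 1792000 ≤
      ∫ y in (v / 2)..v, cothDiv y := by
  obtain ⟨h1, h2⟩ := integral_taylor hv (1 / 2000)
  have h3 := intervalIntegral.integral_mono_on (by linarith) h1
    (intervalIntegrable_cothDiv (half_pos hv) hv) fun y hy => by
      have := taylor_le_cothDiv ((half_pos hv).trans_le hy.1) (hy.2.trans hv1)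
      linarith
  rw [h2] at h3
  linarith

theorem half_rate_bounds {c : ℝ} (hc : c = 3.60585021) :
    0.5695682 ≤ rate (-Real.log c) / 2 ∧ rate (-Real.log c) / 2 ≤ 0.5695684 := by
  have h1 : rate (-Real.log c) / 2 = Real.log ((1 + c⁻¹) / (1 - c⁻¹)) := by
    rw [rate, Real.exp_neg, Real.exp_log (by rw [hc]; norm_num)]; ring
  have hpos : 0 < (1 + c⁻¹) / (1 - c⁻¹) := by rw [hc]; norm_num
  rw [h1]
  constructor
  · rw [Real.le_log_iff_exp_le hpos, hc]
    have := (abs_le.1 (exp_sub_sum_le (x := 0.5695682) (by norm_num [abs_of_pos]))).2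
    rw [abs_of_pos (by norm_num)] at this
    refine (sub_le_iff_le_add.1 this).trans ?_
    norm_num
  · rw [Real.log_le_iff_le_exp hpos, hc]
    have := (abs_le.1 (exp_sub_sum_le (x := 0.5695684) (by norm_num [abs_of_pos]))).1
    rw [abs_of_pos (by norm_num)] at this
    refine le_trans ?_ (le_sub_iff_add_le.1 this)
    norm_num

theorem log_bounds {c : ℝ} (hc : c = 3.60585021) :
    1.282554 ≤ Real.log c ∧ Real.log c ≤ 1.282561 := by
  -- Since c/4 is near 1, its logarithm is in the range of the enclosure of exp.
  have h1 : Real.log c = 2 * Real.log 2 + Real.log (c / 4) := by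
    rw [Real.log_div (by rw [hc]; norm_num) (by norm_num),
      show (4 : ℝ) = 2 ^ 2 by norm_num, Real.log_pow]
    push_cast; ring
  have hpos : 0 < c / 4 := by rw [hc]; norm_num
  have h2 := Real.log_two_gt_d9
  have h3 := Real.log_two_lt_d9
  have h4 : -0.103739 ≤ Real.log (c / 4) := by
    rw [Real.le_log_iff_exp_le hpos, hc]
    have := (abs_le.1 (exp_sub_sum_le (x := -0.103739) (by norm_num [abs_of_pos]))).2
    rw [abs_neg, abs_of_pos (by norm_num)] at this
    refine (sub_le_iff_le_add.1 this).trans ?_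
    norm_num
  have h5 : Real.log (c / 4) ≤ -0.103735 := by
    rw [Real.log_le_iff_le_exp hpos, hc]
    have := (abs_le.1 (exp_sub_sum_le (x := -0.103735) (by norm_num [abs_of_pos]))).1
    rw [abs_neg, abs_of_pos (by norm_num)] at this
    refine le_trans ?_ (le_sub_iff_add_le.1 this)
    norm_num
  rw [h1]
  constructor <;> norm_num at * <;> linarith

/-- The accuracy is chosen for the five digits of β₀: 0.929955² · 1.156315 > 1 > 0.929945² ·
1.156339. -/
theorem travel_bounds {c : ℝ} (hc : c = 3.60585021) :
    1.156315 < -2 * travel (-Real.log c) ∧ -2 * travel (-Real.log c) < 1.156339 := by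
  have hlc : -Real.log c < 0 := by
    have := (log_bounds hc).1
    norm_num at this ⊢
    linarith
  rw [travel_eq_integral_cothDiv hlc]
  obtain ⟨h1, h2⟩ := half_rate_bounds hc
  set v := rate (-Real.log c) / 2
  have hv : 0 < v := by norm_num at h1; linarith
  have hv1 : v ≤ 1 := by norm_num at h2; linarith
  have h3 := integral_cothDiv_le hv hv1
  have h4 := le_integral_cothDiv hv hv1
  have h5 := Real.log_two_gt_d9
  have h6 := Real.log_two_lt_d9
  have e1 : 1 / v ≤ 1 / 0.5695682 := one_div_le_one_div_of_le (by norm_num) h1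
  have e2 : 1 / 0.5695684 ≤ 1 / v := one_div_le_one_div_of_le hv h2
  have p3 := pow_le_pow_left₀ (by norm_num) h1 3
  have p5 := pow_le_pow_left₀ (by norm_num) h1 5
  have q3 := pow_le_pow_left₀ hv.le h2 3
  have q5 := pow_le_pow_left₀ hv.le h2 5
  have q7 := pow_le_pow_left₀ hv.le h2 7
  constructor <;> norm_num at * <;> linarith

theorem isThreshold_iff_sq {c β : ℝ} (hc : 1 < c) :
    IsThreshold c β ↔ 0 < β ∧ β ^ 2 * (-2 * travel (-Real.log c)) = 1 := by
  rw [isThreshold_iff]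
  refine and_congr_right fun hβ => ?_
  simp only [hc, true_and, clock]
  field_simp
  constructor <;> intro h <;> linarith

theorem threshold_values {c β : ℝ} (hc : c = 3.60585021) (hβ : 0 < β)
    (h : β ^ 2 * (-2 * travel (-Real.log c)) = 1) :
    0.929945 < β ∧ β < 0.929955 := by
  obtain ⟨h1, h2⟩ := travel_bounds hc
  set J := -2 * travel (-Real.log c)
  constructor
  · by_contra! hle
    have e1 := pow_le_pow_left₀ hβ.le hle 2
    have : 0 < β ^ 2 := by positivity
    norm_num at *
    nlinarith
  · by_contra! hle
    have e1 := pow_le_pow_left₀ (by norm_num) hle 2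
    norm_num at *
    nlinarith

end RoughKernel
end

/-! ### Assembly of the theorem -/

noncomputable section

namespace RoughKernel

theorem existsUnique_threshold : ∃! β₀ : ℝ, IsThreshold 3.60585021 β₀ := by
  have hc : (1 : ℝ) < 3.60585021 := by norm_num
  simp only [isThreshold_iff_sq hc]
  have hJ := (travel_bounds rfl).1
  set J := -2 * travel (-Real.log 3.60585021)
  have hJ0 : 0 < J := by norm_num at hJ; linarith
  refine ⟨√(1 / J), ⟨Real.sqrt_pos.2 (by positivity), ?_⟩, ?_⟩
  · rw [Real.sq_sqrt (by positivity), div_mul_cancel₀ _ hJ0.ne']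
  · rintro β ⟨hβ, h⟩
    rw [← h, mul_div_cancel_right₀ _ hJ0.ne', Real.sqrt_sq hβ.le]

theorem threshold_solution_values {β₀ : ℝ} (hβ : 0 < β₀) {η : ℝ → ℝ}
    (h : ExplodesAtOne 3.60585021 β₀ η) :
    |β₀ - 0.92995| < 0.000005 ∧
      ∃ η₁ : ℝ, Tendsto η (𝓝[<] 1) (𝓝 η₁) ∧ |η₁ / β₀ - 2.3854| < 0.00005 := by
  have hc : (1 : ℝ) < 3.60585021 := by norm_num
  obtain ⟨h1, h2⟩ :=
    threshold_values rfl hβ ((isThreshold_iff_sq hc).1 ⟨hβ, η, h⟩).2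
  obtain ⟨h3, h4⟩ := log_bounds rfl
  refine ⟨by rw [abs_lt]; norm_num at *; constructor <;> linarith, _,
    tendsto_of_explodes h hβ, ?_⟩
  have e : 2 * β₀ ^ 2 * Real.log 3.60585021 / β₀ = 2 * (β₀ * Real.log 3.60585021) := by
    field_simp
  rw [e, abs_lt]
  have e1 := mul_le_mul h1.le h3 (by norm_num) hβ.le
  have e2 := mul_le_mul h2.le h4 ((by norm_num : (0 : ℝ) ≤ 1.282554).trans h3) (by norm_num)
  norm_num at *
  constructor <;> linarith

section

variable {c₀ β₀ H T a : ℝ}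

theorem eventually_frequently_lt_kernelError (h : IsThreshold c₀ β₀) (hH : -1 / 2 < H)
    (hH' : H < 1 / 2) (hT : 0 < T) (ha : 0 < a) {γ : ℝ} (hγ : 0 < γ) (C : ℝ) :
    ∀ᶠ p : ℝ × ℝ in 𝓝[admissible c₀ β₀] (c₀, β₀),
      ∃ᶠ N : ℕ in atTop, ∃ x w, IsNonGeometricRule H p.1 p.2 a N x w ∧
        (1 + C * Real.exp (-γ * √N)) * leadingTerm H p.1 p.2 a N < kernelError H T x w := by
  obtain ⟨hβ, hc, -⟩ := isThreshold_iff.1 h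
  have hα : 0 < √(1 / 2 + H) := Real.sqrt_pos.2 (by linarith)
  have t1 : Tendsto (fun p : ℝ × ℝ => 2 * -endPoint p.1 p.2) (𝓝[admissible c₀ β₀] (c₀, β₀))
      (𝓝 0) := by
    simpa using ((tendsto_endPoint h).mono_left nhdsWithin_le_nhds).neg.const_mul 2
  have t2 : Tendsto (fun p : ℝ × ℝ => γ / (p.2 * √(1 / 2 + H)))
      (𝓝[admissible c₀ β₀] (c₀, β₀)) (𝓝 (γ / (β₀ * √(1 / 2 + H)))) := by
    have : ContinuousAt (fun p : ℝ × ℝ => γ / (p.2 * √(1 / 2 + H))) (c₀, β₀) :=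
      continuousAt_const.div (by fun_prop) (mul_pos hβ hα).ne'
    exact this.tendsto.mono_left nhdsWithin_le_nhds
  filter_upwards [t1.eventually_lt t2 (by positivity), self_mem_nhdsWithin] with p hp hadm
  have hcl := clock_one_neg_of_admissible h hadm
  have hβ' : 0 < p.2 := hβ.trans_le hadm.2.1
  have hc' : 1 < p.1 := hc.trans_le hadm.1
  refine Eventually.frequently ?_
  filter_upwards [eventually_lt_kernelError hH hH' hβ' hc' hcl hT ha hγ C hp,
    eventually_gridNeg hH hβ' hc' hcl a] with N h1 h2
  obtain ⟨x, w, hR⟩ := h2.1.exists_rule hH hH' (by linarith) ha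
  exact ⟨x, w, hR, h1 x w hR⟩

/-- In the exponent of the constant both rate(V) and `lag` tend to infinity at the threshold, while
log c stays bounded. -/
theorem eventually_eventually_le_leadingTerm (h : IsThreshold c₀ β₀) (hH : -1 / 2 < H)
    (hH' : H < 1 / 2) (ha : 0 < a) (C : ℝ) :
    ∀ᶠ p : ℝ × ℝ in 𝓝[admissible c₀ β₀] (c₀, β₀), ∀ᶠ N : ℕ in atTop,
      C * Real.exp (-(etaSolution p.1 p.2 1 / p.2) * √((H + 1 / 2) * N)) ≤
        leadingTerm H p.1 p.2 a N := by
  obtain ⟨hβ, hc, -⟩ := isThreshold_iff.1 h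
  have hα : 0 < 1 / 2 + H := by linarith
  have hκ : 0 < cH H / (H + 1 / 2) := div_pos (cH_pos hH hH') (by linarith)
  have t1 : Tendsto (fun p : ℝ × ℝ => (1 / 2 + H) * (rate (endPoint p.1 p.2) / 2 *
      lag H p.1 p.2 a)) (𝓝[admissible c₀ β₀] (c₀, β₀)) atTop :=
    (((tendsto_rate_endPoint h).atTop_div_const two_pos).atTop_mul_atTop₀
      (tendsto_lag a h)).const_mul_atTop hα
  have t2 : Tendsto (fun p : ℝ × ℝ => -Real.log p.1) (𝓝[admissible c₀ β₀] (c₀, β₀))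
      (𝓝 (-Real.log c₀)) := by
    have : ContinuousAt (fun p : ℝ × ℝ => -Real.log p.1) (c₀, β₀) :=
      (continuousAt_fst.log (by simp only; linarith)).neg
    exact this.tendsto.mono_left nhdsWithin_le_nhds
  have t3 := (Real.tendsto_exp_atTop.comp (t1.atTop_add t2)).const_mul_atTop hκ
  filter_upwards [t3.eventually_ge_atTop C, (tendsto_lag (H := H) a h).eventually_ge_atTop 0,
    self_mem_nhdsWithin] with p h1 h2 hadm
  exact eventually_le_leadingTerm hH hH' (hβ.trans_le hadm.2.1) (hc.trans_le hadm.1)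
    (clock_one_neg_of_admissible h hadm) ha h2 h1

end

end RoughKernel
end

theorem mainTheorem8 :
    -- The threshold values.
    ((∃! β₀ : ℝ, RoughKernel.IsThreshold 3.60585021 β₀) ∧
      ∀ β₀ : ℝ, 0 < β₀ → ∀ η : ℝ → ℝ, RoughKernel.ExplodesAtOne 3.60585021 β₀ η →
        |β₀ - 0.92995| < 0.000005 ∧
        ∃ η₁ : ℝ, Tendsto η (𝓝[<] 1) (𝓝 η₁) ∧ |η₁ / β₀ - 2.3854| < 0.00005) ∧
    -- The error bounds.
    ∀ c₀ β₀ : ℝ, RoughKernel.IsThreshold c₀ β₀ →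
      ∃ η : ℝ → ℝ → ℝ → ℝ,
        (∀ c β : ℝ, (c, β) ∈ RoughKernel.admissible c₀ β₀ →
          RoughKernel.IsEtaSolution c β (Icc 0 1) (η c β)) ∧
        ∀ H T a : ℝ, -1 / 2 < H → H < 1 / 2 → 0 < T → 0 < a →
          (∀ c β : ℝ, (c, β) ∈ RoughKernel.admissible c₀ β₀ →
            -- The rule is well defined for all large `N`.
            (∀ᶠ N : ℕ in atTop, ∃ x w, RoughKernel.IsNonGeometricRule H c β a N x w) ∧
            -- The first bound, with the leading constant.
            (∀ ε : ℝ, 0 < ε → ∀ᶠ N : ℕ in atTop, ∀ x w,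
              RoughKernel.IsNonGeometricRule H c β a N x w →
                RoughKernel.kernelError H T x w ≤
                  (1 + ε) * RoughKernel.leadingTerm H c β a N) ∧
            -- The size of the bound.
            (fun N : ℕ => RoughKernel.leadingTerm H c β a N) =Θ[atTop]
              (fun N : ℕ => Real.exp (-(η c β 1 / β) * √((H + 1 / 2) * N)))) ∧
          -- The higher order terms in the first bound explode at the threshold.
          (∀ γ C : ℝ, 0 < γ →
            ∀ᶠ p : ℝ × ℝ in 𝓝[RoughKernel.admissible c₀ β₀] (c₀, β₀),
              ∃ᶠ N : ℕ in atTop, ∃ x w, RoughKernel.IsNonGeometricRule H p.1 p.2 a N x w ∧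
                (1 + C * Real.exp (-γ * √N)) * RoughKernel.leadingTerm H p.1 p.2 a N <
                  RoughKernel.kernelError H T x w) ∧
          -- The leading constant in the second bound explodes at the threshold.
          (∀ C : ℝ, ∀ᶠ p : ℝ × ℝ in 𝓝[RoughKernel.admissible c₀ β₀] (c₀, β₀),
            ∀ᶠ N : ℕ in atTop,
              C * Real.exp (-(η p.1 p.2 1 / p.2) * √((H + 1 / 2) * N)) ≤
                RoughKernel.leadingTerm H p.1 p.2 a N) := by
  refine ⟨⟨RoughKernel.existsUnique_threshold,
    fun β₀ hβ η h => RoughKernel.threshold_solution_values hβ h⟩, fun c₀ β₀ h => ?_⟩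
  obtain ⟨hβ₀, hc₀, -⟩ := RoughKernel.isThreshold_iff.1 h
  refine ⟨RoughKernel.etaSolution, fun c β hp => ?_, fun H T a hH hH' hT ha =>
    ⟨fun c β hp => ?_, fun γ C hγ =>
      RoughKernel.eventually_frequently_lt_kernelError h hH hH' hT ha hγ C,
      fun C => RoughKernel.eventually_eventually_le_leadingTerm h hH hH' ha C⟩⟩
  · have hβ : 0 < β := hβ₀.trans_le hp.2.1
    refine RoughKernel.isEtaSolution_etaSolution (by linarith [hp.1]) hβ fun t ht => ?_
    exact ((RoughKernel.clock_strictMono hβ).monotone ht.2).trans_lt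
      (RoughKernel.clock_one_neg_of_admissible h hp)
  · have hβ : 0 < β := hβ₀.trans_le hp.2.1
    have hc : 1 < c := hc₀.trans_le hp.1
    have hcl := RoughKernel.clock_one_neg_of_admissible h hp
    refine ⟨?_, fun ε hε => RoughKernel.eventually_kernelError_le hH hH' hβ hc hcl hT ha hε,
      RoughKernel.leadingTerm_isTheta hH hH' hβ hc hcl ha⟩
    filter_upwards [RoughKernel.eventually_gridNeg hH hβ hc hcl a] with N hN
    exact hN.1.exists_rule hH hH' (by linarith) ha
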